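/- **Setting.** Let $d\ge 1$, let $\mathbb X\subseteq\mathbb R^d$ be compact, and let $(x_j,y_j)_{j\ge1}$ be i.i.d. copies of $(X,Y)$ with law $P$, where $X\in\mathbb X$ and $Y\in\{+1,-1\}$. Assume that the law $P_{\mathbb X}$ of $X$ is absolutely continuous and that its support is the whole of $\mathbb X$, in the sense that its density is positive at Lebesgue-almost every point of $\mathbb X$. Let $\{f_\theta:\mathbb X\to[-1,1] \mid \theta\in\Theta\}$ ($\Theta$ an arbitrary set) be functions in $L^2(P_{\mathbb X})$ with $\int (f_{\theta_1}-f_{\theta_2})^2\,dP_{\mathbb X}\ne 0$ whenever $\theta_1\ne\theta_2$, and let $\theta^*\in\Theta$ be such that $f_{\theta^*}(X)=\mathbb E[Y\mid X]$ almost surely. **Algorithm I.** Fix integers $m\ge 3$, $1\le q\le m$, and window sizes $k_n\le n$. For a sample size $n$ and a candidate $\theta$ put $y_{0,j}(\theta)=y_j$ and, given $(x_j,y_j)_{j\le n}$, generate labels $y_{i,j}(\theta)\in\{+1,-1\}$, $1\le i\le m-1$, $1\le j\le n$, independently with $\mathbb P(y_{i,j}(\theta)=\pm1)=(1\pm f_\theta(x_j))/2$.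 (For different $n$ the labels may be initial segments of the same sequences or be generated anew.) Let $\pi$ be a uniformly distributed random permutation of $\{0,\dots,m-1\}$, independent of these datasets. Let $$f^{(i)}_{\theta,n}(x)=\frac1{k_n}\sum_{j=1}^n y_{i,j}(\theta)\,\mathbb I\big(x_j\in N(x,k_n)\big),\qquad Z^{(i)}_n(\theta)=\sum_{j=0}^{m-1}\int_{\mathbb X}\big(f^{(i)}_{\theta,n}(x)-f^{(j)}_{\theta,n}(x)\big)^2dx ,$$ where $N(x,k_n)$ is the set of the $k_n$ nearest neighbours of $x$ among $x_1,\dots,x_n$ in the Euclidean distance (ties, which have probability zero, go to the smaller index). Write $Z_a\prec_\pi Z_b$ if $Z_a<Z_b$, or $Z_a=Z_b$ and $\pi(a)<\pi(b)$. The rank of the original dataset is $$\mathcal R_n(\theta)=1+\sum_{i=1}^{m-1}\mathbb I\big(Z^{(i)}_n(\theta)\prec_\pi Z^{(0)}_n(\theta)\big),$$ and the confidence region is $\Theta_n=\{\theta\in\Theta:\mathcal R_n(\theta)\le q\}$. **Theorem.** For every sample size $n$, $$\mathbb P(\theta^*\in\Theta_n)=\frac qm .$$ Moreover, if $q<m$,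 $k_n\to\infty$ and $k_n/n\to0$ as $n\to\infty$, then the regions are strongly consistent: for every $\theta\in\Theta$ with $\theta\ne\theta^*$, $$\mathbb P\Big(\bigcap_{N=1}^\infty\bigcup_{n=N}^\infty\{\theta\in\Theta_n\}\Big)=0 .$$ -/

import Mathlib

open MeasureTheory ProbabilityTheory Filter Topology
open scoped ENNReal

noncomputable section

/-- Euclidean space `ℝ^d`, containing the input space. -/
abbrev Inp (d : ℕ) : Type := EuclideanSpace ℝ (Fin d)

/-- The output space `{+1, -1}`: the units of `ℤ`. -/
abbrev Label : Type := ℤˣ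

instance instMeasurableSingletonLabel : MeasurableSingletonClass Label where
  measurableSet_singleton s :=
    ⟨{(s : ℤ)}, MeasurableSet.of_discrete, by ext t; simp [Units.ext_iff]⟩

/-- The real number `+1` or `-1` given by a label. -/
def Label.toReal (s : Label) : ℝ := ((s : ℤ) : ℝ)

/-! ### The standing assumptions on the distribution and on the family of candidates -/

/-- Assumptions on the law `P` of `(X, Y)` that only concern the input: `𝕏` is compact, the input law
lives on `𝕏`, is absolutely continuous (with respect to Lebesgue measure), and its support is the
whole of `𝕏`, in the sense that its density is positive almost everywhere on `𝕏`. -/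
structure InputAssumptions {d : ℕ} (𝕏 : Set (Inp d)) (P : Measure (Inp d × Label)) : Prop where
  compact : IsCompact 𝕏
  mem_ae : ∀ᵐ x ∂P.fst, x ∈ 𝕏
  absCont : P.fst ≪ volume
  fullSupport : (volume.restrict 𝕏) ≪ P.fst

/-- `f` is an indexed family of candidate regression functions `𝕏 → [-1, 1]`, square integrable with
respect to the input law, injectively parametrized up to the `L²`-distance of the input law, and
containing the true regression function `x ↦ E[Y | X = x]`, with parameter `θstar`. -/
structure IsRegressionFamily {d : ℕ} {Θ : Type*} (𝕏 : Set (Inp d)) (P : Measure (Inp d × Label))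
    (f : Θ → Inp d → ℝ) (θstar : Θ) : Prop where
  range : ∀ θ, ∀ x ∈ 𝕏, f θ x ∈ Set.Icc (-1 : ℝ) 1
  memLp : ∀ θ, MemLp (f θ) 2 P.fst
  injective : ∀ θ₁ θ₂, θ₁ ≠ θ₂ → ∫ x, (f θ₁ x - f θ₂ x) ^ 2 ∂P.fst ≠ 0
  regression : P[fun s => s.2.toReal | MeasurableSpace.comap Prod.fst inferInstance]
    =ᵐ[P] fun s => f θstar s.1

/-! ### Resampling -/

/-- The probability `P_θ(Y = s | X = x)`, where `t = f_θ(x)`: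
it is `(t + 1) / 2` for `s = +1` and `(1 - t) / 2` for `s = -1`. -/
def labelProb (t : ℝ) (s : Label) : ℝ≥0∞ := ENNReal.ofReal ((1 + s.toReal * t) / 2)

/-- The random mechanism. `(x j, y₀ j)`, `j = 0, 1, …`, is the observed i.i.d. sequence with law `P`.
For sample size `n` and candidate `θ`, `y n θ i j` is the label number `j` of the dataset number `i`;
dataset `0` is the original one. `π n` is the tie-breaking permutation. The alternative labels for
different `n` may be newly generated or be initial segments of the same sequences (any joint
behaviour in `n` and in `θ` is allowed), and likewise for the permutations. -/
structure IsResampling {d m : ℕ} [NeZero m] {Θ Ω : Type*} [MeasurableSpace Ω] (μ : Measure Ω)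
    (P : Measure (Inp d × Label)) (f : Θ → Inp d → ℝ)
    (x : ℕ → Ω → Inp d) (y₀ : ℕ → Ω → Label)
    (y : (n : ℕ) → Θ → Fin m → Fin n → Ω → Label) (π : ℕ → Ω → Equiv.Perm (Fin m)) : Prop where
  measurable_x : ∀ j, Measurable (x j)
  measurable_y₀ : ∀ j, Measurable (y₀ j)
  measurable_y : ∀ n θ i j, Measurable (y n θ i j)
  measurable_π : ∀ n σ, MeasurableSet {ω | π n ω = σ}
  indep : iIndepFun (fun j ω => (x j ω, y₀ j ω)) μ
  law : ∀ j, μ.map (fun ω => (x j ω, y₀ j ω)) = P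
  original : ∀ n θ (j : Fin n) ω, y n θ 0 j ω = y₀ j ω
  /-- Given the original sample of size `n`, the alternative labels `y n θ i j`, `i ≠ 0`, are
  independent, and `y n θ i j` has the distribution `P_θ(Y = · | X = x j)`. -/
  resample : ∀ n θ (A : Set (Fin n → Inp d × Label)), MeasurableSet A →
    ∀ s : {i : Fin m // i ≠ 0} → Fin n → Label,
      μ {ω | (fun j : Fin n => (x j ω, y₀ j ω)) ∈ A ∧
          ∀ (i : {i : Fin m // i ≠ 0}) (j : Fin n), y n θ i j ω = s i j}
        = ∫⁻ ω in {ω | (fun j : Fin n => (x j ω, y₀ j ω)) ∈ A},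
            ∏ i, ∏ j : Fin n, labelProb (f θ (x j ω)) (s i j) ∂μ
  /-- `π n` is uniformly distributed on the permutations and independent of all the datasets. -/
  permutation : ∀ n θ (B : Set (Fin m → Fin n → Inp d × Label)), MeasurableSet B →
    ∀ σ : Equiv.Perm (Fin m),
      μ {ω | (fun i (j : Fin n) => (x j ω, y n θ i j ω)) ∈ B ∧ π n ω = σ}
        = μ {ω | (fun i (j : Fin n) => (x j ω, y n θ i j ω)) ∈ B} * (m.factorial : ℝ≥0∞)⁻¹

/-! ### The algorithm -/

open Classical in
/-- `x j` is among the `k` nearest neighbours of `z` in the sample `x` (Euclidean distance; ties,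
which have probability zero, go to the smaller index). -/
def IsNeighbor {d n : ℕ} (x : Fin n → Inp d) (k : ℕ) (z : Inp d) (j : Fin n) : Prop :=
  (Finset.univ.filter fun l : Fin n =>
    dist (x l) z < dist (x j) z ∨ (dist (x l) z = dist (x j) z ∧ l < j)).card < k

open Classical in
/-- The `k`-nearest-neighbour regression estimate of the labelled sample `(x, y)` at `z`. -/
def knnEstimate {d n : ℕ} (k : ℕ) (x : Fin n → Inp d) (y : Fin n → Label) (z : Inp d) : ℝ :=
  1 / (k : ℝ) * ∑ j, (y j).toReal * (if IsNeighbor x k z j then 1 else 0)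

/-- The squared `L²`-distance of `f` and `g` on `𝕏` for Lebesgue measure. -/
def sqDist {d : ℕ} (𝕏 : Set (Inp d)) (f g : Inp d → ℝ) : ℝ := ∫ z in 𝕏, (f z - g z) ^ 2

/-- `Z^{(i)}`: the total squared distance of the estimate of dataset `i` from all the estimates. -/
def totalDist {d n m : ℕ} (𝕏 : Set (Inp d)) (k : ℕ) (x : Fin n → Inp d)
    (y : Fin m → Fin n → Label) (i : Fin m) : ℝ :=
  ∑ j, sqDist 𝕏 (knnEstimate k x (y i)) (knnEstimate k x (y j))

/-- The order `Z a ≺_π Z b`: the usual `<`, with ties broken by the permutation `π`. -/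
def Precedes {m : ℕ} (π : Equiv.Perm (Fin m)) (Z : Fin m → ℝ) (a b : Fin m) : Prop :=
  Z a < Z b ∨ (Z a = Z b ∧ π a < π b)

open Classical in
/-- The rank of `Z 0` among `Z 0, …, Z (m - 1)` in the increasing order `≺_π`; it is `m` if `Z 0` is
the largest. -/
def rankZero {m : ℕ} [NeZero m] (π : Equiv.Perm (Fin m)) (Z : Fin m → ℝ) : ℕ :=
  1 + (Finset.univ.filter fun i : Fin m => i ≠ 0 ∧ Precedes π Z i 0).card

/-- The confidence region of Algorithm I. -/
def confidenceRegion {d n m : ℕ} [NeZero m] {Θ : Type*} (𝕏 : Set (Inp d)) (k q : ℕ)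
    (x : Fin n → Inp d) (y : Θ → Fin m → Fin n → Label) (π : Equiv.Perm (Fin m)) : Set Θ :=
  {θ | rankZero π (totalDist 𝕏 k x (y θ)) ≤ q}

/-- The confidence region based on the sample of size `n`, with window size `k n`, at the outcome
`ω`. -/
def randomRegion {d m : ℕ} [NeZero m] {Θ Ω : Type*} (𝕏 : Set (Inp d)) (k : ℕ → ℕ) (q : ℕ)
    (x : ℕ → Ω → Inp d) (y : (n : ℕ) → Θ → Fin m → Fin n → Ω → Label)
    (π : ℕ → Ω → Equiv.Perm (Fin m)) (n : ℕ) (ω : Ω) : Set Θ :=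
  confidenceRegion 𝕏 (k n) q (fun j : Fin n => x j ω) (fun θ i j => y n θ i j ω) (π n ω)

end

/-! Coverage. A measurable version `g` of the true regression function determines the law of (X, Y)
(`eq_labelLaw_of_condExp`): given the inputs, the original labels are drawn by the mechanism that
generates the alternative ones. At the true parameter the m datasets thus share their inputs and
have conditionally i.i.d. labels, so they are exchangeable (`IsResampling.measure_datasets_perm`).
Ties being broken by a uniform permutation, all datasets are equally likely to be among the q first;
exactly q of them are, so each has probability q/m.

Consistency. The nearest neighbour estimate of the original dataset converges to the true regression
function, that of every alternative dataset to the candidate. If Δ is the squared distance of the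
two on 𝕏 for Lebesgue measure, the total distances converge almost surely to (m - 1)Δ for the
original dataset and to Δ for the others. Here Δ > 0, and m ≥ 3 separates the limits, so eventually
the original dataset has rank m > q.

The analytic core is the strong L¹ consistency of nearest neighbour regression
(`ae_tendsto_knnError`). Since samples of different sizes may depend on each other arbitrarily, only
the law at each single size is available, and tail bounds summable in n are needed for
Borel-Cantelli. They come from the fourth central moment of the integrated error, which is O(1/n²),
once the mean error is known to vanish.

The moment bound is of Efron-Stein type (`integral_sub_integral_pow_four_le_of_leaveOneOut`): it
suffices to know how much the error changes when one sample point is left out. That is at most 2/k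
times the mass of the cell of the point, that is, of the set of z having it as a neighbour. The cell
mass is of order k/n in fourth moment, for two reasons. By a Chernoff bound, u is a neighbour of z
with probability exponentially small in n/k times the mass of the ball around z through u. By
Stone's cone covering, the z for which this ball has mass at most a form a set of mass at most
proportional to a, whatever the law (`measure_setOf_measure_ball_le`).

The mean error vanishes by Stone's argument (`tendsto_integral_knnError`): the noise averages out
over k neighbours, the regression function is replaced by a continuous function at a cost controlled
by the first moment of the cell mass, and neighbours are close because k/n → 0. Everything is proved
for the input law; absolute continuity of Lebesgue measure on 𝕏 with respect to it carries the
convergence over to the distances used by the algorithm. -/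

/-! ### Splitting off one coordinate of a finite power of a probability measure -/

section PiSplit

variable {E : Type*} [MeasurableSpace E] (Q : Measure E) [IsProbabilityMeasure Q]

lemma measurable_insertNth {n : ℕ} (j : Fin (n + 1)) :
    Measurable (fun p : E × (Fin n → E) => (j.insertNth p.1 p.2 : Fin (n + 1) → E)) :=
  (MeasurableEquiv.piFinSuccAbove (fun _ : Fin (n + 1) => E) j).symm.measurable

lemma integral_pi_insertNth {n : ℕ} (j : Fin (n + 1)) (F : (Fin (n + 1) → E) → ℝ) :
    ∫ w, F w ∂(Measure.pi fun _ => Q)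
      = ∫ p, F (j.insertNth p.1 p.2) ∂(Q.prod (Measure.pi fun _ : Fin n => Q)) :=
  ((measurePreserving_piFinSuccAbove (fun _ : Fin (n + 1) => Q) j).symm.integral_comp' F).symm

lemma lintegral_pi_insertNth {n : ℕ} (j : Fin (n + 1)) (F : (Fin (n + 1) → E) → ℝ≥0∞) :
    ∫⁻ w, F w ∂(Measure.pi fun _ => Q)
      = ∫⁻ p, F (j.insertNth p.1 p.2) ∂(Q.prod (Measure.pi fun _ : Fin n => Q)) :=
  ((measurePreserving_piFinSuccAbove (fun _ : Fin (n + 1) => Q) j).symm.lintegral_comp_emb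
    (MeasurableEquiv.measurableEmbedding _) F).symm

end PiSplit

/-! ### A fourth moment inequality of Efron-Stein type -/

section FourthMoment

lemma integrable_of_measurable_of_abs_le {Ω : Type*} [MeasurableSpace Ω] {μ : Measure Ω}
    [IsFiniteMeasure μ] {F : Ω → ℝ} (hF : Measurable F) (C : ℝ) (h : ∀ ω, |F ω| ≤ C) :
    Integrable F μ :=
  Integrable.of_bound hF.aestronglyMeasurable C (ae_of_all _ h)

lemma abs_pow_le_pow_of_abs_le {a C : ℝ} (h : |a| ≤ C) (p : ℕ) : |a ^ p| ≤ C ^ p := by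
  rw [abs_pow]; exact pow_le_pow_left₀ (abs_nonneg _) h p

lemma pow_four_sub_le (u v : ℝ) : (u - v) ^ 4 ≤ 8 * u ^ 4 + 8 * v ^ 4 := by
  nlinarith [sq_nonneg (u + v), sq_nonneg (u - v), sq_nonneg (u ^ 2 - v ^ 2),
    sq_nonneg ((u + v) ^ 2), mul_nonneg (sq_nonneg (u + v)) (sq_nonneg (u - v)),
    mul_nonneg (sq_nonneg (u + v)) (sq_nonneg (u + v)), sq_nonneg (u * v), sq_nonneg (u^2+v^2)]

lemma abs_integral_le_of_abs_le {Ω : Type*} [MeasurableSpace Ω] {μ : Measure Ω}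
    [IsProbabilityMeasure μ] {F : Ω → ℝ} {C : ℝ} (h : ∀ ω, |F ω| ≤ C) : |∫ ω, F ω ∂μ| ≤ C := by
  simpa using norm_integral_le_of_norm_le_const (μ := μ) (f := F) (ae_of_all _ h)

lemma integral_pow_four_le {Ω : Type*} [MeasurableSpace Ω] {μ : Measure Ω}
    [IsProbabilityMeasure μ] {F : Ω → ℝ} (hF : Measurable F) {C : ℝ} (h : ∀ ω, |F ω| ≤ C) :
    (∫ ω, F ω ∂μ) ^ 4 ≤ ∫ ω, F ω ^ 4 ∂μ :=
  (Even.convexOn_pow (by decide : Even 4)).map_integral_le (by fun_prop) isClosed_univ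
    (by simp) (integrable_of_measurable_of_abs_le hF C h)
    (integrable_of_measurable_of_abs_le (hF.pow_const 4) (C ^ 4)
      fun ω => abs_pow_le_pow_of_abs_le (h ω) 4)

/-- A fourth moment form of Pythagoras: when S³D integrates to zero, the square root of the fourth
moment grows only additively. Summing n increments therefore gives a fourth moment of order n², as
for independent centred variables. -/
lemma integral_add_pow_four_le {Ω : Type*} [MeasurableSpace Ω] {μ : Measure Ω}
    [IsProbabilityMeasure μ] {S D : Ω → ℝ} (hS : Measurable S) (hD : Measurable D) {C : ℝ}
    (hSC : ∀ ω, |S ω| ≤ C) (hDC : ∀ ω, |D ω| ≤ C) (horth : ∫ ω, S ω ^ 3 * D ω ∂μ = 0)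
    {a b : ℝ} (ha : 0 < a) (hb : 0 < b) (hSa : ∫ ω, S ω ^ 4 ∂μ ≤ a ^ 2)
    (hDb : ∫ ω, D ω ^ 4 ∂μ ≤ b ^ 2) :
    ∫ ω, (S ω + D ω) ^ 4 ∂μ ≤ (a + 4 * b) ^ 2 := by
  have i1 : Integrable (fun ω => S ω ^ 4) μ := integrable_of_measurable_of_abs_le (hS.pow_const 4)
    (C ^ 4) fun ω => abs_pow_le_pow_of_abs_le (hSC ω) 4
  have i2 : Integrable (fun ω => D ω ^ 4) μ := integrable_of_measurable_of_abs_le (hD.pow_const 4)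
    (C ^ 4) fun ω => abs_pow_le_pow_of_abs_le (hDC ω) 4
  have i3 : Integrable (fun ω => S ω ^ 3 * D ω) μ :=
    integrable_of_measurable_of_abs_le ((hS.pow_const 3).mul hD) (C ^ 3 * C) fun ω => by
      rw [abs_mul]
      have hC : 0 ≤ C := (abs_nonneg _).trans (hSC ω)
      exact mul_le_mul (abs_pow_le_pow_of_abs_le (hSC ω) 3) (hDC ω) (abs_nonneg _) (by positivity)
  have i4 : Integrable (fun ω => (S ω + D ω) ^ 4) μ :=
    integrable_of_measurable_of_abs_le ((hS.add hD).pow_const 4) ((C + C) ^ 4) fun ω =>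
      abs_pow_le_pow_of_abs_le ((abs_add_le _ _).trans (add_le_add (hSC ω) (hDC ω))) 4
  -- The odd term is absorbed by 4SD³ ≤ 2S²D² + 2D⁴, and 8S²D² is split with weights b/a and a/b so
  -- that both halves integrate to multiples of ab.
  have key : ∀ ω, (S ω + D ω) ^ 4
      ≤ (1 + 4 * (b / a)) * S ω ^ 4 + 4 * (S ω ^ 3 * D ω) + (3 + 4 * (a / b)) * D ω ^ 4 := by
    intro ω
    set s := S ω
    set t := D ω
    have h1 : 2 * (s ^ 2 * t ^ 2) ≤ b / a * s ^ 4 + a / b * t ^ 4 := by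
      have : b / a * s ^ 4 + a / b * t ^ 4 - 2 * (s ^ 2 * t ^ 2)
          = (b * s ^ 2 - a * t ^ 2) ^ 2 / (a * b) := by
        field_simp; ring
      have h2 : 0 ≤ (b * s ^ 2 - a * t ^ 2) ^ 2 / (a * b) := by positivity
      linarith
    nlinarith [mul_nonneg (sq_nonneg t) (sq_nonneg (s - t))]
  calc ∫ ω, (S ω + D ω) ^ 4 ∂μ
      ≤ ∫ ω, ((1 + 4 * (b / a)) * S ω ^ 4 + 4 * (S ω ^ 3 * D ω)
          + (3 + 4 * (a / b)) * D ω ^ 4) ∂μ :=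
        integral_mono i4 (((i1.const_mul _).add (i3.const_mul _)).add (i2.const_mul _)) key
    _ = (1 + 4 * (b / a)) * ∫ ω, S ω ^ 4 ∂μ + (3 + 4 * (a / b)) * ∫ ω, D ω ^ 4 ∂μ := by
        rw [integral_add (by exact (i1.const_mul _).add (i3.const_mul _)) (i2.const_mul _),
          integral_add (i1.const_mul _) (i3.const_mul _), integral_const_mul, integral_const_mul,
          integral_const_mul, horth]
        ring
    _ ≤ (1 + 4 * (b / a)) * a ^ 2 + (3 + 4 * (a / b)) * b ^ 2 := by gcongr
    _ = a ^ 2 + 8 * (a * b) + 3 * b ^ 2 := by field_simp; ring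
    _ ≤ (a + 4 * b) ^ 2 := by nlinarith [sq_nonneg b]

variable {E : Type*} [MeasurableSpace E] (Q : Measure E) [IsProbabilityMeasure Q]

/-- Induction on the number of coordinates: averaging out coordinate 0 splits T - E T into S, a
centred function of the other coordinates, and D, which has mean zero given them, so S³D integrates
to zero. Each coordinate adds 4 · 4s to the square root of the moment. The factor n + 1 instead of n
keeps the bound positive at the start of the induction. -/
lemma integral_sub_integral_pow_four_le_of_leaveOneOut {C s : ℝ} (hs : 0 < s) (n : ℕ)
    (T : (Fin n → E) → ℝ) (U : Fin n → (Fin n → E) → ℝ) (hT : Measurable T)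
    (hU : ∀ j, Measurable (U j)) (hTC : ∀ w, |T w| ≤ C) (hUC : ∀ j w, |U j w| ≤ C)
    (hupd : ∀ j w a, U j (Function.update w j a) = U j w)
    (hbound : ∀ j, ∫ w, (T w - U j w) ^ 4 ∂(Measure.pi fun _ => Q) ≤ s ^ 2) :
    ∫ w, (T w - ∫ v, T v ∂(Measure.pi fun _ => Q)) ^ 4 ∂(Measure.pi fun _ => Q)
      ≤ (16 * (n + 1) * s) ^ 2 := by
  induction n with
  | zero =>
    have : ∀ w : Fin 0 → E, T w - ∫ v, T v ∂(Measure.pi fun _ => Q) = 0 := by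
      intro w
      have h1 : ∀ v, T v = T w := fun v => by rw [Subsingleton.elim v w]
      simp [h1]
    simp only [this]
    simp
    positivity
  | succ n ih =>
    let ν : Measure (Fin n → E) := Measure.pi fun _ => Q
    have hC : 0 ≤ C := by
      obtain ⟨w⟩ : Nonempty (Fin (n + 1) → E) :=
        nonempty_of_isProbabilityMeasure (Measure.pi fun _ : Fin (n + 1) => Q)
      exact (abs_nonneg _).trans (hTC w)
    let c : E × (Fin n → E) → (Fin (n + 1) → E) := fun p => (0 : Fin (n + 1)).insertNth p.1 p.2
    have hc : Measurable c := measurable_insertNth 0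
    have hcx : ∀ x : Fin n → E, Measurable fun a => c (a, x) := fun x => by fun_prop
    have hca : ∀ a : E, Measurable fun x => c (a, x) := fun a => by fun_prop
    let avg : ((Fin (n + 1) → E) → ℝ) → (Fin n → E) → ℝ := fun F x => ∫ a, F (c (a, x)) ∂Q
    have havg : ∀ F, Measurable F → Measurable (avg F) := fun F hF =>
      ((hF.comp hc).stronglyMeasurable.integral_prod_left' (μ := Q)).measurable
    have havgC : ∀ F : (Fin (n + 1) → E) → ℝ, ∀ B, (∀ w, |F w| ≤ B) → ∀ x, |avg F x| ≤ B :=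
      fun F B h x => abs_integral_le_of_abs_le fun a => h _
    have hint : ∀ F : (Fin (n + 1) → E) → ℝ, Measurable F → ∀ B, (∀ w, |F w| ≤ B) →
        ∫ w, F w ∂(Measure.pi fun _ => Q) = ∫ x, avg F x ∂ν := fun F hF B hB => by
      rw [integral_pi_insertNth Q 0 F]
      exact integral_prod_symm _ (integrable_of_measurable_of_abs_le (hF.comp hc) B fun p => hB _)
    have hTU : ∀ j, Measurable fun w => T w - U j w := fun j => hT.sub (hU j)
    have hTUC : ∀ j w, |T w - U j w| ≤ C + C := fun j w =>
      (abs_sub _ _).trans (add_le_add (hTC w) (hUC j w))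
    have hsub : ∀ j x, avg (fun w => T w - U j w) x = avg T x - avg (U j) x := fun j x =>
      integral_sub (integrable_of_measurable_of_abs_le (hT.comp (hcx x)) C fun p => hTC _)
        (integrable_of_measurable_of_abs_le ((hU j).comp (hcx x)) C fun p => hUC _ _)
    have hjensen : ∀ j, ∫ x, (avg (fun w => T w - U j w) x) ^ 4 ∂ν ≤ s ^ 2 := fun j => by
      refine le_trans ?_ (hbound j)
      rw [hint _ ((hTU j).pow_const 4) _ fun w => abs_pow_le_pow_of_abs_le (hTUC j w) 4]
      refine integral_mono
        (integrable_of_measurable_of_abs_le ((havg _ (hTU j)).pow_const 4) ((C + C) ^ 4) fun x =>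
          abs_pow_le_pow_of_abs_le (havgC _ _ (hTUC j) x) 4)
        (integrable_of_measurable_of_abs_le (havg _ ((hTU j).pow_const 4)) ((C + C) ^ 4)
          (havgC _ _ fun w => abs_pow_le_pow_of_abs_le (hTUC j w) 4)) fun x => ?_
      exact integral_pow_four_le ((hTU j).comp (hcx x)) fun a => hTUC j _
    -- Averaging preserves the leave-one-out bounds, by Jensen's inequality.
    have hG := ih (avg T) (fun j => avg (U j.succ)) (havg _ hT) (fun j => havg _ (hU _))
      (havgC _ _ hTC) (fun j => havgC _ _ (hUC _))
      (fun j x a => by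
        refine integral_congr_ae (ae_of_all _ fun b => ?_)
        change U j.succ (c (b, Function.update x j a)) = U j.succ (c (b, x))
        rw [← hupd j.succ (c (b, x)) a]
        congr 1
        simp only [c, Fin.insertNth_zero']
        rw [Fin.cons_update])
      (fun j => by simpa only [hsub] using hjensen j.succ)
    set m₀ : ℝ := ∫ v, T v ∂(Measure.pi fun _ => Q) with hm₀
    have hm₀' : ∫ x, avg T x ∂(Measure.pi fun _ => Q) = m₀ := (hint T hT C hTC).symm
    rw [hm₀'] at hG
    have hm₀C : |m₀| ≤ C := abs_integral_le_of_abs_le hTC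
    let S : E × (Fin n → E) → ℝ := fun p => avg T p.2 - m₀
    let D : E × (Fin n → E) → ℝ := fun p => T (c p) - avg T p.2
    have hSm : Measurable S := ((havg _ hT).comp measurable_snd).sub_const _
    have hDm : Measurable D := (hT.comp hc).sub ((havg _ hT).comp measurable_snd)
    have hSC : ∀ p, |S p| ≤ C + C := fun p =>
      (abs_sub _ _).trans (add_le_add (havgC _ _ hTC _) hm₀C)
    have hDC : ∀ p, |D p| ≤ C + C := fun p =>
      (abs_sub _ _).trans (add_le_add (hTC _) (havgC _ _ hTC _))
    have horth : ∫ p, S p ^ 3 * D p ∂(Q.prod ν) = 0 := by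
      have hi : Integrable (fun p => S p ^ 3 * D p) (Q.prod ν) :=
        integrable_of_measurable_of_abs_le ((hSm.pow_const 3).mul hDm) ((C + C) ^ 3 * (C + C))
          fun p => by
            rw [abs_mul]
            exact mul_le_mul (abs_pow_le_pow_of_abs_le (hSC p) 3) (hDC p) (abs_nonneg _)
              (by positivity)
      rw [integral_prod_symm _ hi]
      refine integral_eq_zero_of_ae (ae_of_all _ fun x => ?_)
      change ∫ a, (avg T x - m₀) ^ 3 * (T (c (a, x)) - avg T x) ∂Q = 0
      rw [integral_const_mul, integral_sub
        (by exact integrable_of_measurable_of_abs_le (hT.comp (hcx x)) C fun p => hTC _)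
        (integrable_const _)]
      simp [avg]
    have hS4 : ∫ p, S p ^ 4 ∂(Q.prod ν) ≤ (16 * (n + 1) * s) ^ 2 := by
      refine le_of_eq_of_le ?_ hG
      rw [integral_prod_symm _ (integrable_of_measurable_of_abs_le (hSm.pow_const 4)
        ((C + C) ^ 4) fun p => abs_pow_le_pow_of_abs_le (hSC p) 4)]
      simp [S, ν]
    have hD4 : ∫ p, D p ^ 4 ∂(Q.prod ν) ≤ (4 * s) ^ 2 := by
      have hU0 : ∀ a b x, U 0 (c (a, x)) = U 0 (c (b, x)) := fun a b x => by
        rw [← hupd 0 (c (b, x)) a]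
        congr 1
        simp only [c, Fin.insertNth_zero']
        rw [Fin.update_cons_zero]
      -- As `U 0` ignores coordinate 0, subtracting it from T does not change T minus its average;
      -- so D inherits the smallness of T - `U 0`.
      have hDeq : ∀ p, D p = (T (c p) - U 0 (c p)) - avg (fun w => T w - U 0 w) p.2 := fun p => by
        rw [hsub]
        have : avg (U 0) p.2 = U 0 (c p) := by
          have h1 : ∀ a, U 0 (c (a, p.2)) = U 0 (c p) := fun a => hU0 a p.1 p.2
          simp [avg, h1]
        rw [this]; simp only [D]; ring
      have i1 : Integrable (fun p => (T (c p) - U 0 (c p)) ^ 4) (Q.prod ν) :=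
        integrable_of_measurable_of_abs_le (((hTU 0).comp hc).pow_const 4) ((C + C) ^ 4) fun p =>
          abs_pow_le_pow_of_abs_le (hTUC 0 _) 4
      have i2 : Integrable (fun p => (avg (fun w => T w - U 0 w) p.2) ^ 4) (Q.prod ν) :=
        integrable_of_measurable_of_abs_le
          (((havg _ (hTU 0)).comp measurable_snd).pow_const 4) ((C + C) ^ 4) fun p =>
          abs_pow_le_pow_of_abs_le (havgC _ _ (hTUC 0) _) 4
      have e1 : ∫ p, (T (c p) - U 0 (c p)) ^ 4 ∂(Q.prod ν) ≤ s ^ 2 := by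
        refine le_of_eq_of_le ?_ (hbound 0)
        exact (integral_pi_insertNth Q 0 fun w => (T w - U 0 w) ^ 4).symm
      have e2 : ∫ p, (avg (fun w => T w - U 0 w) p.2) ^ 4 ∂(Q.prod ν) ≤ s ^ 2 := by
        refine le_of_eq_of_le ?_ (hjensen 0)
        rw [integral_prod_symm _ i2]
        simp
      calc ∫ p, D p ^ 4 ∂(Q.prod ν)
          ≤ ∫ p, (8 * (T (c p) - U 0 (c p)) ^ 4
              + 8 * (avg (fun w => T w - U 0 w) p.2) ^ 4) ∂(Q.prod ν) := by
            refine integral_mono (integrable_of_measurable_of_abs_le (hDm.pow_const 4)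
              ((C + C) ^ 4) fun p => abs_pow_le_pow_of_abs_le (hDC p) 4)
              ((i1.const_mul _).add (i2.const_mul _)) fun p => ?_
            simp only [hDeq]
            exact pow_four_sub_le _ _
        _ = 8 * ∫ p, (T (c p) - U 0 (c p)) ^ 4 ∂(Q.prod ν)
              + 8 * ∫ p, (avg (fun w => T w - U 0 w) p.2) ^ 4 ∂(Q.prod ν) := by
            rw [integral_add (i1.const_mul _) (i2.const_mul _), integral_const_mul,
              integral_const_mul]
        _ ≤ (4 * s) ^ 2 := by nlinarith
    have := integral_add_pow_four_le hSm hDm hSC hDC horth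
      (a := 16 * (n + 1) * s) (b := 4 * s) (by positivity) (by positivity) hS4 hD4
    rw [integral_pi_insertNth Q 0]
    calc _ = ∫ p, (S p + D p) ^ 4 ∂(Q.prod ν) := by
          refine integral_congr_ae (ae_of_all _ fun p => ?_)
          simp only [S, D, c]; ring
      _ ≤ _ := this
      _ = _ := by push_cast; ring

end FourthMoment

/-! ### Stone's covering lemma for measures -/

section ConeCover

lemma exists_finset_cover_unitSphere (d : ℕ) :
    ∃ s : Finset (Inp d), ∀ v : Inp d, ‖v‖ = 1 → ∃ c ∈ s, dist v c < 1 / 2 := by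
  obtain ⟨t, -, htf, hcov⟩ :=
    (isCompact_sphere (0 : Inp d) 1).finite_cover_balls (e := 1 / 2) (by norm_num)
  refine ⟨htf.toFinset, fun v hv => ?_⟩
  have := hcov (show v ∈ Metric.sphere (0 : Inp d) 1 by simpa using hv)
  simp only [Set.mem_iUnion, Metric.mem_ball, exists_prop] at this
  simpa using this

/-- Unit vectors at distance below 1 have inner product above 1/2, that is, an angle below 60°.
Hence ‖sv - tw‖² < s² + t² - st ≤ t². -/
lemma norm_smul_sub_smul_lt {V : Type*} [NormedAddCommGroup V] [InnerProductSpace ℝ V] {v w : V}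
    (hv : ‖v‖ = 1) (hw : ‖w‖ = 1) (hvw : ‖v - w‖ < 1) {s t : ℝ} (hs : 0 < s) (hst : s ≤ t) :
    ‖s • v - t • w‖ < t := by
  have h1 := norm_sub_sq_real v w
  have h2 := norm_sub_sq_real (s • v) (t • w)
  rw [real_inner_smul_left, real_inner_smul_right, norm_smul, norm_smul, hv, hw] at h2
  rw [hv, hw] at h1
  simp only [Real.norm_eq_abs, mul_one, sq_abs] at h2
  have h3 : ‖v - w‖ ^ 2 < 1 := by nlinarith [norm_nonneg (v - w)]
  have h4 : (1 : ℝ) / 2 < inner ℝ v w := by linarith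
  have h5 : 0 < s * t := by nlinarith
  refine lt_of_pow_lt_pow_left₀ 2 (by linarith) ?_
  nlinarith

/-- The cone with apex `u` around the direction `c`. -/
def coneAt {d : ℕ} (u c : Inp d) : Set (Inp d) :=
  {z | z ≠ u ∧ dist (‖z - u‖⁻¹ • (z - u)) c < 1 / 2}

/-- The diameter of the cone's directions is below 1, so two of its points are seen from the apex
under less than 60°. The nearer one then lies in the open ball around the farther one through the
apex. -/
lemma dist_lt_of_mem_coneAt {d : ℕ} {u c z w : Inp d} (hz : z ∈ coneAt u c) (hw : w ∈ coneAt u c)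
    (h : dist z u ≤ dist w u) : dist z w < dist w u := by
  have hz0 : 0 < ‖z - u‖ := norm_pos_iff.2 (sub_ne_zero.2 hz.1)
  have hw0 : 0 < ‖w - u‖ := norm_pos_iff.2 (sub_ne_zero.2 hw.1)
  have hd : ‖‖z - u‖⁻¹ • (z - u) - ‖w - u‖⁻¹ • (w - u)‖ < 1 := by
    rw [← dist_eq_norm]
    have h1 := dist_triangle_right (‖z - u‖⁻¹ • (z - u)) (‖w - u‖⁻¹ • (w - u)) c
    have h2 := hz.2
    have h3 := hw.2
    linarith
  have hn : ∀ y : Inp d, 0 < ‖y‖ → ‖‖y‖⁻¹ • y‖ = 1 := fun y hy => by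
    rw [norm_smul, norm_inv, norm_norm, inv_mul_cancel₀ hy.ne']
  have := norm_smul_sub_smul_lt (hn _ hz0) (hn _ hw0) hd hz0
    (by simpa [dist_eq_norm] using h)
  rw [smul_inv_smul₀ hz0.ne', smul_inv_smul₀ hw0.ne', sub_sub_sub_cancel_right] at this
  rw [dist_eq_norm, dist_eq_norm]
  exact this

/-- The ball around a point w of this set through u contains all its points no farther from u than
w, and has mass at most a. Take w farthest from u; if there is none, exhaust the set by points whose
distances increase to the supremum. Continuity from below along increasing sets needs no
measurability. -/
lemma measure_coneAt_inter_le {d : ℕ} (ρ : Measure (Inp d)) (u c : Inp d) (a : ℝ≥0∞) :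
    ρ (coneAt u c ∩ {z | ρ (Metric.ball z (dist z u)) ≤ a}) ≤ a := by
  set M := coneAt u c ∩ {z | ρ (Metric.ball z (dist z u)) ≤ a} with hM
  rcases M.eq_empty_or_nonempty with h | hne
  · simp [h]
  have key : ∀ w ∈ M, ρ {z ∈ M | edist z u ≤ edist w u} ≤ a := fun w hw => by
    refine le_trans (measure_mono ?_) hw.2
    intro z hz
    refine dist_lt_of_mem_coneAt hz.1.1 hw.1 ?_
    have := hz.2
    rwa [edist_dist, edist_dist, ENNReal.ofReal_le_ofReal_iff dist_nonneg] at this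
  -- Extended distances are used so that the supremum exists for unbounded sets too.
  obtain ⟨r, hrm, -, hrt, hrM⟩ := (isLUB_sSup ((fun z => edist z u) '' M)).exists_seq_monotone_tendsto
    (hne.image _)
  by_cases hatt : ∃ w ∈ M, ∀ z ∈ M, edist z u ≤ edist w u
  · obtain ⟨w, hw, hmax⟩ := hatt
    exact (measure_mono fun z hz => show z ∈ {z ∈ M | edist z u ≤ edist w u} from
      ⟨hz, hmax z hz⟩).trans (key w hw)
  · push Not at hatt
    have hsub : M ⊆ ⋃ n, {z ∈ M | edist z u ≤ r n} := fun z hz => by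
      obtain ⟨w, hw, hzw⟩ := hatt z hz
      have hlt : edist z u < sSup ((fun z => edist z u) '' M) :=
        hzw.trans_le (le_sSup ⟨w, hw, rfl⟩)
      obtain ⟨n, hn⟩ := (hrt.eventually (lt_mem_nhds hlt)).exists
      exact Set.mem_iUnion.2 ⟨n, hz, hn.le⟩
    refine (measure_mono hsub).trans ?_
    have hmono : Monotone fun n => {z ∈ M | edist z u ≤ r n} := fun i j hij z hz =>
      ⟨hz.1, le_trans hz.2 (hrm hij)⟩
    rw [hmono.measure_iUnion]
    refine iSup_le fun n => ?_
    obtain ⟨w, hw, hwn⟩ := hrM n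
    simpa only [← hwn] using key w hw

/-- Finitely many cones, their number depending on d only, cover everything except the apex, which
is null. -/
lemma measure_setOf_measure_ball_le {d : ℕ} {s : Finset (Inp d)}
    (hs : ∀ v : Inp d, ‖v‖ = 1 → ∃ c ∈ s, dist v c < 1 / 2) (ρ : Measure (Inp d)) [NullSingletonClass ρ]
    (u : Inp d) (a : ℝ≥0∞) :
    ρ {z | ρ (Metric.ball z (dist z u)) ≤ a} ≤ s.card * a := by
  have hsub : {z | ρ (Metric.ball z (dist z u)) ≤ a}
      ⊆ {u} ∪ ⋃ c ∈ s, coneAt u c ∩ {z | ρ (Metric.ball z (dist z u)) ≤ a} := fun z hz => by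
    by_cases hzu : z = u
    · exact Or.inl hzu
    · right
      have hz0 : ‖z - u‖ ≠ 0 := norm_ne_zero_iff.2 (sub_ne_zero.2 hzu)
      obtain ⟨c, hc, hcz⟩ := hs (‖z - u‖⁻¹ • (z - u)) (by
        rw [norm_smul, norm_inv, norm_norm, inv_mul_cancel₀ hz0])
      exact Set.mem_biUnion hc ⟨⟨hzu, hcz⟩, hz⟩
  calc ρ {z | ρ (Metric.ball z (dist z u)) ≤ a}
      ≤ ρ {u} + ρ (⋃ c ∈ s, coneAt u c ∩ {z | ρ (Metric.ball z (dist z u)) ≤ a}) :=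
        (measure_mono hsub).trans (measure_union_le _ _)
    _ ≤ 0 + ∑ c ∈ s, a := by
        gcongr
        · simp
        · exact (measure_biUnion_finset_le _ _).trans
            (Finset.sum_le_sum fun c _ => measure_coneAt_inter_le ρ u c a)
    _ = s.card * a := by simp

end ConeCover

/-! ### The mass of balls through a given point -/

section BallMass

variable {d : ℕ} (ρ : Measure (Inp d))

/-- The mass of the open ball around `z` with `u` on its boundary. -/
noncomputable def ballMass (u z : Inp d) : ℝ := ρ.real (Metric.ball z (dist z u))

lemma ballMass_nonneg (u z : Inp d) : 0 ≤ ballMass ρ u z := measureReal_nonneg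

lemma measurable_ballMass [IsFiniteMeasure ρ] :
    Measurable fun p : Inp d × Inp d => ballMass ρ p.1 p.2 := by
  have hopen : IsOpen {q : (Inp d × Inp d) × Inp d | dist q.2 q.1.2 < dist q.1.2 q.1.1} :=
    isOpen_lt (by fun_prop) (by fun_prop)
  exact (measurable_measure_prodMk_left (ν := ρ) hopen.measurableSet).ennreal_toReal

lemma measurable_ballMass_right [IsFiniteMeasure ρ] (u : Inp d) :
    Measurable fun z => ballMass ρ u z :=
  (measurable_ballMass ρ).of_uncurry_left (f := ballMass ρ)

/-- A discrete layer-cake bound: the single term with index ⌊a/t⌋ already suffices. It reduces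
exponential integrals to the masses of sublevel sets. -/
lemma exp_neg_div_le_tsum {a t : ℝ} (ha : 0 ≤ a) (ht : 0 < t) :
    ENNReal.ofReal (Real.exp (-(a / t)))
      ≤ ∑' i : ℕ, ENNReal.ofReal (Real.exp (-(i : ℝ)))
          * (Set.Iic ((i + 1) * t)).indicator 1 a := by
  refine le_trans ?_ (ENNReal.le_tsum ⌊a / t⌋₊)
  have h1 : a ∈ Set.Iic ((⌊a / t⌋₊ + 1) * t) := by
    have := (Nat.lt_floor_add_one (a / t)).le
    rwa [div_le_iff₀ ht] at this
  rw [Set.indicator_of_mem h1]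
  simp only [Pi.one_apply, mul_one]
  exact ENNReal.ofReal_le_ofReal (Real.exp_le_exp.2 (neg_le_neg (Nat.floor_le (by positivity))))

/-- The integral of `exp (-ballMass / t)` is at most proportional to `t`, with a constant that
depends on the dimension only. -/
lemma exists_integral_exp_neg_ballMass_le (d : ℕ) :
    ∃ K : ℝ, 0 < K ∧ ∀ (ρ : Measure (Inp d)) [IsProbabilityMeasure ρ] [NullSingletonClass ρ]
      (u : Inp d) (t : ℝ), 0 < t → ∫ z, Real.exp (-(ballMass ρ u z / t)) ∂ρ ≤ K * t := by
  obtain ⟨s, hs⟩ := exists_finset_cover_unitSphere d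
  have hsum : Summable fun i : ℕ => Real.exp (-(i : ℝ)) * (i + 1) := by
    have h0 := Real.summable_pow_mul_exp_neg_nat_mul 1 one_pos
    have h1 := Real.summable_pow_mul_exp_neg_nat_mul 0 one_pos
    have h2 : (fun i : ℕ => Real.exp (-(i : ℝ)) * (i + 1)) = fun i : ℕ =>
        (i : ℝ) ^ 1 * Real.exp (-1 * i) + (i : ℝ) ^ 0 * Real.exp (-1 * i) := by
      funext i
      rw [neg_one_mul]; ring
    rw [h2]
    exact h0.add h1
  obtain ⟨B, hB⟩ : ∃ B, B = ∑' i : ℕ, Real.exp (-(i : ℝ)) * (i + 1) := ⟨_, rfl⟩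
  have hB0 : 0 ≤ B := hB ▸ tsum_nonneg fun i => by positivity
  -- The summand 1 only serves to make the constant positive.
  refine ⟨s.card * B + 1, by positivity, fun ρ _ _ u t ht => ?_⟩
  have hmeas : Measurable fun z => ballMass ρ u z := measurable_ballMass_right ρ u
  have hlin : ∫⁻ z, ENNReal.ofReal (Real.exp (-(ballMass ρ u z / t))) ∂ρ
      ≤ ENNReal.ofReal (s.card * B * t) := by
    calc ∫⁻ z, ENNReal.ofReal (Real.exp (-(ballMass ρ u z / t))) ∂ρ
        ≤ ∫⁻ z, ∑' i : ℕ, ENNReal.ofReal (Real.exp (-(i : ℝ)))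
          * (Set.Iic ((i + 1) * t)).indicator 1 (ballMass ρ u z) ∂ρ :=
          lintegral_mono fun z => exp_neg_div_le_tsum (ballMass_nonneg ρ u z) ht
      _ = ∑' i : ℕ, ENNReal.ofReal (Real.exp (-(i : ℝ)))
          * ρ {z | ballMass ρ u z ≤ (i + 1) * t} := by
          have hind : ∀ i : ℕ, Measurable fun z =>
              (Set.Iic (((i : ℝ) + 1) * t)).indicator (1 : ℝ → ℝ≥0∞) (ballMass ρ u z) := fun i =>
            (measurable_one.indicator measurableSet_Iic).comp hmeas
          rw [lintegral_tsum fun i => ((hind i).const_mul _).aemeasurable]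
          refine tsum_congr fun i => ?_
          rw [lintegral_const_mul _ (hind i)]
          congr 1
          rw [← lintegral_indicator_one (measurableSet_le hmeas measurable_const)]
          rfl
      _ ≤ ∑' i : ℕ, ENNReal.ofReal (s.card * t) * ENNReal.ofReal (Real.exp (-(i : ℝ)) * (i + 1)) := by
          refine ENNReal.tsum_le_tsum fun i => ?_
          -- The cone covering: sublevel sets of `ballMass` have mass at most linear in the level.
          have h1 : ρ {z | ballMass ρ u z ≤ (i + 1) * t}
              ≤ s.card * ENNReal.ofReal ((i + 1) * t) := by
            refine le_trans (measure_mono fun z hz => ?_)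
              (measure_setOf_measure_ball_le hs ρ u (ENNReal.ofReal ((i + 1) * t)))
            exact (ENNReal.le_ofReal_iff_toReal_le (measure_ne_top _ _) (by positivity)).2 hz
          calc _ ≤ ENNReal.ofReal (Real.exp (-(i : ℝ)))
                * (s.card * ENNReal.ofReal ((i + 1) * t)) := by gcongr
            _ = _ := by
                rw [← ENNReal.ofReal_natCast, ← ENNReal.ofReal_mul (by positivity),
                  ← ENNReal.ofReal_mul (by positivity), ← ENNReal.ofReal_mul (by positivity)]
                congr 1; ring
      _ = ENNReal.ofReal (s.card * B * t) := by
          rw [ENNReal.tsum_mul_left, ← ENNReal.ofReal_tsum_of_nonneg (fun i => by positivity) hsum,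
            ← ENNReal.ofReal_mul (by positivity), ← hB]
          congr 1; ring
  rw [integral_eq_lintegral_of_nonneg_ae (ae_of_all _ fun z => (Real.exp_pos _).le)
    (by fun_prop)]
  refine (ENNReal.toReal_le_of_le_ofReal (by positivity) hlin).trans ?_
  nlinarith only [ht]

end BallMass

/-! ### Ranks in a finite strict total order -/

section Rank

open Classical in
/-- The number of elements of `S` that precede `a`. -/
noncomputable def rankIn {ι : Type*} (r : ι → ι → Prop) (S : Finset ι) (a : ι) : ℕ :=
  (S.filter fun l => r l a).card

variable {ι : Type*} (r : ι → ι → Prop) [IsStrictTotalOrder ι r]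

lemma rankIn_lt_rankIn {S : Finset ι} {a b : ι} (ha : a ∈ S) (h : r a b) :
    rankIn r S a < rankIn r S b := by
  classical
  refine Finset.card_lt_card ⟨fun l hl => ?_, fun hsub => ?_⟩
  · simp only [Finset.mem_filter] at hl ⊢
    exact ⟨hl.1, _root_.trans hl.2 h⟩
  · have := hsub (show a ∈ S.filter fun l => r l b by simp [ha, h])
    simp only [Finset.mem_filter] at this
    exact irrefl_of r a this.2

lemma rankIn_injOn (S : Finset ι) : Set.InjOn (rankIn r S) S := fun a ha b hb hab => by
  rcases trichotomous_of r a b with h | h | h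
  · exact absurd hab (rankIn_lt_rankIn r ha h).ne
  · exact h
  · exact absurd hab (rankIn_lt_rankIn r hb h).ne'

lemma rankIn_lt_card {S : Finset ι} {a : ι} (ha : a ∈ S) : rankIn r S a < S.card := by
  classical
  refine Finset.card_lt_card ⟨Finset.filter_subset _ _, fun hsub => ?_⟩
  have := hsub ha
  simp only [Finset.mem_filter] at this
  exact irrefl_of r a this.2

open Classical in
lemma card_filter_rankIn_lt_le (S : Finset ι) (k : ℕ) :
    (S.filter fun a => rankIn r S a < k).card ≤ k := by
  refine (Finset.card_le_card_of_injOn (t := Finset.range k) (rankIn r S) (fun a ha => ?_)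
    fun a ha b hb h => ?_).trans (Finset.card_range k).le
  · simpa using (Finset.mem_filter.1 ha).2
  · exact rankIn_injOn r S (Finset.mem_filter.1 ha).1 (Finset.mem_filter.1 hb).1 h

open Classical in
-- Ranks are injective and below the cardinality, hence they run through 0, …, |S| - 1. Both the
-- number of neighbours and the number of datasets ranked among the first q are counted this way.
lemma card_filter_rankIn_lt (S : Finset ι) {k : ℕ} (hk : k ≤ S.card) :
    (S.filter fun a => rankIn r S a < k).card = k := by
  have himg : S.image (rankIn r S) = Finset.range S.card := by
    refine Finset.eq_of_subset_of_card_le (fun i hi => ?_) ?_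
    · obtain ⟨a, ha, rfl⟩ := Finset.mem_image.1 hi
      exact Finset.mem_range.2 (rankIn_lt_card r ha)
    · rw [Finset.card_image_of_injOn (rankIn_injOn r S), Finset.card_range]
  have h2 : (S.filter fun a => rankIn r S a < k).image (rankIn r S) = Finset.range k := by
    ext i
    simp only [Finset.mem_image, Finset.mem_filter, Finset.mem_range]
    constructor
    · rintro ⟨a, ⟨-, h⟩, rfl⟩; exact h
    · intro hi
      have : i ∈ S.image (rankIn r S) := by rw [himg]; exact Finset.mem_range.2 (by omega)
      obtain ⟨a, ha, rfl⟩ := Finset.mem_image.1 this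
      exact ⟨a, ⟨ha, hi⟩, rfl⟩
  have h3 := Finset.card_image_of_injOn
    ((rankIn_injOn r S).mono fun a ha => (Finset.mem_filter.1 ha).1 :
      Set.InjOn (rankIn r S) (S.filter fun a => rankIn r S a < k))
  rw [← h3, h2, Finset.card_range]

end Rank

/-! ### Nearest neighbours -/

section Neighbors

variable {d n : ℕ}

/-- The order of the sample points by their distance from `z`. -/
def Nearer (x : Fin n → Inp d) (z : Inp d) (l j : Fin n) : Prop :=
  dist (x l) z < dist (x j) z ∨ (dist (x l) z = dist (x j) z ∧ l < j)

instance isStrictTotalOrder_nearer (x : Fin n → Inp d) (z : Inp d) :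
    IsStrictTotalOrder (Fin n) (Nearer x z) where
  irrefl a h := by
    rcases h with h | h
    · exact lt_irrefl _ h
    · exact lt_irrefl _ h.2
  trans a b c hab hbc := by
    rcases hab with h | ⟨h, h'⟩ <;> rcases hbc with g | ⟨g, g'⟩
    · exact Or.inl (h.trans g)
    · exact Or.inl (g ▸ h)
    · exact Or.inl (h ▸ g)
    · exact Or.inr ⟨h.trans g, h'.trans g'⟩
  trichotomous a b hab hba := by
    simp only [Nearer, not_or, not_and, not_lt] at hab hba
    have h := le_antisymm hba.1 hab.1
    exact le_antisymm (hba.2 h.symm) (hab.2 h)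

lemma isNeighbor_iff_rankIn_lt (x : Fin n → Inp d) (k : ℕ) (z : Inp d) (j : Fin n) :
    IsNeighbor x k z j ↔ rankIn (Nearer x z) Finset.univ j < k := by
  unfold IsNeighbor rankIn Nearer
  exact iff_of_eq (by congr!)

lemma abs_toReal_label (s : Label) : |s.toReal| = 1 := by
  rcases Int.units_eq_one_or s with rfl | rfl <;> simp [Label.toReal]

open Classical in
lemma filter_isNeighbor (x : Fin n → Inp d) (k : ℕ) (z : Inp d) :
    Finset.univ.filter (IsNeighbor x k z)
      = Finset.univ.filter fun j => rankIn (Nearer x z) Finset.univ j < k :=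
  Finset.filter_congr fun j _ => isNeighbor_iff_rankIn_lt x k z j

open Classical in
lemma sum_isNeighbor (x : Fin n → Inp d) {k : ℕ} (hk : k ≤ n) (z : Inp d) :
    ∑ j, (if IsNeighbor x k z j then (1 : ℝ) else 0) = k := by
  rw [Finset.sum_boole, filter_isNeighbor]
  exact_mod_cast card_filter_rankIn_lt (Nearer x z) Finset.univ (by simpa using hk)

open Classical in
lemma sum_isNeighbor_le (x : Fin n → Inp d) (k : ℕ) (z : Inp d) :
    ∑ j, (if IsNeighbor x k z j then (1 : ℝ) else 0) ≤ k := by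
  rw [Finset.sum_boole, filter_isNeighbor]
  exact_mod_cast card_filter_rankIn_lt_le (Nearer x z) Finset.univ k

open Classical in
/-- The nearest neighbour estimate without the sample point number `j`. -/
noncomputable def leaveOneOutEstimate (k : ℕ) (x : Fin n → Inp d) (y : Fin n → Label) (j : Fin n)
    (z : Inp d) : ℝ :=
  1 / (k : ℝ) * ∑ l ∈ Finset.univ.erase j,
    (y l).toReal * (if rankIn (Nearer x z) (Finset.univ.erase j) l < k then 1 else 0)

lemma abs_one_div_mul_sum_le (k : ℕ) (S : Finset (Fin n)) (y : Fin n → Label) (p : Fin n → Prop)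
    [DecidablePred p]
    (hp : (S.filter p).card ≤ k) :
    |1 / (k : ℝ) * ∑ l ∈ S, (y l).toReal * (if p l then 1 else 0)| ≤ 1 := by
  have h1 : |∑ l ∈ S, (y l).toReal * (if p l then (1 : ℝ) else 0)| ≤ k := by
    refine (Finset.abs_sum_le_sum_abs _ _).trans ?_
    have : ∀ l ∈ S, |(y l).toReal * (if p l then (1 : ℝ) else 0)| = if p l then 1 else 0 := by
      intro l _
      rw [abs_mul, abs_toReal_label, one_mul]
      split_ifs <;> simp
    rw [Finset.sum_congr rfl this, Finset.sum_boole]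
    exact_mod_cast hp
  rw [abs_mul, abs_of_nonneg (by positivity : (0 : ℝ) ≤ 1 / k)]
  rcases Nat.eq_zero_or_pos k with rfl | hk
  · simp
  · have : (0 : ℝ) < k := by exact_mod_cast hk
    rw [one_div, inv_mul_le_iff₀ this, mul_one]
    exact h1

lemma abs_knnEstimate_le (k : ℕ) (x : Fin n → Inp d) (y : Fin n → Label) (z : Inp d) :
    |knnEstimate k x y z| ≤ 1 := by
  classical
  exact abs_one_div_mul_sum_le k _ y _ (by
    convert card_filter_rankIn_lt_le (Nearer x z) Finset.univ k
    exact isNeighbor_iff_rankIn_lt x k z _)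

lemma abs_leaveOneOutEstimate_le (k : ℕ) (x : Fin n → Inp d) (y : Fin n → Label) (j : Fin n)
    (z : Inp d) : |leaveOneOutEstimate k x y j z| ≤ 1 := by
  classical
  exact abs_one_div_mul_sum_le k (Finset.univ.erase j) y _
    (by convert card_filter_rankIn_lt_le (Nearer x z) (Finset.univ.erase j) k)

lemma rankIn_univ_eq (r : Fin n → Fin n → Prop) (j l : Fin n) [Decidable (r j l)] :
    rankIn r Finset.univ l = rankIn r (Finset.univ.erase j) l + if r j l then 1 else 0 := by
  classical
  unfold rankIn
  rw [Finset.filter_erase]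
  split_ifs with h
  · rw [Finset.card_erase_add_one (by simp [h])]
  · rw [Finset.erase_eq_of_notMem (by simp [h]), add_zero]

open Classical in
-- Deleting a point that is not a neighbour of z changes nothing. Deleting a neighbour removes one
-- label from the sum and lets in at most one other, each of absolute value 1.
lemma abs_knnEstimate_sub_leaveOneOutEstimate_le {k : ℕ} (x : Fin n → Inp d) (y : Fin n → Label)
    (j : Fin n) (z : Inp d) :
    |knnEstimate k x y z - leaveOneOutEstimate k x y j z|
      ≤ 2 / k * (if IsNeighbor x k z j then 1 else 0) := by
  set r := Nearer x z with hr
  set S : Finset (Fin n) := Finset.univ.erase j with hS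
  have hdiff : knnEstimate k x y z - leaveOneOutEstimate k x y j z
      = 1 / (k : ℝ) * ((y j).toReal * (if IsNeighbor x k z j then 1 else 0)
        + ∑ l ∈ S, (y l).toReal * ((if IsNeighbor x k z l then 1 else 0)
          - (if rankIn r S l < k then 1 else 0))) := by
    unfold knnEstimate leaveOneOutEstimate
    rw [← Finset.add_sum_erase Finset.univ _ (Finset.mem_univ j)]
    simp only [mul_sub, Finset.sum_sub_distrib]
    ring
  -- The only point that can enter has rank k - 1 after the deletion and rank k, counted from 0,
  -- before it.
  have hterm : ∀ l ∈ S, |(y l).toReal * ((if IsNeighbor x k z l then (1 : ℝ) else 0)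
          - (if rankIn r S l < k then 1 else 0))|
        ≤ if (rankIn r S l + 1 = k ∧ IsNeighbor x k z j) then 1 else 0 := by
    intro l hl
    rw [abs_mul, abs_toReal_label, one_mul, isNeighbor_iff_rankIn_lt, isNeighbor_iff_rankIn_lt]
    have h1 := rankIn_univ_eq r j l
    rw [← hS] at h1
    rw [← hr, h1]
    by_cases hjl : r j l
    · have h2 := rankIn_lt_rankIn r (Finset.mem_univ j) hjl
      simp only [h1, hjl, if_true] at h2 ⊢
      by_cases h3 : rankIn r S l + 1 < k
      · rw [if_pos h3, if_pos (by omega)]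
        split_ifs <;> simp
      · rw [if_neg h3]
        by_cases h4 : rankIn r S l < k
        · have h5 : rankIn r Finset.univ j < k := by omega
          rw [if_pos h4, if_pos ⟨by omega, h5⟩]; simp
        · rw [if_neg h4]
          split_ifs <;> simp
    · simp only [hjl, if_false, add_zero]
      split_ifs <;> simp
  have hcard : ∑ l ∈ S, (if (rankIn r S l + 1 = k ∧ IsNeighbor x k z j) then (1 : ℝ) else 0)
      ≤ if IsNeighbor x k z j then 1 else 0 := by
    by_cases hj : IsNeighbor x k z j
    · simp only [hj, and_true, if_true]
      rw [Finset.sum_boole]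
      have : (S.filter fun l => rankIn r S l + 1 = k).card ≤ 1 := by
        refine Finset.card_le_one.2 fun a ha b hb => ?_
        rw [Finset.mem_filter] at ha hb
        exact rankIn_injOn r S ha.1 hb.1 (by omega)
      exact_mod_cast this
    · simp [hj]
  have hsum := (Finset.abs_sum_le_sum_abs _ _).trans ((Finset.sum_le_sum hterm).trans hcard)
  rw [hdiff, abs_mul, abs_of_nonneg (by positivity : (0 : ℝ) ≤ 1 / k)]
  have h0 : |(y j).toReal * (if IsNeighbor x k z j then (1 : ℝ) else 0)|
      = if IsNeighbor x k z j then 1 else 0 := by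
    rw [abs_mul, abs_toReal_label, one_mul]
    split_ifs <;> simp
  calc _ ≤ 1 / (k : ℝ) * ((if IsNeighbor x k z j then 1 else 0)
          + (if IsNeighbor x k z j then 1 else 0)) := by
        gcongr
        exact (abs_add_le _ _).trans (add_le_add h0.le hsum)
    _ = _ := by ring

lemma leaveOneOutEstimate_congr {k : ℕ} {x x' : Fin n → Inp d} {y y' : Fin n → Label} {j : Fin n}
    (hx : ∀ l ≠ j, x l = x' l) (hy : ∀ l ≠ j, y l = y' l) (z : Inp d) :
    leaveOneOutEstimate k x y j z = leaveOneOutEstimate k x' y' j z := by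
  classical
  unfold leaveOneOutEstimate
  congr 1
  refine Finset.sum_congr rfl fun l hl => ?_
  have hlj : l ≠ j := Finset.ne_of_mem_erase hl
  have : rankIn (Nearer x z) (Finset.univ.erase j) l
      = rankIn (Nearer x' z) (Finset.univ.erase j) l := by
    unfold rankIn
    congr 1
    refine Finset.filter_congr fun i hi => ?_
    simp only [Nearer, hx l hlj, hx i (Finset.ne_of_mem_erase hi)]
  rw [hy l hlj, this]

open Classical in
lemma card_lt_of_isNeighbor {x : Fin n → Inp d} {k : ℕ} {z : Inp d} {j : Fin n}
    (h : IsNeighbor x k z j) :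
    (Finset.univ.filter fun l => dist (x l) z < dist (x j) z).card < k :=
  (Finset.card_le_card (Finset.monotone_filter_right _ fun _ _ hl => Or.inl hl)).trans_lt h

/-! ### Measurability -/

variable {α : Type*} [MeasurableSpace α]

lemma measurableSet_nearer {x : Fin n → α → Inp d} (hx : ∀ j, Measurable (x j)) {z : α → Inp d}
    (hz : Measurable z) (l j : Fin n) :
    MeasurableSet {a | Nearer (fun i => x i a) (z a) l j} := by
  have hd : ∀ j, Measurable fun a => dist (x j a) (z a) := fun j => (hx j).dist hz
  exact (measurableSet_lt (hd l) (hd j)).union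
    ((measurableSet_eq_fun (hd l) (hd j)).inter (MeasurableSet.const _))

lemma measurable_rankIn_nearer {x : Fin n → α → Inp d} (hx : ∀ j, Measurable (x j))
    {z : α → Inp d} (hz : Measurable z) (S : Finset (Fin n)) (j : Fin n) :
    Measurable fun a => rankIn (Nearer (fun i => x i a) (z a)) S j := by
  classical
  simp only [rankIn, Finset.card_filter]
  exact Finset.measurable_fun_sum _ fun l _ =>
    Measurable.ite (measurableSet_nearer hx hz l j) measurable_const measurable_const

lemma measurableSet_isNeighbor {x : Fin n → α → Inp d} (hx : ∀ j, Measurable (x j))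
    {z : α → Inp d} (hz : Measurable z) (k : ℕ) (j : Fin n) :
    MeasurableSet {a | IsNeighbor (fun i => x i a) k (z a) j} := by
  simp only [isNeighbor_iff_rankIn_lt]
  exact measurable_rankIn_nearer hx hz Finset.univ j (measurableSet_Iio (a := k))

lemma measurable_toReal_label : Measurable Label.toReal := measurable_of_countable _

lemma measurable_knnEstimate {x : Fin n → α → Inp d} (hx : ∀ j, Measurable (x j))
    {y : Fin n → α → Label} (hy : ∀ j, Measurable (y j)) {z : α → Inp d} (hz : Measurable z)
    (k : ℕ) : Measurable fun a => knnEstimate k (fun i => x i a) (fun i => y i a) (z a) := by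
  classical
  exact (Finset.measurable_fun_sum _ fun j _ => (measurable_toReal_label.comp (hy j)).mul
    (Measurable.ite (measurableSet_isNeighbor hx hz k j) measurable_const
      measurable_const)).const_mul _

lemma measurable_leaveOneOutEstimate {x : Fin n → α → Inp d} (hx : ∀ j, Measurable (x j))
    {y : Fin n → α → Label} (hy : ∀ j, Measurable (y j)) {z : α → Inp d} (hz : Measurable z)
    (k : ℕ) (j : Fin n) :
    Measurable fun a => leaveOneOutEstimate k (fun i => x i a) (fun i => y i a) j (z a) := by
  classical
  exact (Finset.measurable_fun_sum _ fun l _ => (measurable_toReal_label.comp (hy l)).mul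
    (Measurable.ite (measurable_rankIn_nearer hx hz _ l (measurableSet_Iio (a := k)))
      measurable_const measurable_const)).const_mul _

end Neighbors

/-! ### An exponential bound for the number of sample points in a set -/

section Chernoff

lemma exp_neg_le_one_sub_half {s : ℝ} (h0 : 0 ≤ s) (h1 : s ≤ 1) : Real.exp (-s) ≤ 1 - s / 2 := by
  have h2 : 1 + s ≤ Real.exp s := by linarith [Real.add_one_le_exp s]
  have h3 : Real.exp (-s) * Real.exp s = 1 := by rw [← Real.exp_add]; simp
  have h4 := Real.exp_pos (-s)
  have h5 : 0 ≤ 1 - s / 2 := by linarith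
  -- This rests on (1 + s)(1 - s/2) ≥ 1 for 0 ≤ s ≤ 1.
  nlinarith [mul_le_mul_of_nonneg_left h2 h4.le]

variable {E : Type*} [MeasurableSpace E] (Q : Measure E) [IsProbabilityMeasure Q]

lemma measurableSet_card_lt {E : Type*} [MeasurableSpace E] {B : Set E} (hB : MeasurableSet B)
    (N k : ℕ) [DecidablePred (· ∈ B)] :
    MeasurableSet {w : Fin N → E | (Finset.univ.filter fun l => w l ∈ B).card < k} := by
  have : Measurable fun w : Fin N → E => (Finset.univ.filter fun l => w l ∈ B).card := by
    simp only [Finset.card_filter]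
    exact Finset.measurable_fun_sum _ fun l _ =>
      Measurable.ite (measurable_pi_apply l hB) measurable_const measurable_const
  exact this (measurableSet_Iio (a := k))

open Classical in
-- Chernoff's method with exponent 1/k: on the event the count divided by k is below 1, so e ·
-- exp(-count/k) dominates the indicator. By independence its mean is e times an N-th power, and
-- each factor is at most 1 - Q(B)/(2k) ≤ exp(-Q(B)/(2k)).
lemma measureReal_pi_card_lt_le {B : Set E} (hB : MeasurableSet B) (N : ℕ) {k : ℕ} (hk : 1 ≤ k) :
    (Measure.pi fun _ : Fin N => Q).real {w | (Finset.univ.filter fun l => w l ∈ B).card < k}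
      ≤ Real.exp 1 * Real.exp (-(N * Q.real B / (2 * k))) := by
  have hk0 : (0 : ℝ) < k := by exact_mod_cast hk
  let φ : E → ℝ := fun e => Real.exp (-(B.indicator 1 e / k))
  have hφ : Measurable φ := by
    have : Measurable (B.indicator (1 : E → ℝ)) := measurable_one.indicator hB
    fun_prop
  have hprod : ∀ w : Fin N → E,
      ∏ l, φ (w l) = Real.exp (-((Finset.univ.filter fun l => w l ∈ B).card / k)) := by
    intro w
    rw [← Real.exp_sum]
    congr 1
    rw [Finset.sum_neg_distrib, ← Finset.sum_div]
    congr 2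
    rw [← Finset.sum_boole]
    exact Finset.sum_congr rfl fun l _ => by simp [Set.indicator_apply]
  have hφ1 : ∀ e, |φ e| ≤ 1 := fun e => by
    rw [abs_of_pos (Real.exp_pos _), Real.exp_le_one_iff]
    have : 0 ≤ B.indicator (1 : E → ℝ) e := Set.indicator_nonneg (fun _ _ => zero_le_one) e
    have := div_nonneg this hk0.le
    linarith
  have hmeasP : Measurable fun w : Fin N → E => ∏ l, φ (w l) := by fun_prop
  have hprod1 : ∀ w : Fin N → E, |∏ l, φ (w l)| ≤ 1 := fun w => by
    rw [Finset.abs_prod]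
    exact Finset.prod_le_one (fun _ _ => abs_nonneg _) fun l _ => hφ1 _
  have hint : ∫ e, φ e ∂Q ≤ Real.exp (-(Q.real B / (2 * k))) := by
    have h1 : ∀ e, φ e ≤ 1 - B.indicator 1 e * (1 / (2 * k)) := fun e => by
      have h2 := exp_neg_le_one_sub_half (s := B.indicator 1 e / k)
        (div_nonneg (Set.indicator_nonneg (fun _ _ => zero_le_one) e) hk0.le) (by
          rw [div_le_one hk0]
          have : B.indicator (1 : E → ℝ) e ≤ 1 := Set.indicator_le_self' (by simp) e
          exact this.trans (by exact_mod_cast hk))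
      refine h2.trans (le_of_eq ?_)
      field_simp
    have hBi : Integrable (B.indicator (1 : E → ℝ)) Q :=
      (integrable_indicator_iff hB).2 (integrable_const (1 : ℝ)).integrableOn
    calc ∫ e, φ e ∂Q ≤ ∫ e, (1 - B.indicator (1 : E → ℝ) e * (1 / (2 * k))) ∂Q :=
          integral_mono (integrable_of_measurable_of_abs_le hφ 1 hφ1)
            ((integrable_const _).sub (hBi.mul_const _)) h1
      _ = 1 - Q.real B / (2 * k) := by
          rw [integral_sub (integrable_const _) (hBi.mul_const _), integral_mul_const,
            integral_indicator_one hB]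
          simp; ring
      _ ≤ _ := by
          have := Real.add_one_le_exp (-(Q.real B / (2 * k)))
          linarith
  have hmeas := measurableSet_card_lt hB N k
  calc _ = ∫ w, ({w : Fin N → E | (Finset.univ.filter fun l => w l ∈ B).card < k}).indicator
          (1 : (Fin N → E) → ℝ) w
        ∂(Measure.pi fun _ : Fin N => Q) := (integral_indicator_one hmeas).symm
    _ ≤ ∫ w, Real.exp 1 * ∏ l, φ (w l) ∂(Measure.pi fun _ : Fin N => Q) := by
        refine integral_mono ((integrable_indicator_iff hmeas).2
          (integrable_const (1 : ℝ)).integrableOn)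
          ((integrable_of_measurable_of_abs_le hmeasP 1 hprod1).const_mul _) fun w => ?_
        dsimp only
        rw [hprod, ← Real.exp_add]
        refine Set.indicator_apply_le' (fun hw => ?_) fun _ => (Real.exp_pos _).le
        refine Real.one_le_exp ?_
        have h1 : ((Finset.univ.filter fun l => w l ∈ B).card : ℝ) / k ≤ 1 := by
          rw [div_le_one hk0]
          have h2 : (Finset.univ.filter fun l => w l ∈ B).card < k := hw
          exact_mod_cast h2.le
        linarith
    _ = Real.exp 1 * (∫ e, φ e ∂Q) ^ N := by
        rw [integral_const_mul, integral_fintype_prod_eq_prod (fun _ : Fin N => φ)]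
        simp
    _ ≤ Real.exp 1 * Real.exp (-(Q.real B / (2 * k))) ^ N := by
        gcongr
    _ = _ := by
        rw [← Real.exp_nat_mul]
        congr 2
        ring

end Chernoff

/-! ### Moments of the mass of the cell of a sample point -/

section CellMass

variable {d : ℕ}

open Classical in
/-- The indicator that sample point number `j` is a neighbour of `z`. -/
noncomputable def neighborInd {n : ℕ} (k : ℕ) (x : Fin n → Inp d) (j : Fin n) (z : Inp d) : ℝ :=
  if IsNeighbor x k z j then 1 else 0

lemma neighborInd_nonneg {n : ℕ} (k : ℕ) (x : Fin n → Inp d) (j : Fin n) (z : Inp d) :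
    0 ≤ neighborInd k x j z := by
  unfold neighborInd; split_ifs <;> simp

lemma neighborInd_le_one {n : ℕ} (k : ℕ) (x : Fin n → Inp d) (j : Fin n) (z : Inp d) :
    neighborInd k x j z ≤ 1 := by
  unfold neighborInd; split_ifs <;> simp

lemma abs_neighborInd_le {n : ℕ} (k : ℕ) (x : Fin n → Inp d) (j : Fin n) (z : Inp d) :
    |neighborInd k x j z| ≤ 1 := by
  rw [abs_of_nonneg (neighborInd_nonneg _ _ _ _)]; exact neighborInd_le_one _ _ _ _

lemma measurable_neighborInd {α : Type*} [MeasurableSpace α] {n : ℕ} {x : Fin n → α → Inp d}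
    (hx : ∀ j, Measurable (x j)) {z : α → Inp d} (hz : Measurable z) (k : ℕ) (j : Fin n) :
    Measurable fun a => neighborInd k (fun i => x i a) j (z a) := by
  classical
  exact Measurable.ite (measurableSet_isNeighbor hx hz k j) measurable_const measurable_const

/-- The inputs of a labelled sample. -/
def inputs {n : ℕ} (w : Fin n → Inp d × Label) : Fin n → Inp d := fun j => (w j).1

/-- The labels of a labelled sample. -/
def labels {n : ℕ} (w : Fin n → Inp d × Label) : Fin n → Label := fun j => (w j).2

lemma measurable_neighborInd_inputs {α : Type*} [MeasurableSpace α] {n : ℕ}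
    {w : α → Fin n → Inp d × Label} (hw : Measurable w) {z : α → Inp d} (hz : Measurable z)
    (k : ℕ) (j : Fin n) : Measurable fun a => neighborInd k (inputs (w a)) j (z a) :=
  measurable_neighborInd (x := fun j a => (w a j).1) (fun j => by fun_prop) hz k j

lemma measurable_insertNth_comp {α E : Type*} [MeasurableSpace α] [MeasurableSpace E] {N : ℕ}
    (j : Fin (N + 1)) {e : α → E} (he : Measurable e) {w : α → Fin N → E} (hw : Measurable w) :
    Measurable fun a => (j.insertNth (e a) (w a) : Fin (N + 1) → E) :=
  (measurable_insertNth j).comp (he.prodMk hw)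

variable (Q : Measure (Inp d × Label))

/-- The mass of the set of all points of which sample point number `j` is a neighbour. -/
noncomputable def cellMass {n : ℕ} (k : ℕ) (w : Fin n → Inp d × Label) (j : Fin n) : ℝ :=
  ∫ z, neighborInd k (inputs w) j z ∂Q.fst

variable [IsProbabilityMeasure Q]

lemma measurable_cellMass {n : ℕ} (k : ℕ) (j : Fin n) :
    Measurable fun w : Fin n → Inp d × Label => cellMass Q k w j :=
  (measurable_neighborInd_inputs (α := (Fin n → Inp d × Label) × Inp d)
    measurable_fst measurable_snd k j).stronglyMeasurable.integral_prod_right'.measurable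

lemma abs_cellMass_le {n : ℕ} (k : ℕ) (w : Fin n → Inp d × Label) (j : Fin n) :
    |cellMass Q k w j| ≤ 1 := abs_integral_le_of_abs_le fun _ => abs_neighborInd_le _ _ _ _

/-- If point j, fixed at e, is a neighbour of z, then fewer than k of the other N points fall into
the open ball around z with e on its boundary; the exponential bound applies to this event. -/
lemma integral_neighborInd_insertNth_le {N k : ℕ} (hk : 1 ≤ k) (j : Fin (N + 1))
    (e : Inp d × Label) (z : Inp d) :
    ∫ w', neighborInd k (inputs (j.insertNth e w' : Fin (N + 1) → Inp d × Label)) j z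
        ∂(Measure.pi fun _ : Fin N => Q)
      ≤ Real.exp 1 * Real.exp (-(N * ballMass Q.fst e.1 z / (2 * k))) := by
  classical
  set B : Set (Inp d × Label) := Prod.fst ⁻¹' Metric.ball z (dist z e.1) with hB
  have hBm : MeasurableSet B := measurable_fst Metric.isOpen_ball.measurableSet
  have hBR : Q.real B = ballMass Q.fst e.1 z := by
    rw [ballMass, Measure.real, Measure.real, Measure.fst_apply Metric.isOpen_ball.measurableSet]
  rw [← hBR]
  refine le_trans ?_ (measureReal_pi_card_lt_le Q hBm N hk)
  have hmeas := measurableSet_card_lt hBm N k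
  rw [← integral_indicator_one hmeas]
  have hins : Measurable fun w' : Fin N → Inp d × Label =>
      (j.insertNth e w' : Fin (N + 1) → Inp d × Label) :=
    measurable_insertNth_comp j measurable_const measurable_id
  have hm := measurable_neighborInd_inputs hins (measurable_const (a := z)) k j
  refine integral_mono (integrable_of_measurable_of_abs_le hm 1 fun _ => abs_neighborInd_le _ _ _ _)
    ((integrable_indicator_iff hmeas).2 (integrable_const (1 : ℝ)).integrableOn) fun w' => ?_
  dsimp only
  by_cases h : IsNeighbor (inputs (j.insertNth e w' : Fin (N + 1) → Inp d × Label)) k z j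
  · have hc := card_lt_of_isNeighbor h
    have hmem : w' ∈ {w : Fin N → Inp d × Label |
        (Finset.univ.filter fun l => w l ∈ B).card < k} := by
      refine lt_of_le_of_lt ?_ hc
      rw [← Finset.card_map (Fin.succAboveEmb j)]
      refine Finset.card_le_card fun i hi => ?_
      obtain ⟨l, hl, rfl⟩ := Finset.mem_map.1 hi
      have hl' := (Finset.mem_filter.1 hl).2
      refine Finset.mem_filter.2 ⟨Finset.mem_univ _, ?_⟩
      simp only [inputs, Fin.coe_succAboveEmb, Fin.insertNth_apply_succAbove,
        Fin.insertNth_apply_same]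
      simp only [hB, Set.mem_preimage, Metric.mem_ball] at hl'
      rwa [dist_comm e.1 z]
    rw [Set.indicator_of_mem hmem]
    exact neighborInd_le_one _ _ _ _
  · rw [neighborInd, if_neg h]
    exact Set.indicator_nonneg (fun _ _ => zero_le_one) _

/-- The first moment bound behind Stone's theorem. -/
lemma integral_mul_cellMass_le {K : ℝ}
    (hK : ∀ (u : Inp d) (t : ℝ), 0 < t →
      ∫ z, Real.exp (-(ballMass Q.fst u z / t)) ∂Q.fst ≤ K * t)
    {N k : ℕ} (hN : 1 ≤ N) (hk : 1 ≤ k) (j : Fin (N + 1)) {v : Inp d × Label → ℝ}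
    (hv : Measurable v) {C : ℝ} (hvC : ∀ e, |v e| ≤ C) (hv0 : ∀ e, 0 ≤ v e) :
    ∫ w, v (w j) * cellMass Q k w j ∂(Measure.pi fun _ : Fin (N + 1) => Q)
      ≤ Real.exp 1 * (K * (2 * k / N)) * ∫ e, v e ∂Q := by
  have hk0 : (0 : ℝ) < k := by exact_mod_cast hk
  have hN0 : (0 : ℝ) < N := by exact_mod_cast hN
  have hC : 0 ≤ C := by
    obtain ⟨e⟩ := nonempty_of_isProbabilityMeasure Q
    exact (abs_nonneg _).trans (hvC e)
  let ins : (Inp d × Label) × (Fin N → Inp d × Label) → (Fin (N + 1) → Inp d × Label) :=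
    fun p => j.insertNth p.1 p.2
  have hins : Measurable ins := measurable_insertNth j
  have hcm : Measurable fun p => cellMass Q k (ins p) j := (measurable_cellMass Q k j).comp hins
  have hcell : ∀ e, ∫ w', cellMass Q k (ins (e, w')) j ∂(Measure.pi fun _ : Fin N => Q)
      ≤ Real.exp 1 * (K * (2 * k / N)) := fun e => by
    have hm : Measurable fun q : (Fin N → Inp d × Label) × Inp d =>
        neighborInd k (inputs (ins (e, q.1))) j q.2 :=
      measurable_neighborInd_inputs
        (measurable_insertNth_comp j (measurable_const (a := e)) measurable_fst) measurable_snd k j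
    unfold cellMass
    have i1 : Integrable (fun q : (Fin N → Inp d × Label) × Inp d =>
        neighborInd k (inputs (ins (e, q.1))) j q.2)
        ((Measure.pi fun _ : Fin N => Q).prod Q.fst) :=
      integrable_of_measurable_of_abs_le hm 1 fun _ => abs_neighborInd_le _ _ _ _
    -- By Fubini, z may be fixed first. The probability that j is its neighbour is exponentially
    -- small in `ballMass`, and integrating over z is the covering bound with t = 2k/N.
    rw [integral_integral_swap i1]
    have hmb := measurable_ballMass_right Q.fst e.1
    calc _ ≤ ∫ z, Real.exp 1 * Real.exp (-(ballMass Q.fst e.1 z / (2 * k / N))) ∂Q.fst := by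
          refine integral_mono
            (integrable_of_measurable_of_abs_le
              (hm.stronglyMeasurable.integral_prod_left' (μ := Measure.pi fun _ => Q)).measurable 1
              fun z => abs_integral_le_of_abs_le fun _ => abs_neighborInd_le _ _ _ _)
            ((integrable_of_measurable_of_abs_le (by fun_prop) 1 fun z => ?_).const_mul _)
            fun z => ?_
          · rw [abs_of_pos (Real.exp_pos _), Real.exp_le_one_iff]
            have := ballMass_nonneg Q.fst e.1 z
            have : 0 ≤ ballMass Q.fst e.1 z / (2 * k / N) := by positivity
            linarith
          · refine (integral_neighborInd_insertNth_le Q hk j e z).trans (le_of_eq ?_)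
            congr 3
            field_simp
      _ ≤ _ := by
          rw [integral_const_mul]
          gcongr
          exact hK _ _ (by positivity)
  have hint : Integrable (fun p => v (ins p j) * cellMass Q k (ins p) j)
      (Q.prod (Measure.pi fun _ : Fin N => Q)) :=
    integrable_of_measurable_of_abs_le
      ((hv.comp ((measurable_pi_apply j).comp hins)).mul hcm) (C * 1) fun p => by
        rw [abs_mul]
        exact mul_le_mul (hvC _) (abs_cellMass_le Q k _ j) (abs_nonneg _) hC
  rw [integral_pi_insertNth Q j, integral_prod _ hint, ← integral_const_mul]
  refine integral_mono hint.integral_prod_left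
    ((integrable_of_measurable_of_abs_le hv C hvC).const_mul _) fun e => ?_
  have hve : ∀ w', v (ins (e, w') j) = v e := fun w' => by simp [ins]
  simp only [hve]
  rw [integral_const_mul, mul_comm]
  exact mul_le_mul_of_nonneg_right (hcell e) (hv0 e)

/-- Hölder's inequality with exponents 4 and 4/3 for the product of I e^(3b/4) and e^(-3b/4), where
I = I⁴. It is proved from the tangent of the fourth power at r = ∫I / c. -/
lemma pow_four_integral_le_of_weight {Ω : Type*} [MeasurableSpace Ω] {μ : Measure Ω}
    [IsProbabilityMeasure μ] {I b : Ω → ℝ} (hI : Measurable I) (hb : Measurable b)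
    (hI01 : ∀ ω, I ω = 0 ∨ I ω = 1) (hb0 : ∀ ω, 0 ≤ b ω) {B : ℝ} (hbB : ∀ ω, b ω ≤ B) {c : ℝ}
    (hc0 : 0 < c) (hc : ∫ ω, Real.exp (-b ω) ∂μ ≤ c) :
    (∫ ω, I ω ∂μ) ^ 4 ≤ c ^ 3 * ∫ ω, I ω * Real.exp (3 * b ω) ∂μ := by
  set m := ∫ ω, I ω ∂μ with hm
  have hIa : ∀ ω, |I ω| ≤ 1 := fun ω => by rcases hI01 ω with h | h <;> simp [h]
  have hI0 : ∀ ω, 0 ≤ I ω := fun ω => by rcases hI01 ω with h | h <;> simp [h]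
  have hm0 : 0 ≤ m := integral_nonneg hI0
  set r := m / c with hr
  have hr0 : 0 ≤ r := by positivity
  have i1 : Integrable I μ := integrable_of_measurable_of_abs_le hI 1 hIa
  have i2 : Integrable (fun ω => Real.exp (-b ω)) μ :=
    integrable_of_measurable_of_abs_le (by fun_prop) 1 fun ω => by
      rw [abs_of_pos (Real.exp_pos _), Real.exp_le_one_iff]; linarith [hb0 ω]
  have i3 : Integrable (fun ω => I ω * Real.exp (3 * b ω)) μ :=
    integrable_of_measurable_of_abs_le (by fun_prop) (1 * Real.exp (3 * B)) fun ω => by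
      rw [abs_mul, abs_of_pos (Real.exp_pos _)]
      exact mul_le_mul (hIa ω) (Real.exp_le_exp.2 (by linarith [hbB ω])) (Real.exp_pos _).le
        zero_le_one
  have hpt : ∀ ω, 4 * r ^ 3 * I ω - 3 * r ^ 4 * Real.exp (-b ω) ≤ I ω * Real.exp (3 * b ω) := by
    intro ω
    have he := Real.exp_pos (-b ω)
    rcases hI01 ω with h | h
    · rw [h]
      have : 0 ≤ 3 * r ^ 4 * Real.exp (-b ω) := by positivity
      linarith
    · rw [h]
      set φ := Real.exp (b ω) with hφ
      have h1 : Real.exp (-b ω) * φ = 1 := by rw [hφ, ← Real.exp_add]; simp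
      have h3 : Real.exp (3 * b ω) = Real.exp (-b ω) * φ ^ 4 := by
        rw [hφ, ← Real.exp_nat_mul, ← Real.exp_add]; congr 1; push_cast; ring
      -- The graph of φ⁴ lies above its tangent at r.
      have h4 : 4 * r ^ 3 * φ - 3 * r ^ 4 ≤ φ ^ 4 := by
        nlinarith [sq_nonneg (φ ^ 2 - r ^ 2), mul_nonneg (sq_nonneg r) (sq_nonneg (φ - r)),
          sq_nonneg (φ - r)]
      calc 4 * r ^ 3 * 1 - 3 * r ^ 4 * Real.exp (-b ω)
          = Real.exp (-b ω) * (4 * r ^ 3 * φ - 3 * r ^ 4) := by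
            rw [← h1]; ring
        _ ≤ Real.exp (-b ω) * φ ^ 4 := by gcongr
        _ = _ := by rw [h3, one_mul]
  have hint := integral_mono ((i1.const_mul (4 * r ^ 3)).sub (i2.const_mul (3 * r ^ 4))) i3 hpt
  dsimp only [Pi.sub_apply] at hint
  rw [integral_sub (i1.const_mul (4 * r ^ 3)) (i2.const_mul (3 * r ^ 4)), integral_const_mul,
    integral_const_mul, ← hm] at hint
  have h5 : 4 * r ^ 3 * m - 3 * r ^ 4 * c ≤ ∫ ω, I ω * Real.exp (3 * b ω) ∂μ := by
    have : 3 * r ^ 4 * ∫ ω, Real.exp (-b ω) ∂μ ≤ 3 * r ^ 4 * c := by gcongr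
    linarith
  have hmrc : m = r * c := by rw [hr]; field_simp
  calc m ^ 4 = c ^ 3 * (4 * r ^ 3 * m - 3 * r ^ 4 * c) := by rw [hmrc]; ring
    _ ≤ _ := by gcongr

/-- Expanding the fourth power would require four points z at once. Hölder's inequality with weight
b = `ballMass`/t reduces it to the probability for a single z. With t = 8k/N this probability is at
most e · exp(-4b), which pays for the factor exp(3b) and leaves the integrable exp(-b). -/
lemma integral_cellMass_pow_four_le {K : ℝ} (hK0 : 0 < K)
    (hK : ∀ (u : Inp d) (t : ℝ), 0 < t →
      ∫ z, Real.exp (-(ballMass Q.fst u z / t)) ∂Q.fst ≤ K * t)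
    {N k : ℕ} (hN : 1 ≤ N) (hk : 1 ≤ k) (j : Fin (N + 1)) :
    ∫ w, cellMass Q k w j ^ 4 ∂(Measure.pi fun _ : Fin (N + 1) => Q)
      ≤ Real.exp 1 * (K * (8 * k / N)) ^ 4 := by
  have hk0 : (0 : ℝ) < k := by exact_mod_cast hk
  have hN0 : (0 : ℝ) < N := by exact_mod_cast hN
  set t : ℝ := 8 * k / N with ht
  have ht0 : 0 < t := by positivity
  let ins : (Inp d × Label) × (Fin N → Inp d × Label) → (Fin (N + 1) → Inp d × Label) :=
    fun p => j.insertNth p.1 p.2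
  have hins : Measurable ins := measurable_insertNth j
  have hb0 : ∀ u z, 0 ≤ ballMass Q.fst u z / t := fun u z =>
    div_nonneg (ballMass_nonneg _ _ _) ht0.le
  have hb1 : ∀ u z, ballMass Q.fst u z / t ≤ 1 / t := fun u z => by
    have : ballMass Q.fst u z ≤ 1 := measureReal_le_one
    gcongr
  have hcell : ∀ e, ∫ w', cellMass Q k (ins (e, w')) j ^ 4 ∂(Measure.pi fun _ : Fin N => Q)
      ≤ Real.exp 1 * (K * t) ^ 4 := fun e => by
    have hm : Measurable fun q : (Fin N → Inp d × Label) × Inp d =>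
        neighborInd k (inputs (ins (e, q.1))) j q.2 :=
      measurable_neighborInd_inputs
        (measurable_insertNth_comp j (measurable_const (a := e)) measurable_fst) measurable_snd k j
    have hmb := measurable_ballMass_right Q.fst e.1
    have hmb2 : Measurable fun q : (Fin N → Inp d × Label) × Inp d =>
        ballMass Q.fst e.1 q.2 := hmb.comp measurable_snd
    have hm3 : Measurable fun q : (Fin N → Inp d × Label) × Inp d =>
        neighborInd k (inputs (ins (e, q.1))) j q.2 * Real.exp (3 * (ballMass Q.fst e.1 q.2 / t)) := by
      fun_prop
    have hb3 : ∀ q : (Fin N → Inp d × Label) × Inp d,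
        |neighborInd k (inputs (ins (e, q.1))) j q.2 * Real.exp (3 * (ballMass Q.fst e.1 q.2 / t))|
          ≤ 1 * Real.exp (3 * (1 / t)) := fun q => by
      rw [abs_mul, abs_of_pos (Real.exp_pos _)]
      exact mul_le_mul (abs_neighborInd_le _ _ _ _)
        (Real.exp_le_exp.2 (by linarith [hb1 e.1 q.2])) (Real.exp_pos _).le zero_le_one
    have i3 := integrable_of_measurable_of_abs_le (μ := (Measure.pi fun _ : Fin N => Q).prod Q.fst)
      hm3 _ hb3
    have hstep : ∀ w', cellMass Q k (ins (e, w')) j ^ 4 ≤ (K * t) ^ 3 *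
        ∫ z, neighborInd k (inputs (ins (e, w'))) j z
          * Real.exp (3 * (ballMass Q.fst e.1 z / t)) ∂Q.fst := fun w' =>
      pow_four_integral_le_of_weight (I := fun z => neighborInd k (inputs (ins (e, w'))) j z)
        (measurable_neighborInd_inputs measurable_const measurable_id k j)
        (hmb.div_const t) (fun z => by
          dsimp only [neighborInd]
          split_ifs <;> simp) (hb0 _) (hb1 _) (by positivity) (hK _ _ ht0)
    calc _ ≤ ∫ w', (K * t) ^ 3 * ∫ z, neighborInd k (inputs (ins (e, w'))) j z
            * Real.exp (3 * (ballMass Q.fst e.1 z / t)) ∂Q.fst ∂(Measure.pi fun _ : Fin N => Q) := by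
          refine integral_mono (integrable_of_measurable_of_abs_le
            (((measurable_cellMass Q k j).comp
              (measurable_insertNth_comp j measurable_const measurable_id)).pow_const 4) (1 ^ 4) fun w' =>
              abs_pow_le_pow_of_abs_le (abs_cellMass_le Q k _ j) 4)
            (i3.integral_prod_left.const_mul _) hstep
      _ = (K * t) ^ 3 * ∫ z, (∫ w', neighborInd k (inputs (ins (e, w'))) j z
            ∂(Measure.pi fun _ : Fin N => Q)) * Real.exp (3 * (ballMass Q.fst e.1 z / t)) ∂Q.fst := by
          rw [integral_const_mul, integral_integral_swap i3]
          simp only [integral_mul_const]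
      _ ≤ (K * t) ^ 3 * ∫ z, Real.exp 1 * Real.exp (-(ballMass Q.fst e.1 z / t)) ∂Q.fst := by
          gcongr ?_ * ?_
          refine integral_mono ?_
            ((integrable_of_measurable_of_abs_le (by fun_prop) 1 fun z => ?_).const_mul _)
            fun z => ?_
          · have := i3.integral_prod_right
            simpa only [integral_mul_const] using this
          · rw [abs_of_pos (Real.exp_pos _), Real.exp_le_one_iff]
            linarith [hb0 e.1 z]
          · dsimp only
            have h1 := integral_neighborInd_insertNth_le Q hk j e z
            calc _ ≤ (Real.exp 1 * Real.exp (-(N * ballMass Q.fst e.1 z / (2 * k))))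
                    * Real.exp (3 * (ballMass Q.fst e.1 z / t)) := by gcongr
              _ = _ := by
                  rw [mul_assoc, ← Real.exp_add]
                  congr 2
                  rw [ht]; field_simp; ring
      _ ≤ (K * t) ^ 3 * (Real.exp 1 * (K * t)) := by
          rw [integral_const_mul]
          gcongr
          exact hK _ _ ht0
      _ = _ := by ring
  have hint : Integrable (fun p => cellMass Q k (ins p) j ^ 4)
      (Q.prod (Measure.pi fun _ : Fin N => Q)) :=
    integrable_of_measurable_of_abs_le (((measurable_cellMass Q k j).comp hins).pow_const 4)
      (1 ^ 4) fun p => abs_pow_le_pow_of_abs_le (abs_cellMass_le Q k _ j) 4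
  rw [integral_pi_insertNth Q j, integral_prod _ hint]
  calc _ ≤ ∫ e, Real.exp 1 * (K * t) ^ 4 ∂Q :=
        integral_mono hint.integral_prod_left (integrable_const _) hcell
    _ = _ := by simp

end CellMass

/-! ### The integrated absolute error of the nearest neighbour estimate -/

section Error

variable {d : ℕ} (Q : Measure (Inp d × Label)) [IsProbabilityMeasure Q] {g : Inp d → ℝ}

/-- The integrated absolute error of the nearest neighbour estimate of `g`. -/
noncomputable def knnError {n : ℕ} (g : Inp d → ℝ) (k : ℕ) (w : Fin n → Inp d × Label) : ℝ :=
  ∫ z, |knnEstimate k (inputs w) (labels w) z - g z| ∂Q.fst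

lemma measurable_knnEstimate_inputs {α : Type*} [MeasurableSpace α] {n : ℕ}
    {w : α → Fin n → Inp d × Label} (hw : Measurable w) {z : α → Inp d} (hz : Measurable z)
    (k : ℕ) : Measurable fun a => knnEstimate k (inputs (w a)) (labels (w a)) (z a) :=
  measurable_knnEstimate (x := fun j a => (w a j).1) (fun j => by fun_prop)
    (y := fun j a => (w a j).2) (fun j => by fun_prop) hz k

lemma measurable_leaveOneOutEstimate_inputs {α : Type*} [MeasurableSpace α] {n : ℕ}
    {w : α → Fin n → Inp d × Label} (hw : Measurable w) {z : α → Inp d} (hz : Measurable z)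
    (k : ℕ) (j : Fin n) :
    Measurable fun a => leaveOneOutEstimate k (inputs (w a)) (labels (w a)) j (z a) :=
  measurable_leaveOneOutEstimate (x := fun j a => (w a j).1) (fun j => by fun_prop)
    (y := fun j a => (w a j).2) (fun j => by fun_prop) hz k j

lemma abs_abs_sub_le_two {a b : ℝ} (ha : |a| ≤ 1) (hb : |b| ≤ 1) : |(|a - b|)| ≤ 2 := by
  rw [abs_abs]; exact (abs_sub a b).trans (by linarith)

lemma measurable_abs_knnEstimate_sub (hg : Measurable g) {n : ℕ} (k : ℕ) :
    Measurable fun p : (Fin n → Inp d × Label) × Inp d =>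
      |knnEstimate k (inputs p.1) (labels p.1) p.2 - g p.2| :=
  measurable_norm.comp ((measurable_knnEstimate_inputs measurable_fst measurable_snd k).sub
    (hg.comp measurable_snd))

lemma measurable_knnError (hg : Measurable g) {n : ℕ} (k : ℕ) :
    Measurable fun w : Fin n → Inp d × Label => knnError Q g k w :=
  (measurable_abs_knnEstimate_sub hg k).stronglyMeasurable.integral_prod_right'.measurable

lemma abs_knnError_le (hg1 : ∀ z, |g z| ≤ 1) {n : ℕ} (k : ℕ) (w : Fin n → Inp d × Label) :
    |knnError Q g k w| ≤ 2 :=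
  abs_integral_le_of_abs_le fun z => abs_abs_sub_le_two (abs_knnEstimate_le _ _ _ _) (hg1 z)

/-- The fluctuations of the error around its mean. -/
lemma integral_knnError_sub_pow_four_le (hg : Measurable g) (hg1 : ∀ z, |g z| ≤ 1) {K : ℝ}
    (hK0 : 0 < K)
    (hK : ∀ (u : Inp d) (t : ℝ), 0 < t →
      ∫ z, Real.exp (-(ballMass Q.fst u z / t)) ∂Q.fst ≤ K * t)
    {N k : ℕ} (hN : 1 ≤ N) (hk : 1 ≤ k) :
    ∫ w, (knnError Q g k w - ∫ v, knnError Q g k v ∂(Measure.pi fun _ : Fin (N + 1) => Q)) ^ 4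
        ∂(Measure.pi fun _ : Fin (N + 1) => Q)
      ≤ (48 * (4 * (Real.exp 1 * (8 * K) ^ 2))) ^ 2 / N ^ 2 := by
  have hk0 : (0 : ℝ) < k := by exact_mod_cast hk
  have hN0 : (0 : ℝ) < N := by exact_mod_cast hN
  -- The error recomputed without sample point j.
  let U : Fin (N + 1) → (Fin (N + 1) → Inp d × Label) → ℝ := fun j w =>
    ∫ z, |leaveOneOutEstimate k (inputs w) (labels w) j z - g z| ∂Q.fst
  have hlooM : ∀ j, Measurable fun p : (Fin (N + 1) → Inp d × Label) × Inp d =>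
      |leaveOneOutEstimate k (inputs p.1) (labels p.1) j p.2 - g p.2| := fun j =>
    measurable_norm.comp ((measurable_leaveOneOutEstimate_inputs measurable_fst measurable_snd k j).sub
      (hg.comp measurable_snd))
  have hU : ∀ j, Measurable (U j) := fun j =>
    (hlooM j).stronglyMeasurable.integral_prod_right'.measurable
  have hUC : ∀ j w, |U j w| ≤ 2 := fun j w =>
    abs_integral_le_of_abs_le fun z =>
      abs_abs_sub_le_two (abs_leaveOneOutEstimate_le _ _ _ _ _) (hg1 z)
  have hdiff : ∀ j w, |knnError Q g k w - U j w| ≤ 2 / k * cellMass Q k w j := fun j w => by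
    have i1 : Integrable (fun z => |knnEstimate k (inputs w) (labels w) z - g z|) Q.fst :=
      integrable_of_measurable_of_abs_le (measurable_norm.comp
        ((measurable_knnEstimate_inputs measurable_const measurable_id k).sub hg)) 2
        fun z => abs_abs_sub_le_two (abs_knnEstimate_le _ _ _ _) (hg1 z)
    have i2 : Integrable (fun z => |leaveOneOutEstimate k (inputs w) (labels w) j z - g z|) Q.fst :=
      integrable_of_measurable_of_abs_le (measurable_norm.comp
        ((measurable_leaveOneOutEstimate_inputs measurable_const measurable_id k j).sub hg)) 2
        fun z => abs_abs_sub_le_two (abs_leaveOneOutEstimate_le _ _ _ _ _) (hg1 z)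
    have i3 : Integrable (fun z => neighborInd k (inputs w) j z) Q.fst :=
      integrable_of_measurable_of_abs_le
        (measurable_neighborInd_inputs measurable_const measurable_id k j) 1
        fun z => abs_neighborInd_le _ _ _ _
    rw [knnError, cellMass, ← integral_sub i1 i2, ← integral_const_mul]
    refine (abs_integral_le_integral_abs).trans
      (integral_mono (i1.sub i2).abs (i3.const_mul _) fun z => ?_)
    refine (abs_abs_sub_abs_le _ _).trans ?_
    rw [sub_sub_sub_cancel_right]
    exact abs_knnEstimate_sub_leaveOneOutEstimate_le _ _ _ _
  -- The window size cancels: (2/k)⁴ · e(8Kk/N)⁴ = 16e(8K)⁴/N⁴. Enlarging e to e² makes this the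
  -- square of s.
  set s : ℝ := 4 * (Real.exp 1 * (8 * K) ^ 2) / N ^ 2 with hs
  have hs0 : 0 < s := by positivity
  have h4 : ∀ j, ∫ w, (knnError Q g k w - U j w) ^ 4 ∂(Measure.pi fun _ : Fin (N + 1) => Q)
      ≤ s ^ 2 := fun j => by
    have i4 : Integrable (fun w : Fin (N + 1) → Inp d × Label => cellMass Q k w j ^ 4)
        (Measure.pi fun _ : Fin (N + 1) => Q) :=
      integrable_of_measurable_of_abs_le ((measurable_cellMass Q k j).pow_const 4) (1 ^ 4)
        fun w => abs_pow_le_pow_of_abs_le (abs_cellMass_le Q k _ j) 4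
    calc _ ≤ ∫ w, (2 / k : ℝ) ^ 4 * cellMass Q k w j ^ 4
            ∂(Measure.pi fun _ : Fin (N + 1) => Q) := by
          refine integral_mono (integrable_of_measurable_of_abs_le
            (((measurable_knnError Q hg k).sub (hU j)).pow_const 4) ((2 + 2) ^ 4) fun w =>
            abs_pow_le_pow_of_abs_le ((abs_sub _ _).trans
              (add_le_add (abs_knnError_le Q hg1 k w) (hUC j w))) 4) (i4.const_mul _) fun w => ?_
          dsimp only
          rw [← mul_pow, ← Even.pow_abs (by decide : Even 4)]
          exact pow_le_pow_left₀ (abs_nonneg _) (hdiff j w) 4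
      _ ≤ (2 / k : ℝ) ^ 4 * (Real.exp 1 * (K * (8 * k / N)) ^ 4) := by
          rw [integral_const_mul]
          gcongr
          exact integral_cellMass_pow_four_le Q hK0 hK hN hk j
      _ = 16 * (Real.exp 1 * 1) * (8 * K) ^ 4 / N ^ 4 := by
          field_simp; ring
      _ ≤ 16 * (Real.exp 1 * Real.exp 1) * (8 * K) ^ 4 / N ^ 4 := by
          gcongr
          exact Real.one_le_exp zero_le_one
      _ = s ^ 2 := by rw [hs]; field_simp; ring
  refine (integral_sub_integral_pow_four_le_of_leaveOneOut Q hs0 (N + 1) (fun w => knnError Q g k w) U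
    (measurable_knnError Q hg k) hU (abs_knnError_le Q hg1 k) hUC (fun j w a => ?_) h4).trans ?_
  · refine integral_congr_ae (ae_of_all _ fun z => ?_)
    dsimp only
    rw [leaveOneOutEstimate_congr (x' := inputs w) (y' := labels w)]
    · intro l hl; simp [inputs, hl]
    · intro l hl; simp [labels, hl]
  · have hN1 : (1 : ℝ) ≤ N := by exact_mod_cast hN
    -- The sample has N + 1 points and the moment inequality adds one more; N + 2 ≤ 3N.
    have h1 : 16 * (((N + 1 : ℕ) : ℝ) + 1) * s ≤ 48 * (4 * (Real.exp 1 * (8 * K) ^ 2)) / N := by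
      have h2 : 48 * (4 * (Real.exp 1 * (8 * K) ^ 2)) / N = 16 * (3 * N) * s := by
        rw [hs]; field_simp; ring
      rw [h2]
      push_cast
      gcongr
      linarith
    rw [← div_pow]
    exact pow_le_pow_left₀ (by positivity) h1 2

end Error

/-! ### Convergence of the mean error -/

section MeanError

variable {d : ℕ} (Q : Measure (Inp d × Label)) [IsProbabilityMeasure Q] {g : Inp d → ℝ}

/-- The hypothesis `hreg` says that `g` is the regression function, tested against bounded functions
of the input. With all other points fixed, Φ is such a function of input j, so the integral over
point j vanishes. -/
lemma integral_mul_residual_eq_zero (hg : Measurable g) (hg1 : ∀ z, |g z| ≤ 1)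
    (hreg : ∀ v : Inp d → ℝ, Measurable v → (∃ C, ∀ z, |v z| ≤ C) →
      ∫ e, v e.1 * (e.2.toReal - g e.1) ∂Q = 0)
    {N : ℕ} (j : Fin (N + 1)) {Φ : (Fin (N + 1) → Inp d × Label) → ℝ} (hΦ : Measurable Φ) {C : ℝ}
    (hΦC : ∀ w, |Φ w| ≤ C)
    (hdep : ∀ (w' : Fin N → Inp d × Label) (u : Inp d) (s t : Label),
      Φ (j.insertNth (u, s) w') = Φ (j.insertNth (u, t) w')) :
    ∫ w, Φ w * ((w j).2.toReal - g (w j).1) ∂(Measure.pi fun _ => Q) = 0 := by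
  have hres : Measurable fun e : Inp d × Label => e.2.toReal - g e.1 :=
    (measurable_toReal_label.comp measurable_snd).sub (hg.comp measurable_fst)
  have hres2 : ∀ e : Inp d × Label, |e.2.toReal - g e.1| ≤ 2 := fun e =>
    (abs_sub _ _).trans (by linarith [abs_toReal_label e.2, hg1 e.1])
  have hm : Measurable fun w : Fin (N + 1) → Inp d × Label =>
      Φ w * ((w j).2.toReal - g (w j).1) := hΦ.mul (hres.comp (measurable_pi_apply j))
  have hb : ∀ w : Fin (N + 1) → Inp d × Label, |Φ w * ((w j).2.toReal - g (w j).1)| ≤ C * 2 :=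
    fun w => by
      rw [abs_mul]
      exact mul_le_mul (hΦC w) (hres2 _) (abs_nonneg _) ((abs_nonneg _).trans (hΦC w))
  rw [integral_pi_insertNth Q j, integral_prod_symm]
  · refine integral_eq_zero_of_ae (ae_of_all _ fun w' => ?_)
    simp only [Fin.insertNth_apply_same, Pi.zero_apply]
    -- Since Φ ignores label j, that label may be set to 1.
    rw [← hreg (fun u => Φ (j.insertNth (u, 1) w')) ?_ ⟨C, fun z => hΦC _⟩]
    · refine integral_congr_ae (ae_of_all _ fun e => ?_)
      dsimp only
      rw [hdep w' e.1 1 e.2]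
    · exact hΦ.comp (measurable_insertNth_comp j (measurable_id.prodMk measurable_const)
        measurable_const)
  · exact integrable_of_measurable_of_abs_le (hm.comp (measurable_insertNth j)) _ fun p => hb _

lemma inputs_insertNth {N : ℕ} (j : Fin (N + 1)) (e : Inp d × Label) (w' : Fin N → Inp d × Label) :
    inputs (j.insertNth e w' : Fin (N + 1) → Inp d × Label) = j.insertNth e.1 (inputs w') := by
  funext i
  refine Fin.succAboveCases j ?_ (fun i => ?_) i <;> simp [inputs]

/-- The noise part of the nearest neighbour estimate. -/
noncomputable def knnNoise {n : ℕ} (g : Inp d → ℝ) (k : ℕ) (w : Fin n → Inp d × Label)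
    (z : Inp d) : ℝ :=
  1 / (k : ℝ) * ∑ j, neighborInd k (inputs w) j z * ((w j).2.toReal - g (w j).1)

lemma sum_neighborInd_le {n : ℕ} (k : ℕ) (x : Fin n → Inp d) (z : Inp d) :
    ∑ j, neighborInd k x j z ≤ k := sum_isNeighbor_le x k z

lemma sum_neighborInd {n k : ℕ} (hk : k ≤ n) (x : Fin n → Inp d) (z : Inp d) :
    ∑ j, neighborInd k x j z = k := sum_isNeighbor x hk z

/-- Which points are neighbours depends on the inputs only, so residuals of different points are
orthogonal. On the diagonal at most k terms survive, each at most 4; the prefactor is 1/k². -/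
lemma integral_knnNoise_sq_le (hg : Measurable g) (hg1 : ∀ z, |g z| ≤ 1)
    (hreg : ∀ v : Inp d → ℝ, Measurable v → (∃ C, ∀ z, |v z| ≤ C) →
      ∫ e, v e.1 * (e.2.toReal - g e.1) ∂Q = 0)
    {N k : ℕ} (hk : 1 ≤ k) (z : Inp d) :
    ∫ w, knnNoise g k w z ^ 2 ∂(Measure.pi fun _ : Fin (N + 1) => Q) ≤ 4 / k := by
  have hk0 : (0 : ℝ) < k := by exact_mod_cast hk
  have hres : ∀ j : Fin (N + 1), Measurable fun w : Fin (N + 1) → Inp d × Label =>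
      (w j).2.toReal - g (w j).1 := fun j =>
    (measurable_toReal_label.comp (measurable_snd.comp (measurable_pi_apply j))).sub
      (hg.comp (measurable_fst.comp (measurable_pi_apply j)))
  have hres2 : ∀ (j : Fin (N + 1)) (w : Fin (N + 1) → Inp d × Label),
      |(w j).2.toReal - g (w j).1| ≤ 2 := fun j w =>
    (abs_sub _ _).trans (by linarith [abs_toReal_label (w j).2, hg1 (w j).1])
  have hnb : ∀ j : Fin (N + 1), Measurable fun w : Fin (N + 1) → Inp d × Label =>
      neighborInd k (inputs w) j z := fun j =>
    measurable_neighborInd_inputs measurable_id measurable_const k j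
  let A : Fin (N + 1) → Fin (N + 1) → (Fin (N + 1) → Inp d × Label) → ℝ := fun j l w =>
    (neighborInd k (inputs w) j z * neighborInd k (inputs w) l z * ((w l).2.toReal - g (w l).1))
      * ((w j).2.toReal - g (w j).1)
  have hAm' : ∀ j l, Measurable fun w : Fin (N + 1) → Inp d × Label => neighborInd k (inputs w) j z
      * neighborInd k (inputs w) l z * ((w l).2.toReal - g (w l).1) := fun j l =>
    ((hnb j).mul (hnb l)).mul (hres l)
  have hAm : ∀ j l, Measurable (A j l) := fun j l => (hAm' j l).mul (hres j)
  have hA' : ∀ j l (w : Fin (N + 1) → Inp d × Label), |neighborInd k (inputs w) j z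
      * neighborInd k (inputs w) l z * ((w l).2.toReal - g (w l).1)| ≤ 1 * 1 * 2 := fun j l w => by
    rw [abs_mul, abs_mul]
    exact mul_le_mul (mul_le_mul (abs_neighborInd_le _ _ _ _) (abs_neighborInd_le _ _ _ _)
      (abs_nonneg _) zero_le_one) (hres2 l w) (abs_nonneg _) (by norm_num)
  have hA : ∀ j l w, |A j l w| ≤ 1 * 1 * 2 * 2 := fun j l w => by
    simp only [A]
    rw [abs_mul]
    exact mul_le_mul (hA' j l w) (hres2 j w) (abs_nonneg _) (by norm_num)
  have iA : ∀ j l, Integrable (A j l) (Measure.pi fun _ : Fin (N + 1) => Q) := fun j l =>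
    integrable_of_measurable_of_abs_le (hAm j l) _ (hA j l)
  have hcross : ∀ j l, j ≠ l → ∫ w, A j l w ∂(Measure.pi fun _ : Fin (N + 1) => Q) = 0 := by
    intro j l hjl
    refine integral_mul_residual_eq_zero Q hg hg1 hreg j (hAm' j l) (hA' j l) fun w' u s t => ?_
    rw [inputs_insertNth, inputs_insertNth]
    obtain ⟨i, rfl⟩ := Fin.exists_succAbove_eq hjl.symm
    simp only [Fin.insertNth_apply_succAbove]
  have hdiag : ∀ w, ∑ j, A j j w ≤ 4 * k := fun w => by
    calc ∑ j, A j j w ≤ ∑ j, 4 * neighborInd k (inputs w) j z := by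
          refine Finset.sum_le_sum fun j _ => ?_
          have h1 := abs_le.1 (hres2 j w)
          have h2 : ((w j).2.toReal - g (w j).1) ^ 2 ≤ 4 := by nlinarith
          have h3 : neighborInd k (inputs w) j z * neighborInd k (inputs w) j z
              = neighborInd k (inputs w) j z := by
            unfold neighborInd; split_ifs <;> simp
          simp only [A, h3]
          have h4 := neighborInd_nonneg k (inputs w) j z
          nlinarith
      _ ≤ 4 * k := by
          rw [← Finset.mul_sum]
          exact mul_le_mul_of_nonneg_left (sum_neighborInd_le k _ z) (by norm_num)
  have hsq : ∀ w : Fin (N + 1) → Inp d × Label,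
      knnNoise g k w z ^ 2 = (1 / (k : ℝ)) ^ 2 * ∑ j, ∑ l, A j l w := fun w => by
    rw [knnNoise, mul_pow, sq (∑ j, _), Finset.sum_mul_sum]
    congr 1
    refine Finset.sum_congr rfl fun j _ => Finset.sum_congr rfl fun l _ => ?_
    simp only [A]; ring
  simp only [hsq]
  rw [integral_const_mul, integral_finsetSum _ fun j _ => integrable_finsetSum _ fun l _ => iA j l]
  have hrow : ∀ j, ∫ w, ∑ l, A j l w ∂(Measure.pi fun _ : Fin (N + 1) => Q)
      = ∫ w, A j j w ∂(Measure.pi fun _ : Fin (N + 1) => Q) := fun j => by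
    rw [integral_finsetSum _ fun l _ => iA j l]
    exact Finset.sum_eq_single j (fun l _ hl => hcross j l hl.symm) (by simp)
  simp only [hrow]
  rw [← integral_finsetSum _ fun j _ => iA j j]
  have h5 : ∫ w, ∑ j, A j j w ∂(Measure.pi fun _ : Fin (N + 1) => Q) ≤ 4 * k := by
    calc _ ≤ ∫ _, (4 * k : ℝ) ∂(Measure.pi fun _ : Fin (N + 1) => Q) :=
          integral_mono (integrable_finsetSum _ fun j _ => iA j j) (integrable_const _) hdiag
      _ = _ := by simp
  calc _ ≤ (1 / (k : ℝ)) ^ 2 * (4 * k) := by gcongr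
    _ = 4 / k := by field_simp

end MeanError

/-! ### Stone's bound for the mean error -/

section MeanErrorBound

variable {d : ℕ}

open Classical in
/-- The indicator that fewer than `k` inputs are at distance less than `r` from `z`. -/
noncomputable def sparseInd {n : ℕ} (k : ℕ) (r : ℝ) (w : Fin n → Inp d × Label) (z : Inp d) : ℝ :=
  if (Finset.univ.filter fun l => dist (inputs w l) z < r).card < k then 1 else 0

lemma sparseInd_nonneg {n : ℕ} (k : ℕ) (r : ℝ) (w : Fin n → Inp d × Label) (z : Inp d) :
    0 ≤ sparseInd k r w z := by
  unfold sparseInd; split_ifs <;> simp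

lemma abs_sparseInd_le {n : ℕ} (k : ℕ) (r : ℝ) (w : Fin n → Inp d × Label) (z : Inp d) :
    |sparseInd k r w z| ≤ 1 := by
  unfold sparseInd; split_ifs <;> simp

lemma measurable_sparseInd {n : ℕ} (k : ℕ) (r : ℝ) :
    Measurable fun p : (Fin n → Inp d × Label) × Inp d => sparseInd k r p.1 p.2 := by
  classical
  have hc : Measurable fun p : (Fin n → Inp d × Label) × Inp d =>
      (Finset.univ.filter fun l => dist (inputs p.1 l) p.2 < r).card := by
    simp only [Finset.card_filter]
    refine Finset.measurable_fun_sum _ fun l _ => Measurable.ite ?_ measurable_const measurable_const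
    have h1 : Measurable fun p : (Fin n → Inp d × Label) × Inp d => inputs p.1 l :=
      measurable_fst.comp ((measurable_pi_apply l).comp measurable_fst)
    exact measurableSet_lt (h1.dist measurable_snd) measurable_const
  exact Measurable.ite (hc (measurableSet_Iio (a := k))) measurable_const measurable_const

variable (Q : Measure (Inp d × Label)) [IsProbabilityMeasure Q] {g : Inp d → ℝ}

lemma knnError_nonneg (Q : Measure (Inp d × Label)) {n : ℕ} (g : Inp d → ℝ) (k : ℕ)
    (w : Fin n → Inp d × Label) : 0 ≤ knnError Q g k w :=
  integral_nonneg fun _ => abs_nonneg _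

lemma integral_sparseInd_le {n k : ℕ} (hk : 1 ≤ k) (r : ℝ) (z : Inp d) :
    ∫ w, sparseInd k r w z ∂(Measure.pi fun _ : Fin n => Q)
      ≤ Real.exp 1 * Real.exp (-(n * Q.fst.real (Metric.ball z r) / (2 * k))) := by
  classical
  have hBm : MeasurableSet (Prod.fst ⁻¹' Metric.ball z r : Set (Inp d × Label)) :=
    measurable_fst Metric.isOpen_ball.measurableSet
  have hBQ : Q.real (Prod.fst ⁻¹' Metric.ball z r) = Q.fst.real (Metric.ball z r) := by
    rw [Measure.real, Measure.real, Measure.fst_apply Metric.isOpen_ball.measurableSet]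
  rw [← hBQ]
  refine le_of_eq_of_le ?_ (measureReal_pi_card_lt_le Q hBm n hk)
  rw [← integral_indicator_one (measurableSet_card_lt hBm n k)]
  refine integral_congr_ae (ae_of_all _ fun w => ?_)
  simp only [sparseInd, Set.indicator_apply, Set.mem_ofPred_eq, Set.mem_preimage, Metric.mem_ball,
    inputs, Pi.one_apply]
  congr!

lemma measurable_measureReal_ball (ρ : Measure (Inp d)) [IsFiniteMeasure ρ] (r : ℝ) :
    Measurable fun z => ρ.real (Metric.ball z r) := by
  have hopen : IsOpen {q : Inp d × Inp d | dist q.2 q.1 < r} := isOpen_lt (by fun_prop) (by fun_prop)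
  exact (measurable_measure_prodMk_left (ν := ρ) hopen.measurableSet).ennreal_toReal

/-- Either all neighbours of z are within r, where `h` varies by at most ε, or some neighbour is not
and then fewer than k points lie in the ball; in that case the crude bound 2H is used. -/
lemma sum_neighborInd_mul_abs_sub_le {n k : ℕ} (hk : 1 ≤ k) (hkn : k ≤ n) {h : Inp d → ℝ} {H : ℝ}
    (hH : ∀ z, |h z| ≤ H) {r ε : ℝ} (hε : 0 ≤ ε) (hr : ∀ a b, dist a b < r → |h a - h b| ≤ ε)
    (w : Fin n → Inp d × Label) (z : Inp d) :
    1 / (k : ℝ) * ∑ j, neighborInd k (inputs w) j z * |h (w j).1 - h z|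
      ≤ ε + 2 * H * sparseInd k r w z := by
  classical
  have hk0 : (0 : ℝ) < k := by exact_mod_cast hk
  have hH0 : 0 ≤ H := (abs_nonneg _).trans (hH z)
  have hterm : ∀ j, neighborInd k (inputs w) j z * |h (w j).1 - h z|
      ≤ neighborInd k (inputs w) j z * (ε + 2 * H * sparseInd k r w z) := fun j => by
    by_cases hj : IsNeighbor (inputs w) k z j
    · refine mul_le_mul_of_nonneg_left ?_ (neighborInd_nonneg _ _ _ _)
      by_cases hd : dist (w j).1 z < r
      · have h1 := hr _ _ hd
        have h2 := mul_nonneg (mul_nonneg zero_le_two hH0) (sparseInd_nonneg k r w z)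
        linarith
      · have hs : sparseInd k r w z = 1 := by
          unfold sparseInd
          rw [if_pos]
          refine lt_of_le_of_lt (Finset.card_le_card fun l hl => ?_) (card_lt_of_isNeighbor hj)
          rw [Finset.mem_filter] at hl ⊢
          exact ⟨hl.1, hl.2.trans_le (not_lt.1 hd)⟩
        rw [hs]
        have h1 := abs_sub (h (w j).1) (h z)
        linarith [hH (w j).1, hH z]
    · simp [neighborInd, hj]
  calc _ ≤ 1 / (k : ℝ) * ∑ j, neighborInd k (inputs w) j z * (ε + 2 * H * sparseInd k r w z) := by
        exact mul_le_mul_of_nonneg_left (Finset.sum_le_sum fun j _ => hterm j) (by positivity)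
    _ = ε + 2 * H * sparseInd k r w z := by
        rw [← Finset.sum_mul, sum_neighborInd hkn]
        field_simp

/-- Noise, error of replacing `g` by `h` at the neighbours, oscillation of `h`, error of the
replacement at z. The weights sum to one because k ≤ n. -/
lemma knnEstimate_sub_eq {n k : ℕ} (hk : 1 ≤ k) (hkn : k ≤ n) (h : Inp d → ℝ)
    (w : Fin n → Inp d × Label) (z : Inp d) :
    knnEstimate k (inputs w) (labels w) z - g z = knnNoise g k w z
      + 1 / (k : ℝ) * ∑ j, neighborInd k (inputs w) j z * (g (w j).1 - h (w j).1)
      + 1 / (k : ℝ) * ∑ j, neighborInd k (inputs w) j z * (h (w j).1 - h z) + (h z - g z) := by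
  have hk0 : (k : ℝ) ≠ 0 := by positivity
  have h1 : h z - g z = 1 / (k : ℝ) * ∑ j, neighborInd k (inputs w) j z * (h z - g z) := by
    rw [← Finset.sum_mul, sum_neighborInd hkn]; field_simp
  have h2 : knnEstimate k (inputs w) (labels w) z
      = 1 / (k : ℝ) * ∑ j, neighborInd k (inputs w) j z * (w j).2.toReal := by
    unfold knnEstimate neighborInd labels
    congr 1
    exact Finset.sum_congr rfl fun j _ => mul_comm _ _
  have h3 : g z = 1 / (k : ℝ) * ∑ j, neighborInd k (inputs w) j z * g z := by
    rw [← Finset.sum_mul, sum_neighborInd hkn]; field_simp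
  rw [h2]
  conv_lhs => rw [h3]
  conv_rhs => rw [h1]
  unfold knnNoise
  rw [← mul_sub, ← mul_add, ← mul_add, ← mul_add, ← Finset.sum_sub_distrib,
    ← Finset.sum_add_distrib, ← Finset.sum_add_distrib, ← Finset.sum_add_distrib]
  congr 1
  exact Finset.sum_congr rfl fun j _ => by ring

lemma abs_weighted_sum_le {n k : ℕ} (w : Fin n → Inp d × Label) (z : Inp d) (a : Fin n → ℝ) :
    |1 / (k : ℝ) * ∑ j, neighborInd k (inputs w) j z * a j|
      ≤ 1 / (k : ℝ) * ∑ j, neighborInd k (inputs w) j z * |a j| := by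
  rw [abs_mul, abs_of_nonneg (by positivity : (0 : ℝ) ≤ 1 / k)]
  gcongr
  refine (Finset.abs_sum_le_sum_abs _ _).trans (le_of_eq (Finset.sum_congr rfl fun j _ => ?_))
  rw [abs_mul, abs_of_nonneg (neighborInd_nonneg _ _ _ _)]

/-- The replacement of `g` by `h` at random neighbours costs only a constant times its L¹ norm, by
the first moment of the cell mass: N + 1 points contribute e · K · 2k/N each, divided by k, and (N +
1)/N ≤ 2 gives 4eK. The extra 1 is the replacement at z itself. -/
lemma integral_knnError_le (hg : Measurable g) (hg1 : ∀ z, |g z| ≤ 1)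
    (hreg : ∀ v : Inp d → ℝ, Measurable v → (∃ C, ∀ z, |v z| ≤ C) →
      ∫ e, v e.1 * (e.2.toReal - g e.1) ∂Q = 0)
    {K : ℝ} (hK0 : 0 < K)
    (hK : ∀ (u : Inp d) (t : ℝ), 0 < t →
      ∫ z, Real.exp (-(ballMass Q.fst u z / t)) ∂Q.fst ≤ K * t)
    {h : Inp d → ℝ} (hh : Measurable h) {H : ℝ} (hH : ∀ z, |h z| ≤ H) {r ε τ : ℝ}
    (hε : 0 ≤ ε) (hr : ∀ a b, dist a b < r → |h a - h b| ≤ ε) (hτ : 0 < τ)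
    {N k : ℕ} (hN : 1 ≤ N) (hk : 1 ≤ k) (hkN : k ≤ N + 1) :
    ∫ w, knnError Q g k w ∂(Measure.pi fun _ : Fin (N + 1) => Q)
      ≤ (τ + 4 / k / τ) + (4 * Real.exp 1 * K + 1) * ∫ z, |g z - h z| ∂Q.fst
        + (ε + 2 * H * ∫ z, Real.exp 1
          * Real.exp (-((N + 1 : ℕ) * Q.fst.real (Metric.ball z r) / (2 * k))) ∂Q.fst) := by
  have hk0 : (0 : ℝ) < k := by exact_mod_cast hk
  have hN0 : (1 : ℝ) ≤ N := by exact_mod_cast hN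
  obtain ⟨z₀⟩ := nonempty_of_isProbabilityMeasure Q.fst
  have hH0 : 0 ≤ H := (abs_nonneg _).trans (hH z₀)
  let ν : Measure (Fin (N + 1) → Inp d × Label) := Measure.pi fun _ => Q
  have hv : Measurable fun z => |g z - h z| := measurable_norm.comp (hg.sub hh)
  have hvC : ∀ z, |(|g z - h z|)| ≤ 1 + H := fun z => by
    rw [abs_abs]; exact (abs_sub _ _).trans (add_le_add (hg1 z) (hH z))
  have hcoord : ∀ j : Fin (N + 1), Measurable fun p : (Fin (N + 1) → Inp d × Label) × Inp d =>
      p.1 j := fun j => (measurable_pi_apply j).comp measurable_fst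
  have hnb : ∀ j : Fin (N + 1), Measurable fun p : (Fin (N + 1) → Inp d × Label) × Inp d =>
      neighborInd k (inputs p.1) j p.2 := fun j =>
    measurable_neighborInd_inputs measurable_fst measurable_snd k j
  -- the four parts of the error, as functions on the product space
  have mA : Measurable fun p : (Fin (N + 1) → Inp d × Label) × Inp d => knnNoise g k p.1 p.2 :=
    (Finset.measurable_fun_sum _ fun j _ => (hnb j).mul
      ((measurable_toReal_label.comp (measurable_snd.comp (hcoord j))).sub
        (hg.comp (measurable_fst.comp (hcoord j))))).const_mul _
  have bA : ∀ p : (Fin (N + 1) → Inp d × Label) × Inp d, |knnNoise g k p.1 p.2| ≤ 2 := fun p => by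
    refine (abs_weighted_sum_le p.1 p.2 _).trans ?_
    calc _ ≤ 1 / (k : ℝ) * ∑ j, neighborInd k (inputs p.1) j p.2 * 2 := by
          gcongr with j _
          · exact neighborInd_nonneg _ _ _ _
          · exact (abs_sub _ _).trans (by linarith [abs_toReal_label (p.1 j).2, hg1 (p.1 j).1])
      _ = 2 := by rw [← Finset.sum_mul, sum_neighborInd hkN]; field_simp
  have iA : Integrable (fun p : (Fin (N + 1) → Inp d × Label) × Inp d =>
      knnNoise g k p.1 p.2 ^ 2) (ν.prod Q.fst) :=
    integrable_of_measurable_of_abs_le (mA.pow_const 2) (2 ^ 2) fun p =>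
      abs_pow_le_pow_of_abs_le (bA p) 2
  have eA : ∫ p, knnNoise g k p.1 p.2 ^ 2 ∂(ν.prod Q.fst) ≤ 4 / k := by
    rw [integral_prod_symm _ iA]
    calc _ ≤ ∫ _, (4 / k : ℝ) ∂Q.fst := integral_mono iA.integral_prod_right (integrable_const _)
          fun z => integral_knnNoise_sq_le Q hg hg1 hreg hk z
      _ = _ := by simp
  have iBj : ∀ j, Integrable (fun p : (Fin (N + 1) → Inp d × Label) × Inp d =>
      neighborInd k (inputs p.1) j p.2 * |g (p.1 j).1 - h (p.1 j).1|) (ν.prod Q.fst) := fun j =>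
    integrable_of_measurable_of_abs_le
      ((hnb j).mul (hv.comp (measurable_fst.comp (hcoord j)))) (1 * (1 + H)) fun p => by
        rw [abs_mul]
        exact mul_le_mul (abs_neighborInd_le _ _ _ _) (hvC _) (abs_nonneg _) zero_le_one
  have eBj : ∀ j, ∫ p, neighborInd k (inputs p.1) j p.2 * |g (p.1 j).1 - h (p.1 j).1| ∂(ν.prod Q.fst)
      ≤ Real.exp 1 * (K * (2 * k / N)) * ∫ z, |g z - h z| ∂Q.fst := fun j => by
    have h1 := integral_mul_cellMass_le Q hK hN hk j (v := fun e => |g e.1 - h e.1|)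
      (hv.comp measurable_fst) (fun e => hvC _) fun e => abs_nonneg _
    have h2 : ∫ e, |g e.1 - h e.1| ∂Q = ∫ z, |g z - h z| ∂Q.fst :=
      (integral_map measurable_fst.aemeasurable hv.aestronglyMeasurable).symm
    rw [h2] at h1
    refine le_of_eq_of_le ?_ h1
    rw [integral_prod _ (iBj j)]
    refine integral_congr_ae (ae_of_all _ fun w => ?_)
    dsimp only
    rw [integral_mul_const, cellMass, mul_comm]
  have iB : Integrable (fun p : (Fin (N + 1) → Inp d × Label) × Inp d => 1 / (k : ℝ) *
      ∑ j, neighborInd k (inputs p.1) j p.2 * |g (p.1 j).1 - h (p.1 j).1|) (ν.prod Q.fst) :=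
    (integrable_finsetSum _ fun j _ => iBj j).const_mul _
  have hη0 : 0 ≤ ∫ z, |g z - h z| ∂Q.fst := integral_nonneg fun z => abs_nonneg _
  have eB : ∫ p, 1 / (k : ℝ) * ∑ j, neighborInd k (inputs p.1) j p.2 * |g (p.1 j).1 - h (p.1 j).1|
      ∂(ν.prod Q.fst) ≤ 4 * Real.exp 1 * K * ∫ z, |g z - h z| ∂Q.fst := by
    rw [integral_const_mul, integral_finsetSum _ fun j _ => iBj j]
    calc _ ≤ 1 / (k : ℝ) * ∑ _j : Fin (N + 1),
          Real.exp 1 * (K * (2 * k / N)) * ∫ z, |g z - h z| ∂Q.fst := by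
          gcongr with j _
          exact eBj j
      _ = (2 * ((N + 1) / N)) * (Real.exp 1 * K * ∫ z, |g z - h z| ∂Q.fst) := by
          rw [Finset.sum_const, Finset.card_univ, Fintype.card_fin, nsmul_eq_mul]
          push_cast
          field_simp
      _ ≤ 4 * (Real.exp 1 * K * ∫ z, |g z - h z| ∂Q.fst) := by
          gcongr
          rw [← le_div_iff₀' (by norm_num), div_le_iff₀ (by linarith)]
          linarith
      _ = _ := by ring
  have iC : Integrable (fun p : (Fin (N + 1) → Inp d × Label) × Inp d => sparseInd k r p.1 p.2)
      (ν.prod Q.fst) :=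
    integrable_of_measurable_of_abs_le (measurable_sparseInd k r) 1 fun p => abs_sparseInd_le _ _ _ _
  have mball := measurable_measureReal_ball Q.fst r
  have eC : ∫ p, sparseInd k r p.1 p.2 ∂(ν.prod Q.fst) ≤ ∫ z, Real.exp 1
      * Real.exp (-((N + 1 : ℕ) * Q.fst.real (Metric.ball z r) / (2 * k))) ∂Q.fst := by
    rw [integral_prod_symm _ iC]
    refine integral_mono iC.integral_prod_right
      ((integrable_of_measurable_of_abs_le (by fun_prop) 1 fun z => ?_).const_mul _)
      fun z => integral_sparseInd_le Q hk r z
    rw [abs_of_pos (Real.exp_pos _), Real.exp_le_one_iff]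
    have h1 : 0 ≤ Q.fst.real (Metric.ball z r) := measureReal_nonneg
    have : 0 ≤ (N + 1 : ℕ) * Q.fst.real (Metric.ball z r) / (2 * k) := by positivity
    linarith
  have iD : Integrable (fun p : (Fin (N + 1) → Inp d × Label) × Inp d => |g p.2 - h p.2|)
      (ν.prod Q.fst) :=
    integrable_of_measurable_of_abs_le (hv.comp measurable_snd) _ fun p => hvC _
  have eD : ∫ p, |g p.2 - h p.2| ∂(ν.prod Q.fst) = ∫ z, |g z - h z| ∂Q.fst := by
    rw [integral_prod _ iD]; simp
  have iT : Integrable (fun p : (Fin (N + 1) → Inp d × Label) × Inp d =>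
      |knnEstimate k (inputs p.1) (labels p.1) p.2 - g p.2|) (ν.prod Q.fst) :=
    integrable_of_measurable_of_abs_le (measurable_abs_knnEstimate_sub hg k) 2 fun p =>
      abs_abs_sub_le_two (abs_knnEstimate_le _ _ _ _) (hg1 _)
  have hpt : ∀ p : (Fin (N + 1) → Inp d × Label) × Inp d,
      |knnEstimate k (inputs p.1) (labels p.1) p.2 - g p.2|
      ≤ (τ + 1 / τ * knnNoise g k p.1 p.2 ^ 2)
        + 1 / (k : ℝ) * ∑ j, neighborInd k (inputs p.1) j p.2 * |g (p.1 j).1 - h (p.1 j).1|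
        + (ε + 2 * H * sparseInd k r p.1 p.2) + |g p.2 - h p.2| := fun p => by
    rw [knnEstimate_sub_eq hk hkN h p.1 p.2]
    -- A substitute for Cauchy-Schwarz that leaves a free parameter and no square root.
    have h1 : |knnNoise g k p.1 p.2| ≤ τ + 1 / τ * knnNoise g k p.1 p.2 ^ 2 := by
      rw [← sq_abs]
      set a := |knnNoise g k p.1 p.2|
      have : τ + 1 / τ * a ^ 2 - a = ((a - τ) ^ 2 + a * τ) / τ := by field_simp; ring
      have h2 : 0 ≤ ((a - τ) ^ 2 + a * τ) / τ := by
        have : 0 ≤ a := abs_nonneg _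
        positivity
      linarith
    have h2 := abs_weighted_sum_le (k := k) p.1 p.2 fun j => g (p.1 j).1 - h (p.1 j).1
    have h3 := (abs_weighted_sum_le (k := k) p.1 p.2 fun j => h (p.1 j).1 - h p.2).trans
      (sum_neighborInd_mul_abs_sub_le hk hkN hH hε hr p.1 p.2)
    have h4 : |h p.2 - g p.2| = |g p.2 - h p.2| := abs_sub_comm _ _
    exact (abs_add_le _ _).trans (add_le_add ((abs_add_le _ _).trans (add_le_add
      ((abs_add_le _ _).trans (add_le_add h1 h2)) h3)) h4.le)
  have hT : ∫ w, knnError Q g k w ∂ν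
      = ∫ p, |knnEstimate k (inputs p.1) (labels p.1) p.2 - g p.2| ∂(ν.prod Q.fst) :=
    (integral_prod _ iT).symm
  have i1 : Integrable (fun p : (Fin (N + 1) → Inp d × Label) × Inp d =>
      τ + 1 / τ * knnNoise g k p.1 p.2 ^ 2) (ν.prod Q.fst) :=
    (integrable_const τ).add (iA.const_mul _)
  have i3 : Integrable (fun p : (Fin (N + 1) → Inp d × Label) × Inp d =>
      ε + 2 * H * sparseInd k r p.1 p.2) (ν.prod Q.fst) :=
    (integrable_const ε).add (iC.const_mul _)
  have e1 : ∫ p, (τ + 1 / τ * knnNoise g k p.1 p.2 ^ 2) ∂(ν.prod Q.fst) ≤ τ + 4 / k / τ := by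
    rw [integral_add (integrable_const τ) (iA.const_mul _), integral_const_mul]
    simp only [integral_const, probReal_univ, one_smul]
    have h1 := mul_le_mul_of_nonneg_left eA (one_div_pos.2 hτ).le
    have h2 : 1 / τ * (4 / (k : ℝ)) = 4 / k / τ := by ring
    linarith
  have e3 : ∫ p, (ε + 2 * H * sparseInd k r p.1 p.2) ∂(ν.prod Q.fst) ≤ ε + 2 * H * ∫ z, Real.exp 1
      * Real.exp (-((N + 1 : ℕ) * Q.fst.real (Metric.ball z r) / (2 * k))) ∂Q.fst := by
    rw [integral_add (integrable_const ε) (iC.const_mul _), integral_const_mul]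
    simp only [integral_const, probReal_univ, one_smul]
    gcongr
  calc _ = ∫ p, |knnEstimate k (inputs p.1) (labels p.1) p.2 - g p.2| ∂(ν.prod Q.fst) := hT
    _ ≤ ∫ p, ((τ + 1 / τ * knnNoise g k p.1 p.2 ^ 2)
        + 1 / (k : ℝ) * ∑ j, neighborInd k (inputs p.1) j p.2 * |g (p.1 j).1 - h (p.1 j).1|
        + (ε + 2 * H * sparseInd k r p.1 p.2) + |g p.2 - h p.2|) ∂(ν.prod Q.fst) :=
        integral_mono iT (((i1.add iB).add i3).add iD) hpt
    _ = ∫ p, (τ + 1 / τ * knnNoise g k p.1 p.2 ^ 2) ∂(ν.prod Q.fst)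
        + ∫ p, 1 / (k : ℝ) * ∑ j, neighborInd k (inputs p.1) j p.2 * |g (p.1 j).1 - h (p.1 j).1|
          ∂(ν.prod Q.fst)
        + ∫ p, (ε + 2 * H * sparseInd k r p.1 p.2) ∂(ν.prod Q.fst)
        + ∫ p, |g p.2 - h p.2| ∂(ν.prod Q.fst) := by
        rw [integral_add (by exact (i1.add iB).add i3) iD, integral_add (by exact i1.add iB) i3,
          integral_add i1 iB]
    _ ≤ _ := by rw [eD]; linarith

/-- The mean error tends to zero (weak consistency of nearest neighbour regression). -/
lemma tendsto_integral_knnError (hg : Measurable g) (hg1 : ∀ z, |g z| ≤ 1)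
    (hreg : ∀ v : Inp d → ℝ, Measurable v → (∃ C, ∀ z, |v z| ≤ C) →
      ∫ e, v e.1 * (e.2.toReal - g e.1) ∂Q = 0)
    {K : ℝ} (hK0 : 0 < K)
    (hK : ∀ (u : Inp d) (t : ℝ), 0 < t →
      ∫ z, Real.exp (-(ballMass Q.fst u z / t)) ∂Q.fst ≤ K * t)
    {k : ℕ → ℕ} (hkn : ∀ n, k n ≤ n) (hk : Tendsto k atTop atTop)
    (hk' : Tendsto (fun n => (k n : ℝ) / n) atTop (𝓝 0)) :
    Tendsto (fun N => ∫ w, knnError Q g (k (N + 1)) w ∂(Measure.pi fun _ : Fin (N + 1) => Q))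
      atTop (𝓝 0) := by
  rw [Metric.tendsto_atTop']
  intro ε hε
  have hgi : Integrable g Q.fst := integrable_of_measurable_of_abs_le hg 1 hg1
  obtain ⟨η, hη0, hη⟩ : ∃ η : ℝ, 0 < η ∧ (4 * Real.exp 1 * K + 1) * η < ε / 5 := by
    -- The error bound has five parts, each allowed ε/5; taking ε/6 here gives a strict inequality.
    refine ⟨ε / 6 / (4 * Real.exp 1 * K + 1), by positivity, ?_⟩
    rw [mul_div_cancel₀ _ (by positivity)]
    linarith
  -- Continuous functions of compact support are dense in L¹ of the input law and are uniformly
  -- continuous, so one radius r serves all z.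
  obtain ⟨h, hsupp, hgh, hcont, -⟩ := hgi.exists_hasCompactSupport_integral_sub_le hη0
  simp only [Real.norm_eq_abs] at hgh
  obtain ⟨H, hH⟩ := hcont.bounded_above_of_compact_support hsupp
  simp only [Real.norm_eq_abs] at hH
  obtain ⟨r, hr0, hr⟩ := Metric.uniformContinuous_iff.1
    (hsupp.uniformContinuous_of_continuous hcont) (ε / 5) (by positivity)
  have hr' : ∀ a b, dist a b < r → |h a - h b| ≤ ε / 5 := fun a b hab => (hr hab).le
  have hk1 : Tendsto (fun N => k (N + 1)) atTop atTop := hk.comp (tendsto_add_atTop_nat 1)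
  have hkR : Tendsto (fun N => (k (N + 1) : ℝ)) atTop atTop :=
    tendsto_natCast_atTop_atTop.comp hk1
  have hnoise : Tendsto (fun N => 4 / (k (N + 1) : ℝ) / (ε / 5)) atTop (𝓝 0) := by
    simpa using (hkR.const_div_atTop 4).div_const (ε / 5)
  have hsp : Tendsto (fun N => ∫ z, Real.exp 1 * Real.exp (-((N + 1 : ℕ)
      * Q.fst.real (Metric.ball z r) / (2 * k (N + 1)))) ∂Q.fst) atTop (𝓝 0) := by
    have mball := measurable_measureReal_ball Q.fst r
    have h0 : ∫ _, (0 : ℝ) ∂Q.fst = 0 := by simp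
    rw [← h0]
    refine tendsto_integral_of_dominated_convergence (fun _ => Real.exp 1)
      (fun N => Measurable.aestronglyMeasurable (by fun_prop)) (integrable_const _) (fun N => ae_of_all _ fun z => ?_) ?_
    · rw [Real.norm_eq_abs, abs_of_pos (by positivity)]
      have h1 : 0 ≤ Q.fst.real (Metric.ball z r) := measureReal_nonneg
      have h2 : 0 ≤ (N + 1 : ℕ) * Q.fst.real (Metric.ball z r) / (2 * k (N + 1)) := by positivity
      exact mul_le_of_le_one_right (Real.exp_pos _).le (Real.exp_le_one_iff.2 (by linarith))
    -- Almost every z is in the support of the input law, so its balls have positive mass, and n/k →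
    -- ∞ drives the exponent to -∞.
    · filter_upwards [Measure.support_mem_ae (μ := Q.fst)] with z hz
      have hb : 0 < Q.fst.real (Metric.ball z r) :=
        ENNReal.toReal_pos ((Measure.mem_support_iff_forall z).1 hz _ (Metric.ball_mem_nhds z hr0)).ne'
          (measure_ne_top _ _)
      have hratio : Tendsto (fun N => ((k (N + 1) : ℝ) / (N + 1 : ℕ))⁻¹) atTop atTop := by
        refine tendsto_inv_nhdsGT_zero.comp (tendsto_nhdsWithin_iff.2
          ⟨hk'.comp (tendsto_add_atTop_nat 1), ?_⟩)
        filter_upwards [hk1.eventually_ge_atTop 1] with N hN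
        have : (0 : ℝ) < k (N + 1) := by exact_mod_cast hN
        exact div_pos this (by positivity)
      have h2 : Tendsto (fun N => (N + 1 : ℕ) * Q.fst.real (Metric.ball z r) / (2 * k (N + 1)))
          atTop atTop := by
        refine (hratio.atTop_mul_const (half_pos hb)).congr fun N => ?_
        rw [inv_div, div_mul_div_comm, mul_comm 2 (k (N + 1) : ℝ)]
      have h3 := (Real.tendsto_exp_neg_atTop_nhds_zero.comp h2).const_mul (Real.exp 1)
      rw [mul_zero] at h3
      exact h3
  have hsp2 : Tendsto (fun N => 2 * H * ∫ z, Real.exp 1 * Real.exp (-((N + 1 : ℕ)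
      * Q.fst.real (Metric.ball z r) / (2 * k (N + 1)))) ∂Q.fst) atTop (𝓝 0) := by
    simpa using hsp.const_mul (2 * H)
  obtain ⟨N₀, hN₀⟩ := eventually_atTop.1 ((hnoise.eventually (gt_mem_nhds (by positivity : 0 < ε / 5))).and
    ((hsp2.eventually (gt_mem_nhds (by positivity : 0 < ε / 5))).and
      ((hk1.eventually_ge_atTop 1).and (eventually_ge_atTop 1))))
  refine ⟨N₀, fun N hN => ?_⟩
  obtain ⟨h1, h2, h3, h4⟩ := hN₀ N hN.le
  have hmain := integral_knnError_le Q hg hg1 hreg hK0 hK hcont.measurable hH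
    (by positivity : (0 : ℝ) ≤ ε / 5) hr' (by positivity : (0 : ℝ) < ε / 5) h4 h3 (hkn (N + 1))
  have h5 : (4 * Real.exp 1 * K + 1) * ∫ z, |g z - h z| ∂Q.fst < ε / 5 :=
    lt_of_le_of_lt (by gcongr) hη
  rw [Real.dist_eq, sub_zero, abs_of_nonneg (integral_nonneg fun w => knnError_nonneg Q g _ w)]
  linarith

end MeanErrorBound

/-! ### Almost sure convergence of the error -/

section Strong

variable {d : ℕ} (Q : Measure (Inp d × Label)) [IsProbabilityMeasure Q] {g : Inp d → ℝ}

lemma measureReal_knnError_ge_le (hg : Measurable g) (hg1 : ∀ z, |g z| ≤ 1) {K : ℝ} (hK0 : 0 < K)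
    (hK : ∀ (u : Inp d) (t : ℝ), 0 < t →
      ∫ z, Real.exp (-(ballMass Q.fst u z / t)) ∂Q.fst ≤ K * t)
    {N k : ℕ} (hN : 1 ≤ N) (hk : 1 ≤ k) {ε : ℝ} (hε : 0 < ε)
    (hmean : ∫ w, knnError Q g k w ∂(Measure.pi fun _ : Fin (N + 1) => Q) ≤ ε / 2) :
    (Measure.pi fun _ : Fin (N + 1) => Q).real {w | ε ≤ knnError Q g k w}
      ≤ (48 * (4 * (Real.exp 1 * (8 * K) ^ 2))) ^ 2 / (ε / 2) ^ 4 * (1 / (N : ℝ) ^ 2) := by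
  set M := ∫ w, knnError Q g k w ∂(Measure.pi fun _ : Fin (N + 1) => Q) with hM
  have hm := measurable_knnError (n := N + 1) Q hg k
  have hi : Integrable (fun w => (knnError Q g k w - M) ^ 4)
      (Measure.pi fun _ : Fin (N + 1) => Q) :=
    integrable_of_measurable_of_abs_le ((hm.sub_const M).pow_const 4) ((2 + 2) ^ 4) fun w =>
      abs_pow_le_pow_of_abs_le ((abs_sub _ _).trans (add_le_add (abs_knnError_le Q hg1 k w)
        (abs_integral_le_of_abs_le fun v => abs_knnError_le Q hg1 k v))) 4
  have h1 := mul_meas_ge_le_integral_of_nonneg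
    (ae_of_all _ fun w => Even.pow_nonneg (by decide : Even 4) (knnError Q g k w - M)) hi
    ((ε / 2) ^ 4)
  have h2 := integral_knnError_sub_pow_four_le Q hg hg1 hK0 hK hN hk
  have hsub : (Measure.pi fun _ : Fin (N + 1) => Q).real {w | ε ≤ knnError Q g k w}
      ≤ (Measure.pi fun _ : Fin (N + 1) => Q).real
        {w | (ε / 2) ^ 4 ≤ (knnError Q g k w - M) ^ 4} := by
    refine measureReal_mono fun w hw => ?_
    have hw' : ε ≤ knnError Q g k w := hw
    -- With the mean at most ε/2, an error of ε is a deviation of ε/2, to which Markov's inequality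
    -- for the fourth power applies.
    have h3 : ε / 2 ≤ knnError Q g k w - M := by linarith
    exact pow_le_pow_left₀ (by positivity) h3 4
  rw [div_mul_eq_mul_div, mul_one_div, le_div_iff₀ (by positivity), mul_comm]
  refine le_trans (mul_le_mul_of_nonneg_left hsub (by positivity)) (h1.trans ?_)
  rw [← hM] at h2
  exact h2

variable {Ω : Type*} [MeasurableSpace Ω] (μ : Measure Ω)

/-- Strong consistency of nearest neighbour regression, whatever the dependence between the samples
of different sizes. -/
lemma ae_tendsto_knnError [NullSingletonClass Q.fst] (hg : Measurable g) (hg1 : ∀ z, |g z| ≤ 1)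
    (hreg : ∀ v : Inp d → ℝ, Measurable v → (∃ C, ∀ z, |v z| ≤ C) →
      ∫ e, v e.1 * (e.2.toReal - g e.1) ∂Q = 0)
    {k : ℕ → ℕ} (hkn : ∀ n, k n ≤ n) (hk : Tendsto k atTop atTop)
    (hk' : Tendsto (fun n => (k n : ℝ) / n) atTop (𝓝 0))
    {D : (n : ℕ) → Ω → Fin n → Inp d × Label} (hD : ∀ n, Measurable (D n))
    (hlaw : ∀ n, μ.map (D n) = Measure.pi fun _ => Q) :
    ∀ᵐ ω ∂μ, Tendsto (fun n => knnError Q g (k n) (D n ω)) atTop (𝓝 0) := by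
  obtain ⟨K, hK0, hK⟩ := exists_integral_exp_neg_ballMass_le d
  have hmean := tendsto_integral_knnError Q hg hg1 hreg hK0 (hK Q.fst) hkn hk hk'
  have hev : ∀ ε : ℝ, 0 < ε → ∀ᵐ ω ∂μ, ∀ᶠ n in atTop, knnError Q g (k n) (D n ω) < ε := by
    intro ε hε
    obtain ⟨N₀, hN₀⟩ := eventually_atTop.1 ((hmean.eventually (gt_mem_nhds (half_pos hε))).and
      (((hk.comp (tendsto_add_atTop_nat 1)).eventually_ge_atTop 1).and (eventually_ge_atTop 1)))
    set C := (48 * (4 * (Real.exp 1 * (8 * K) ^ 2))) ^ 2 / (ε / 2) ^ 4 with hC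
    have hC0 : 0 ≤ C := by positivity
    -- Only the law of each single sample enters. The first sizes are dropped so that the mean error
    -- is already below ε/2.
    have hbound : ∀ N, μ {ω | ε ≤ knnError Q g (k (N + N₀ + 1)) (D (N + N₀ + 1) ω)}
        ≤ ENNReal.ofReal (C * (1 / ((N + N₀ : ℕ) : ℝ) ^ 2)) := fun N => by
      obtain ⟨h1, h2, h3⟩ := hN₀ (N + N₀) (by omega)
      have h4 := measureReal_knnError_ge_le Q hg hg1 hK0 (hK Q.fst) h3 h2 hε h1.le
      have h5 : μ {ω | ε ≤ knnError Q g (k (N + N₀ + 1)) (D (N + N₀ + 1) ω)}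
          = (Measure.pi fun _ : Fin (N + N₀ + 1) => Q) {w | ε ≤ knnError Q g (k (N + N₀ + 1)) w} := by
        rw [← hlaw, Measure.map_apply (hD _)
          (measurableSet_le measurable_const (measurable_knnError Q hg _))]
        rfl
      rw [h5]
      exact (ENNReal.le_ofReal_iff_toReal_le (measure_ne_top _ _) (by positivity)).2 h4
    have hsum : Summable fun N : ℕ => C * (1 / ((N + N₀ : ℕ) : ℝ) ^ 2) :=
      ((summable_nat_add_iff N₀).2 (Real.summable_one_div_nat_pow.2 one_lt_two)).mul_left C
    have hfin : ∑' N, μ {ω | ε ≤ knnError Q g (k (N + N₀ + 1)) (D (N + N₀ + 1) ω)} ≠ ∞ := by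
      refine ne_top_of_le_ne_top ?_ (ENNReal.tsum_le_tsum hbound)
      rw [← ENNReal.ofReal_tsum_of_nonneg (fun N => by positivity) hsum]
      exact ENNReal.ofReal_ne_top
    filter_upwards [ae_eventually_notMem hfin] with ω hω
    obtain ⟨N₁, hN₁⟩ := eventually_atTop.1 hω
    refine eventually_atTop.2 ⟨N₁ + N₀ + 1, fun n hn => ?_⟩
    obtain ⟨i, rfl⟩ : ∃ i, n = i + N₀ + 1 := ⟨n - N₀ - 1, by omega⟩
    exact not_le.1 (hN₁ i (by omega))
  have hall : ∀ᵐ ω ∂μ, ∀ i : ℕ, ∀ᶠ n in atTop,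
      knnError Q g (k n) (D n ω) < 1 / ((i : ℝ) + 1) :=
    ae_all_iff.2 fun i => hev _ Nat.one_div_pos_of_nat
  filter_upwards [hall] with ω hω
  rw [Metric.tendsto_nhds]
  intro ε hε
  obtain ⟨i, hi⟩ := exists_nat_one_div_lt hε
  filter_upwards [hω i] with n hn
  rw [Real.dist_eq, sub_zero, abs_of_nonneg (knnError_nonneg Q g _ _)]
  exact hn.trans hi

end Strong

/-! ### From the input law to Lebesgue measure -/

section Transfer

variable {α : Type*} [MeasurableSpace α] {ρ ν : Measure α} [IsFiniteMeasure ρ] [IsFiniteMeasure ν]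

/-- For uniformly bounded functions, `L¹` convergence to zero passes to absolutely continuous
measures. -/
lemma tendsto_integral_of_absolutelyContinuous (hνρ : ν ≪ ρ) {u : ℕ → α → ℝ}
    (hu : ∀ n, Measurable (u n)) (hu0 : ∀ n a, 0 ≤ u n a) {C : ℝ} (huC : ∀ n a, u n a ≤ C)
    (h : Tendsto (fun n => ∫ a, u n a ∂ρ) atTop (𝓝 0)) :
    Tendsto (fun n => ∫ a, u n a ∂ν) atTop (𝓝 0) := by
  have hi : ∀ (κ : Measure α) [IsFiniteMeasure κ] n, Integrable (u n) κ := fun κ _ n =>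
    integrable_of_measurable_of_abs_le (hu n) C fun a => by
      rw [abs_of_nonneg (hu0 n a)]; exact huC n a
  have hset : ∀ ε : ℝ, 0 < ε → Tendsto (fun n => ν.real {a | ε ≤ u n a}) atTop (𝓝 0) := by
    intro ε hε
    have hρ : Tendsto (fun n => ρ.real {a | ε ≤ u n a}) atTop (𝓝 0) := by
      refine squeeze_zero (fun n => measureReal_nonneg) (fun n => ?_)
        (by simpa using h.const_mul ε⁻¹)
      have := mul_meas_ge_le_integral_of_nonneg (ae_of_all _ (hu0 n)) (hi ρ n) ε
      rw [inv_mul_eq_div, le_div_iff₀ hε, mul_comm]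
      exact this
    have hρ' : Tendsto (fun n => ρ {a | ε ≤ u n a}) atTop (𝓝 0) := by
      have := ENNReal.tendsto_ofReal hρ
      simpa [ofReal_measureReal] using this
    -- An integrable density has small integrals over sets of small mass; it need not be bounded.
    have hν : Tendsto (fun n => ∫⁻ a in {a | ε ≤ u n a}, ν.rnDeriv ρ a ∂ρ) atTop (𝓝 0) :=
      tendsto_setLIntegral_zero (Measure.lintegral_rnDeriv_lt_top ν ρ).ne hρ'
    simp only [Measure.setLIntegral_rnDeriv hνρ] at hν
    exact (ENNReal.tendsto_toReal ENNReal.zero_ne_top).comp hν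
  rw [Metric.tendsto_nhds]
  intro ε hε
  -- Values below δ contribute at most δ times the total mass, which is below ε; the added 1 covers
  -- the case ν = 0.
  set δ := ε / (2 * (ν.real Set.univ + 1)) with hδ
  have hν0 : 0 ≤ ν.real Set.univ := measureReal_nonneg
  have hδ0 : 0 < δ := by positivity
  have hlim : Tendsto (fun n => δ * ν.real Set.univ + C * ν.real {a | δ ≤ u n a}) atTop
      (𝓝 (δ * ν.real Set.univ + C * 0)) :=
    ((hset δ hδ0).const_mul C).const_add _
  have hlt : δ * ν.real Set.univ + C * 0 < ε := by
    rw [mul_zero, add_zero, hδ, div_mul_eq_mul_div, div_lt_iff₀ (by positivity)]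
    nlinarith
  filter_upwards [hlim.eventually (gt_mem_nhds hlt)] with n hn
  rw [Real.dist_eq, sub_zero, abs_of_nonneg (integral_nonneg (hu0 n))]
  refine lt_of_le_of_lt ?_ hn
  have hm : MeasurableSet {a | δ ≤ u n a} := measurableSet_le measurable_const (hu n)
  have hind : Integrable (({a | δ ≤ u n a}).indicator (1 : α → ℝ)) ν :=
    (integrable_indicator_iff hm).2 (integrable_const (1 : ℝ)).integrableOn
  calc ∫ a, u n a ∂ν ≤ ∫ a, (δ + C * ({a | δ ≤ u n a}).indicator (1 : α → ℝ) a) ∂ν := by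
        refine integral_mono (hi ν n) ((integrable_const _).add (hind.const_mul _)) fun a => ?_
        dsimp only
        by_cases ha : δ ≤ u n a
        · rw [Set.indicator_of_mem (show a ∈ {a | δ ≤ u n a} from ha)]
          simp only [Pi.one_apply, mul_one]
          linarith [huC n a]
        · rw [Set.indicator_of_notMem (show a ∉ {a | δ ≤ u n a} from ha)]
          linarith
    _ = δ * ν.real Set.univ + C * ν.real {a | δ ≤ u n a} := by
        rw [integral_add (integrable_const _) (hind.const_mul _), integral_const_mul,
          integral_indicator_one hm]
        simp [mul_comm]

/-- All functions are bounded by 1, so a difference of squares is at most 4 times the sum of the two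
absolute errors, and L¹ convergence suffices. -/
lemma tendsto_integral_sub_sq (hνρ : ν ≪ ρ) {F G : ℕ → α → ℝ} {a b : α → ℝ}
    (hF : ∀ n, Measurable (F n)) (hG : ∀ n, Measurable (G n)) (ha : Measurable a)
    (hb : Measurable b) (hF1 : ∀ n z, |F n z| ≤ 1) (hG1 : ∀ n z, |G n z| ≤ 1)
    (ha1 : ∀ z, |a z| ≤ 1) (hb1 : ∀ z, |b z| ≤ 1)
    (hFa : Tendsto (fun n => ∫ z, |F n z - a z| ∂ρ) atTop (𝓝 0))
    (hGb : Tendsto (fun n => ∫ z, |G n z - b z| ∂ρ) atTop (𝓝 0)) :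
    Tendsto (fun n => ∫ z, (F n z - G n z) ^ 2 ∂ν) atTop (𝓝 (∫ z, (a z - b z) ^ 2 ∂ν)) := by
  have two : ∀ {s t : ℝ}, |s| ≤ 1 → |t| ≤ 1 → |s - t| ≤ 2 := fun hs ht =>
    (abs_sub _ _).trans (by linarith)
  have hFa' := tendsto_integral_of_absolutelyContinuous hνρ
    (fun n => measurable_norm.comp ((hF n).sub ha)) (fun n z => abs_nonneg _)
    (fun n z => two (hF1 n z) (ha1 z)) hFa
  have hGb' := tendsto_integral_of_absolutelyContinuous hνρ
    (fun n => measurable_norm.comp ((hG n).sub hb)) (fun n z => abs_nonneg _)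
    (fun n z => two (hG1 n z) (hb1 z)) hGb
  have hsum := (hFa'.add hGb').const_mul 4
  rw [add_zero, mul_zero] at hsum
  rw [tendsto_iff_dist_tendsto_zero]
  refine squeeze_zero (fun n => dist_nonneg) (fun n => ?_) hsum
  have i1 : Integrable (fun z => (F n z - G n z) ^ 2) ν :=
    integrable_of_measurable_of_abs_le (((hF n).sub (hG n)).pow_const 2) (2 ^ 2) fun z =>
      abs_pow_le_pow_of_abs_le (two (hF1 n z) (hG1 n z)) 2
  have i2 : Integrable (fun z => (a z - b z) ^ 2) ν :=
    integrable_of_measurable_of_abs_le ((ha.sub hb).pow_const 2) (2 ^ 2) fun z =>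
      abs_pow_le_pow_of_abs_le (two (ha1 z) (hb1 z)) 2
  have i3 : Integrable (fun z => |F n z - a z|) ν :=
    integrable_of_measurable_of_abs_le (measurable_norm.comp ((hF n).sub ha)) 2 fun z =>
      (abs_abs _).trans_le (two (hF1 n z) (ha1 z))
  have i4 : Integrable (fun z => |G n z - b z|) ν :=
    integrable_of_measurable_of_abs_le (measurable_norm.comp ((hG n).sub hb)) 2 fun z =>
      (abs_abs _).trans_le (two (hG1 n z) (hb1 z))
  rw [Real.dist_eq, ← integral_sub i1 i2]
  calc _ ≤ ∫ z, |(F n z - G n z) ^ 2 - (a z - b z) ^ 2| ∂ν := abs_integral_le_integral_abs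
    _ ≤ ∫ z, 4 * (|F n z - a z| + |G n z - b z|) ∂ν := by
        refine integral_mono (i1.sub i2).abs ((i3.add i4).const_mul 4) fun z => ?_
        dsimp only
        have h1 : (F n z - G n z) ^ 2 - (a z - b z) ^ 2
            = ((F n z - G n z) + (a z - b z)) * ((F n z - a z) - (G n z - b z)) := by ring
        rw [h1, abs_mul]
        refine mul_le_mul ?_ (abs_sub _ _) (abs_nonneg _) (by norm_num)
        exact (abs_add_le _ _).trans
          (by linarith [two (hF1 n z) (hG1 n z), two (ha1 z) (hb1 z)])
    _ = _ := by rw [integral_const_mul, integral_add i3 i4]; rfl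

end Transfer

/-! ### The joint law of inputs and labels -/

section LabelLaw

variable {d : ℕ}

lemma measurable_labelProb {α : Type*} [MeasurableSpace α] {t : α → ℝ} (ht : Measurable t)
    (s : Label) : Measurable fun a => labelProb (t a) s :=
  ENNReal.measurable_ofReal.comp (((ht.const_mul _).const_add _).div_const _)

lemma sum_labelProb {t : ℝ} (ht : |t| ≤ 1) : ∑ s : Label, labelProb t s = 1 := by
  have h := abs_le.1 ht
  rw [show (Finset.univ : Finset Label) = {1, -1} from rfl,
    Finset.sum_pair (by decide)]
  simp only [labelProb, Label.toReal]
  rw [← ENNReal.ofReal_add (by norm_num; linarith) (by norm_num; linarith)]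
  rw [ENNReal.ofReal_eq_one]
  push_cast
  ring

lemma labelProb_le_one {t : ℝ} (ht : |t| ≤ 1) (s : Label) : labelProb t s ≤ 1 := by
  rw [← sum_labelProb ht]
  exact Finset.single_le_sum (f := fun s => labelProb t s) (fun _ _ => zero_le) (Finset.mem_univ s)

/-- The law of `(X, Y)` if `X` has law `ρ` and `Y` has mean `g x` given `X = x`. -/
noncomputable def labelLaw (ρ : Measure (Inp d)) (g : Inp d → ℝ) : Measure (Inp d × Label) :=
  ∑ s : Label, (ρ.withDensity fun x => labelProb (g x) s).map fun x => (x, s)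

variable (ρ : Measure (Inp d)) {g : Inp d → ℝ}

lemma lintegral_labelLaw (hg : Measurable g) {F : Inp d × Label → ℝ≥0∞} (hF : Measurable F) :
    ∫⁻ e, F e ∂(labelLaw ρ g) = ∑ s : Label, ∫⁻ x, labelProb (g x) s * F (x, s) ∂ρ := by
  unfold labelLaw
  rw [lintegral_finsetSum_measure]
  refine Finset.sum_congr rfl fun s _ => ?_
  have hs : Measurable fun x : Inp d => (x, s) := measurable_id.prodMk measurable_const
  rw [lintegral_map hF hs,
    lintegral_withDensity_eq_lintegral_mul _ (measurable_labelProb hg s)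
      (show Measurable fun x => F (x, s) from hF.comp hs)]
  rfl

lemma labelLaw_prod_singleton (hg : Measurable g) {B : Set (Inp d)} (hB : MeasurableSet B)
    (s : Label) : labelLaw ρ g (B ×ˢ {s}) = ∫⁻ x in B, labelProb (g x) s ∂ρ := by
  have hm : MeasurableSet (B ×ˢ ({s} : Set Label)) := hB.prod (measurableSet_singleton s)
  rw [← lintegral_indicator_one hm, lintegral_labelLaw ρ hg (measurable_one.indicator hm),
    ← lintegral_indicator hB, Finset.sum_eq_single s]
  · refine lintegral_congr fun x => ?_
    by_cases hx : x ∈ B <;> simp [hx]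
  · intro t _ ht
    refine lintegral_eq_zero_of_ae_eq_zero (ae_of_all _ fun x => ?_)
    simp [ht]
  · exact fun h => absurd (Finset.mem_univ s) h

lemma fst_labelLaw (hg : Measurable g) (hg1 : ∀ x, |g x| ≤ 1) : (labelLaw ρ g).fst = ρ := by
  ext B hB
  have hm : MeasurableSet (Prod.fst ⁻¹' B : Set (Inp d × Label)) := measurable_fst hB
  rw [Measure.fst_apply hB, ← lintegral_indicator_one hm,
    lintegral_labelLaw ρ hg (measurable_one.indicator hm),
    ← lintegral_finsetSum _ fun s _ => show Measurable fun x : Inp d => labelProb (g x) s *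
      (Prod.fst ⁻¹' B : Set (Inp d × Label)).indicator (1 : Inp d × Label → ℝ≥0∞) (x, s) from
        (measurable_labelProb hg s).mul
          ((measurable_one.indicator hm).comp (measurable_id.prodMk measurable_const)),
    ← lintegral_indicator_one hB]
  refine lintegral_congr fun x => ?_
  have : ∀ s : Label, (Prod.fst ⁻¹' B : Set (Inp d × Label)).indicator (1 : Inp d × Label → ℝ≥0∞)
      (x, s) = B.indicator 1 x := fun s => by by_cases hx : x ∈ B <;> simp [hx]
  simp only [this]
  rw [← Finset.sum_mul, sum_labelProb (hg1 x), one_mul]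

lemma isProbabilityMeasure_labelLaw [IsProbabilityMeasure ρ] (hg : Measurable g)
    (hg1 : ∀ x, |g x| ≤ 1) : IsProbabilityMeasure (labelLaw ρ g) :=
  ⟨by rw [← Measure.fst_univ, fst_labelLaw ρ hg hg1, measure_univ]⟩

/-- At each input the two labels cancel: Σ (1 + s g)(s - g)/2 over s = ±1 is zero. This makes strong
consistency applicable to generated labels with any candidate. -/
lemma integral_mul_residual_labelLaw [IsProbabilityMeasure ρ] (hg : Measurable g)
    (hg1 : ∀ x, |g x| ≤ 1) (v : Inp d → ℝ) (hv : Measurable v) (hvC : ∃ C, ∀ z, |v z| ≤ C) :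
    ∫ e, v e.1 * (e.2.toReal - g e.1) ∂(labelLaw ρ g) = 0 := by
  obtain ⟨C, hC⟩ := hvC
  have := isProbabilityMeasure_labelLaw ρ hg hg1
  have hp : ∀ (s : Label) x, 0 ≤ (1 + s.toReal * g x) / 2 := fun s x => by
    have h1 := abs_le.1 (hg1 x)
    rcases Int.units_eq_one_or s with rfl | rfl <;> simp [Label.toReal] <;> linarith
  have hF : Measurable fun e : Inp d × Label => v e.1 * (e.2.toReal - g e.1) :=
    (hv.comp measurable_fst).mul
      ((measurable_toReal_label.comp measurable_snd).sub (hg.comp measurable_fst))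
  have hFs : ∀ s : Label, Measurable fun x : Inp d => v x * (s.toReal - g x) := fun s => by
    fun_prop
  have hC0 : 0 ≤ C := by
    obtain ⟨z⟩ := nonempty_of_isProbabilityMeasure ρ
    exact (abs_nonneg _).trans (hC z)
  have hFb : ∀ (s : Label) x, |v x * (s.toReal - g x)| ≤ C * 2 := fun s x => by
    rw [abs_mul]
    exact mul_le_mul (hC x) ((abs_sub _ _).trans (by linarith [abs_toReal_label s, hg1 x]))
      (abs_nonneg _) hC0
  have hs : ∀ s : Label, Measurable fun x : Inp d => (x, s) := fun s =>
    measurable_id.prodMk measurable_const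
  have hwd : ∀ s : Label, Measurable fun x => Real.toNNReal ((1 + s.toReal * g x) / 2) := fun s => by
    fun_prop
  have hwdeq : ∀ s : Label, (ρ.withDensity fun x => labelProb (g x) s)
      = ρ.withDensity fun x => (Real.toNNReal ((1 + s.toReal * g x) / 2) : ℝ≥0∞) := fun s => rfl
  have hfin : ∀ s : Label, IsFiniteMeasure (ρ.withDensity fun x => labelProb (g x) s) := fun s =>
    isFiniteMeasure_withDensity (ne_top_of_le_ne_top ENNReal.one_ne_top
      ((lintegral_mono fun x => labelProb_le_one (hg1 x) s).trans (by simp)))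
  have hterm : ∀ s : Label, ∫ e, v e.1 * (e.2.toReal - g e.1)
      ∂((ρ.withDensity fun x => labelProb (g x) s).map fun x => (x, s))
      = ∫ x, (1 + s.toReal * g x) / 2 * (v x * (s.toReal - g x)) ∂ρ := fun s => by
    rw [integral_map (hs s).aemeasurable hF.aestronglyMeasurable, hwdeq,
      integral_withDensity_eq_integral_smul (hwd s)]
    refine integral_congr_ae (ae_of_all _ fun x => ?_)
    simp only [NNReal.smul_def, Real.coe_toNNReal _ (hp s x), smul_eq_mul]
  unfold labelLaw
  rw [integral_finsetSum_measure fun s _ => ?_]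
  · simp only [hterm]
    have hint : ∀ s : Label, Integrable
        (fun x => (1 + s.toReal * g x) / 2 * (v x * (s.toReal - g x))) ρ := fun s =>
      integrable_of_measurable_of_abs_le (by fun_prop) (1 * (C * 2)) fun x => by
        rw [abs_mul]
        refine mul_le_mul ?_ (hFb s x) (abs_nonneg _) zero_le_one
        have h1 : |1 + s.toReal * g x| ≤ 2 := (abs_add_le _ _).trans (by
          rw [abs_mul, abs_toReal_label, abs_one]; linarith [hg1 x])
        rw [abs_div, abs_two]
        linarith
    rw [← integral_finsetSum _ fun s _ => hint s]
    refine integral_eq_zero_of_ae (ae_of_all _ fun x => ?_)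
    simp only [Pi.zero_apply]
    rw [show (Finset.univ : Finset Label) = {1, -1} from rfl, Finset.sum_pair (by decide)]
    simp only [Label.toReal]
    push_cast
    ring
  · have := hfin s
    exact (integrable_map_measure hF.aestronglyMeasurable (hs s).aemeasurable).2
      (integrable_of_measurable_of_abs_le (hFs s) (C * 2) (hFb s))

/-- A law on inputs and labels is determined by its input law and its regression function. -/
lemma eq_labelLaw_of_condExp (P : Measure (Inp d × Label)) [IsProbabilityMeasure P]
    (hg : Measurable g) (hg1 : ∀ x, |g x| ≤ 1)
    (hreg : P[fun s => s.2.toReal | MeasurableSpace.comap Prod.fst inferInstance]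
      =ᵐ[P] fun s => g s.1) : P = labelLaw P.fst g := by
  have hY : Measurable fun e : Inp d × Label => e.2.toReal :=
    measurable_toReal_label.comp measurable_snd
  have hYi : Integrable (fun e : Inp d × Label => e.2.toReal) P :=
    integrable_of_measurable_of_abs_le hY 1 fun e => (abs_toReal_label _).le
  have hGi : Integrable (fun e : Inp d × Label => g e.1) P :=
    integrable_of_measurable_of_abs_le (hg.comp measurable_fst) 1 fun e => hg1 _
  have hbox : ∀ (B : Set (Inp d)), MeasurableSet B → ∀ s : Label,
      P (B ×ˢ {s}) = labelLaw P.fst g (B ×ˢ {s}) := by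
    intro B hB s
    have hBm : MeasurableSet (Prod.fst ⁻¹' B : Set (Inp d × Label)) := measurable_fst hB
    have hBs : MeasurableSet (B ×ˢ ({s} : Set Label)) := hB.prod (measurableSet_singleton s)
    have h1 : ∫ e in Prod.fst ⁻¹' B, e.2.toReal ∂P = ∫ e in Prod.fst ⁻¹' B, g e.1 ∂P := by
      rw [← setIntegral_condExp measurable_fst.comap_le hYi ⟨B, hB, rfl⟩]
      exact integral_congr_ae (ae_restrict_of_ae hreg)
    -- For labels ±1 the indicator of Y = s is (1 + sY)/2, so probabilities follow from the
    -- conditional mean.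
    have h2 : P.real (B ×ˢ {s}) = ∫ e in Prod.fst ⁻¹' B, (1 + s.toReal * e.2.toReal) / 2 ∂P := by
      rw [← integral_indicator_one hBs, ← integral_indicator hBm]
      refine integral_congr_ae (ae_of_all _ fun e => ?_)
      obtain ⟨x, t⟩ := e
      by_cases hx : x ∈ B
      · rcases Int.units_eq_one_or s with rfl | rfl <;> rcases Int.units_eq_one_or t with rfl | rfl <;>
          simp [hx, Label.toReal]
      · simp [hx]
    have h3 : P.real (B ×ˢ {s}) = ∫ e in Prod.fst ⁻¹' B, (1 + s.toReal * g e.1) / 2 ∂P := by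
      rw [h2, integral_div, integral_div, integral_add (integrable_const _)
        (hYi.integrableOn.const_mul _), integral_add (integrable_const _)
        (hGi.integrableOn.const_mul _), integral_const_mul, integral_const_mul, h1]
    have hp : ∀ x, 0 ≤ (1 + s.toReal * g x) / 2 := fun x => by
      have h1 := abs_le.1 (hg1 x)
      rcases Int.units_eq_one_or s with rfl | rfl <;> simp [Label.toReal] <;> linarith
    rw [labelLaw_prod_singleton P.fst hg hB, ← ofReal_measureReal, h3,
      ofReal_integral_eq_lintegral_ofReal _ (ae_of_all _ fun e => hp _)]
    · rw [Measure.fst, setLIntegral_map hB (measurable_labelProb hg s) measurable_fst]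
      rfl
    · exact (((integrable_const _).add (hGi.const_mul _)).div_const _).integrableOn
  ext A hA
  -- With two labels only, every measurable set is a finite disjoint union of such rectangles.
  have hdec : A = ⋃ s : Label, ((fun x => (x, s)) ⁻¹' A) ×ˢ {s} := by
    ext ⟨x, t⟩; simp
  have hAm : ∀ s : Label, MeasurableSet ((fun x : Inp d => (x, s)) ⁻¹' A) := fun s =>
    (measurable_id.prodMk measurable_const) hA
  have hdisj : Pairwise (Function.onFun Disjoint fun s : Label =>
      ((fun x : Inp d => (x, s)) ⁻¹' A) ×ˢ ({s} : Set Label)) := fun s t hst =>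
    Set.disjoint_left.2 fun e he he' => hst (he.2.symm.trans he'.2)
  rw [hdec, measure_iUnion hdisj fun s => (hAm s).prod (measurableSet_singleton s),
    measure_iUnion hdisj fun s => (hAm s).prod (measurableSet_singleton s)]
  exact tsum_congr fun s => hbox _ (hAm s) s

end LabelLaw

/-! ### I.i.d. samples described by inputs and conditional labels -/

section PiLabelLaw

lemma lintegral_pi_prod {E : Type*} [MeasurableSpace E] (Q : Measure E) [IsProbabilityMeasure Q]
    {n : ℕ} (F : Fin n → E → ℝ≥0∞) (hF : ∀ i, Measurable (F i)) :
    ∫⁻ w, ∏ i, F i (w i) ∂(Measure.pi fun _ : Fin n => Q) = ∏ i, ∫⁻ e, F i e ∂Q := by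
  induction n with
  | zero => simp
  | succ n ih =>
    rw [lintegral_pi_insertNth Q 0]
    simp only [Fin.prod_univ_succ, Fin.insertNth_zero', Fin.cons_zero, Fin.cons_succ]
    rw [lintegral_prod_mul (f := F 0) (g := fun w : Fin n → E => ∏ i : Fin n, F i.succ (w i))
      (hF 0).aemeasurable (Finset.measurable_fun_prod _ fun i _ =>
        (hF i.succ).comp (measurable_pi_apply i)).aemeasurable, ih _ fun i => hF i.succ]

variable {d n : ℕ} (ρ : Measure (Inp d)) [IsProbabilityMeasure ρ] {g : Inp d → ℝ}

lemma measurable_inputs : Measurable (inputs : (Fin n → Inp d × Label) → Fin n → Inp d) :=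
  measurable_pi_lambda _ fun i => measurable_fst.comp (measurable_pi_apply i)

lemma measurable_labels : Measurable (labels : (Fin n → Inp d × Label) → Fin n → Label) :=
  measurable_pi_lambda _ fun i => measurable_snd.comp (measurable_pi_apply i)

/-- The law of the inputs on the event that the labels take given values. -/
lemma map_inputs_restrict_labels (hg : Measurable g) (hg1 : ∀ x, |g x| ≤ 1) (s : Fin n → Label) :
    ((Measure.pi fun _ : Fin n => labelLaw ρ g).restrict (labels ⁻¹' {s})).map inputs
      = (Measure.pi fun _ : Fin n => ρ).withDensity fun x => ∏ j, labelProb (g (x j)) (s j) := by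
  have := isProbabilityMeasure_labelLaw ρ hg hg1
  have hfin : ∀ j, IsFiniteMeasure (ρ.withDensity fun x => labelProb (g x) (s j)) := fun j =>
    isFiniteMeasure_withDensity (ne_top_of_le_ne_top ENNReal.one_ne_top
      ((lintegral_mono fun x => labelProb_le_one (hg1 x) (s j)).trans (by simp)))
  -- Both sides are the product of the measures with densities `labelProb`; this is checked on
  -- boxes.
  trans Measure.pi fun j => ρ.withDensity fun x => labelProb (g x) (s j)
  · symm
    refine Measure.pi_eq fun B hB => ?_
    rw [Measure.map_apply measurable_inputs (MeasurableSet.univ_pi hB),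
      Measure.restrict_apply (measurable_inputs (MeasurableSet.univ_pi hB))]
    have hset : inputs ⁻¹' (Set.univ.pi B) ∩ labels ⁻¹' {s}
        = Set.univ.pi fun j => B j ×ˢ ({s j} : Set Label) := by
      ext w
      simp only [Set.mem_inter_iff, Set.mem_preimage, Set.mem_pi, Set.mem_univ, true_imp_iff,
        Set.mem_singleton_iff, Set.mem_prod, inputs, labels, funext_iff, forall_and]
    rw [hset, Measure.pi_pi]
    refine Finset.prod_congr rfl fun j _ => ?_
    rw [labelLaw_prod_singleton ρ hg (hB j), withDensity_apply _ (hB j)]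
  · refine Measure.pi_eq fun B hB => ?_
    rw [withDensity_apply _ (MeasurableSet.univ_pi hB),
      ← lintegral_indicator (MeasurableSet.univ_pi hB)]
    have hind : ∀ x : Fin n → Inp d, (Set.univ.pi B).indicator
        (fun x => ∏ j, labelProb (g (x j)) (s j)) x
        = ∏ j, (B j).indicator (fun x => labelProb (g x) (s j)) (x j) := fun x => by
      by_cases hx : x ∈ Set.univ.pi B
      · rw [Set.indicator_of_mem hx]
        exact Finset.prod_congr rfl fun j _ =>
          (Set.indicator_of_mem (hx j (Set.mem_univ j)) fun x => labelProb (g x) (s j)).symm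
      · rw [Set.indicator_of_notMem hx]
        simp only [Set.mem_pi, Set.mem_univ, true_imp_iff, not_forall] at hx
        obtain ⟨j, hj⟩ := hx
        exact (Finset.prod_eq_zero (Finset.mem_univ j) (Set.indicator_of_notMem hj _)).symm
    simp only [hind]
    rw [lintegral_pi_prod ρ (fun j => (B j).indicator fun x => labelProb (g x) (s j))
      fun j => (measurable_labelProb hg (s j)).indicator (hB j)]
    refine Finset.prod_congr rfl fun j _ => ?_
    rw [lintegral_indicator (hB j), withDensity_apply _ (hB j)]

lemma setLIntegral_inputs_labels (hg : Measurable g) (hg1 : ∀ x, |g x| ≤ 1) (s : Fin n → Label)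
    {A : Set (Fin n → Inp d)} (hA : MeasurableSet A) {Φ : (Fin n → Inp d) → ℝ≥0∞}
    (hΦ : Measurable Φ) :
    ∫⁻ w in {w | inputs w ∈ A ∧ labels w = s}, Φ (inputs w) ∂(Measure.pi fun _ => labelLaw ρ g)
      = ∫⁻ x in A, (∏ j, labelProb (g (x j)) (s j)) * Φ x ∂(Measure.pi fun _ => ρ) := by
  have hp : Measurable fun x : Fin n → Inp d => ∏ j, labelProb (g (x j)) (s j) :=
    Finset.measurable_fun_prod _ fun j _ =>
      measurable_labelProb (hg.comp (measurable_pi_apply j)) (s j)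
  have h1 : {w : Fin n → Inp d × Label | inputs w ∈ A ∧ labels w = s}
      = inputs ⁻¹' A ∩ labels ⁻¹' {s} := rfl
  rw [h1, ← Measure.restrict_restrict (measurable_inputs hA),
    ← setLIntegral_map hA hΦ measurable_inputs, map_inputs_restrict_labels ρ hg hg1 s,
    setLIntegral_withDensity_eq_setLIntegral_mul _ hp hΦ hA]
  rfl

lemma measure_eq_sum_labels {E : Type*} [MeasurableSpace E] {ι : Type*} [Fintype ι]
    [MeasurableSpace ι] [MeasurableSingletonClass ι] (μ : Measure E) {l : E → ι} (hl : Measurable l)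
    {B : Set E} (hB : MeasurableSet B) : μ B = ∑ s, μ (B ∩ l ⁻¹' {s}) := by
  rw [← tsum_fintype (L := .unconditional _), ← measure_iUnion]
  · congr 1; ext e; simp
  · exact fun s t hst => Set.disjoint_left.2 fun e he he' => hst (he.2.symm.trans he'.2)
  · exact fun s => hB.inter (hl (measurableSet_singleton s))

/-- A labelled sample whose labels are independent given the inputs is an i.i.d. sample. -/
lemma map_eq_pi_labelLaw {Ω : Type*} [MeasurableSpace Ω] {μ : Measure Ω} (hg : Measurable g)
    (hg1 : ∀ x, |g x| ≤ 1) {D : Ω → Fin n → Inp d × Label} (hD : Measurable D)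
    (h : ∀ (A : Set (Fin n → Inp d)), MeasurableSet A → ∀ s,
      μ {ω | inputs (D ω) ∈ A ∧ labels (D ω) = s}
        = ∫⁻ x in A, ∏ j, labelProb (g (x j)) (s j) ∂(Measure.pi fun _ => ρ)) :
    μ.map D = Measure.pi fun _ => labelLaw ρ g := by
  ext B hB
  rw [measure_eq_sum_labels _ measurable_labels hB, measure_eq_sum_labels (Measure.pi _)
    measurable_labels hB]
  refine Finset.sum_congr rfl fun s _ => ?_
  set A : Set (Fin n → Inp d) := (fun x j => (x j, s j)) ⁻¹' B with hA
  have hAm : MeasurableSet A :=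
    (measurable_pi_lambda _ fun j => (measurable_pi_apply j).prodMk measurable_const) hB
  have hset : B ∩ labels ⁻¹' {s} = {w | inputs w ∈ A ∧ labels w = s} := by
    ext w
    simp only [Set.mem_inter_iff, Set.mem_preimage, Set.mem_singleton_iff, hA]
    constructor
    · rintro ⟨h1, rfl⟩; exact ⟨h1, rfl⟩
    · rintro ⟨h1, rfl⟩; exact ⟨h1, rfl⟩
  have hBs : MeasurableSet (B ∩ labels ⁻¹' {s}) :=
    hB.inter (measurable_labels (measurableSet_singleton s))
  have h2 := setLIntegral_inputs_labels ρ hg hg1 s hAm (Φ := fun _ => 1) measurable_const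
  simp only [lintegral_const, one_mul, mul_one, Measure.restrict_apply MeasurableSet.univ,
    Set.univ_inter] at h2
  rw [Measure.map_apply hD hBs, hset, h2, ← h A hAm s]
  rfl

end PiLabelLaw

/-! ### The laws of the datasets -/

section Datasets

lemma sum_prod_eq_one {I T : Type*} [Fintype I] [DecidableEq I] [Fintype T] {p : I → T → ℝ≥0∞}
    (hp : ∀ i, ∑ t, p i t = 1) : ∑ s : I → T, ∏ i, p i (s i) = 1 := by
  have h := Finset.prod_univ_sum (fun _ : I => (Finset.univ : Finset T)) p
  rw [Fintype.piFinset_univ] at h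
  rw [← h]
  simp [hp]

/-- A marginal of a product distribution: the coordinates other than `i₀` sum out to 1. -/
lemma sum_ite_prod_eq {I T : Type*} [Fintype I] [DecidableEq I] [Fintype T] [DecidableEq T]
    {p : T → ℝ≥0∞} (hp : ∑ t, p t = 1) (i₀ : I) (t : T) :
    ∑ s : I → T, (if s i₀ = t then ∏ i, p (s i) else 0) = p t := by
  have h := Finset.prod_univ_sum (fun _ : I => (Finset.univ : Finset T))
    fun i u => if i = i₀ then (if u = t then p u else 0) else p u
  rw [Fintype.piFinset_univ] at h
  have h1 : ∀ s : I → T, (if s i₀ = t then ∏ i, p (s i) else 0)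
      = ∏ i, if i = i₀ then (if s i = t then p (s i) else 0) else p (s i) := fun s => by
    split_ifs with hs
    · refine Finset.prod_congr rfl fun i _ => ?_
      split_ifs with hi hi'
      · rfl
      · exact absurd (hi ▸ hs) hi'
      · rfl
    · exact (Finset.prod_eq_zero (Finset.mem_univ i₀) (by simp [hs])).symm
  simp only [h1]
  rw [← h, Finset.prod_eq_single i₀]
  · simp
  · intro i _ hi
    simp [hi, hp]
  · simp

variable {d m : ℕ} [NeZero m] {Θ Ω : Type*} [MeasurableSpace Ω] {μ : Measure Ω}
  {𝕏 : Set (Inp d)} {P : Measure (Inp d × Label)}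
  {f : Θ → Inp d → ℝ} {θstar : Θ} {x : ℕ → Ω → Inp d} {y₀ : ℕ → Ω → Label}
  {y : (n : ℕ) → Θ → Fin m → Fin n → Ω → Label} {π : ℕ → Ω → Equiv.Perm (Fin m)}

/-- A candidate is only almost everywhere measurable and bounded only on 𝕏; clipping a measurable
version to [-1, 1] changes nothing almost surely. -/
lemma IsRegressionFamily.exists_measurable_version (hP : InputAssumptions 𝕏 P)
    (hf : IsRegressionFamily 𝕏 P f θstar) (θ : Θ) :
    ∃ g : Inp d → ℝ, Measurable g ∧ (∀ z, |g z| ≤ 1) ∧ f θ =ᵐ[P.fst] g := by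
  have hm := (hf.memLp θ).1
  refine ⟨fun z => max (-1) (min 1 (hm.mk (f θ) z)),
    measurable_const.max (measurable_const.min hm.stronglyMeasurable_mk.measurable),
    fun z => abs_le.2 ⟨le_max_left _ _, max_le (by norm_num) (min_le_left _ _)⟩, ?_⟩
  filter_upwards [hm.ae_eq_mk, hP.mem_ae] with z hz hz𝕏
  have h := hf.range θ z hz𝕏
  rw [← hz, min_eq_right h.2, max_eq_right h.1]

lemma measurable_original (hres : IsResampling μ P f x y₀ y π) (n : ℕ) :
    Measurable fun ω (j : Fin n) => (x j ω, y₀ j ω) :=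
  measurable_pi_lambda _ fun j => (hres.measurable_x j).prodMk (hres.measurable_y₀ j)

/-- All the datasets of sample size `n`. -/
def datasets (x : ℕ → Ω → Inp d) (y : (n : ℕ) → Θ → Fin m → Fin n → Ω → Label) (n : ℕ) (θ : Θ)
    (ω : Ω) : Fin m → Fin n → Inp d × Label := fun i j => (x j ω, y n θ i j ω)

lemma measurable_datasets (hres : IsResampling μ P f x y₀ y π) (n : ℕ) (θ : Θ) :
    Measurable (datasets x y n θ) :=
  measurable_pi_lambda _ fun i => measurable_pi_lambda _ fun j =>
    (hres.measurable_x j).prodMk (hres.measurable_y n θ i j)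

lemma IsResampling.map_original [IsProbabilityMeasure μ] (hres : IsResampling μ P f x y₀ y π) (n : ℕ) :
    μ.map (fun ω (j : Fin n) => (x j ω, y₀ j ω)) = Measure.pi fun _ => P := by
  have hmeas : ∀ j, Measurable fun ω => (x j ω, y₀ j ω) := fun j =>
    (hres.measurable_x j).prodMk (hres.measurable_y₀ j)
  have hind : iIndepFun (fun (j : Fin n) ω => (x j ω, y₀ j ω)) μ :=
    hres.indep.precomp (g := fun j : Fin n => (j : ℕ)) Fin.val_injective
  rw [iIndepFun_iff_map_fun_eq_pi_map fun j : Fin n => (hmeas (j : ℕ)).aemeasurable] at hind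
  rw [hind]
  simp only [hres.law]

lemma map_inputs_pi (P : Measure (Inp d × Label)) [IsProbabilityMeasure P] (n : ℕ) :
    (Measure.pi fun _ : Fin n => P).map inputs = Measure.pi fun _ => P.fst :=
  (measurePreserving_pi (fun _ : Fin n => P) (fun _ => P.fst)
    fun _ => ⟨measurable_fst, rfl⟩).map_eq

/-- The law of the alternative labels in terms of a measurable version of the candidate. -/
lemma IsResampling.measure_resample [IsProbabilityMeasure μ] (hres : IsResampling μ P f x y₀ y π) {θ : Θ} {g : Inp d → ℝ}
    (hg : Measurable g) (hfg : f θ =ᵐ[P.fst] g) (n : ℕ) {A : Set (Fin n → Inp d × Label)}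
    (hA : MeasurableSet A) (s : {i : Fin m // i ≠ 0} → Fin n → Label) :
    μ {ω | (fun j : Fin n => (x j ω, y₀ j ω)) ∈ A ∧
          ∀ (i : {i : Fin m // i ≠ 0}) (j : Fin n), y n θ i j ω = s i j}
      = ∫⁻ w in A, ∏ i, ∏ j, labelProb (g (inputs w j)) (s i j) ∂(Measure.pi fun _ => P) := by
  have hD := measurable_original hres n
  have hm : Measurable fun w : Fin n → Inp d × Label =>
      ∏ i, ∏ j, labelProb (g (inputs w j)) (s i j) :=
    Finset.measurable_fun_prod _ fun i _ => Finset.measurable_fun_prod _ fun j _ =>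
      measurable_labelProb (hg.comp (measurable_fst.comp (measurable_pi_apply j))) _
  rw [hres.resample n θ A hA s, ← hres.map_original n, setLIntegral_map hA hm hD]
  refine lintegral_congr_ae (ae_restrict_of_ae ?_)
  have hx : ∀ j : Fin n, ∀ᵐ ω ∂μ, f θ (x j ω) = g (x j ω) := fun j => by
    have hmap : μ.map (x j) = P.fst := by
      rw [← hres.law j, Measure.fst, Measure.map_map measurable_fst
        ((hres.measurable_x j).prodMk (hres.measurable_y₀ j))]
      rfl
    rw [← hmap] at hfg
    exact ae_of_ae_map (hres.measurable_x j).aemeasurable hfg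
  filter_upwards [ae_all_iff.2 hx] with ω hω
  simp only [hω, inputs]

variable [IsProbabilityMeasure μ] [IsProbabilityMeasure P]

/-- The datasets with alternative labels are i.i.d. samples. -/
lemma IsResampling.map_dataset (hres : IsResampling μ P f x y₀ y π) {θ : Θ} {g : Inp d → ℝ}
    (hg : Measurable g) (hg1 : ∀ z, |g z| ≤ 1) (hfg : f θ =ᵐ[P.fst] g) (n : ℕ) {i₀ : Fin m}
    (hi₀ : i₀ ≠ 0) :
    μ.map (fun ω (j : Fin n) => (x j ω, y n θ i₀ j ω)) = Measure.pi fun _ => labelLaw P.fst g := by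
  have hD : Measurable fun ω (j : Fin n) => (x j ω, y n θ i₀ j ω) :=
    measurable_pi_lambda _ fun j => (hres.measurable_x j).prodMk (hres.measurable_y n θ i₀ j)
  refine map_eq_pi_labelLaw P.fst hg hg1 hD fun A hA t => ?_
  let I := {i : Fin m // i ≠ 0}
  let l : Ω → I → Fin n → Label := fun ω i j => y n θ i j ω
  have hl : Measurable l := measurable_pi_lambda _ fun i => measurable_pi_lambda _ fun j =>
    hres.measurable_y n θ i j
  have hB : MeasurableSet {ω | inputs (fun j : Fin n => (x j ω, y n θ i₀ j ω)) ∈ A ∧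
      labels (fun j : Fin n => (x j ω, y n θ i₀ j ω)) = t} :=
    ((measurable_inputs.comp hD) hA).inter
      ((measurable_labels.comp hD) (measurableSet_singleton t))
  have hA' : MeasurableSet (inputs ⁻¹' A : Set (Fin n → Inp d × Label)) := measurable_inputs hA
  have hp : ∀ s : I → Fin n → Label, Measurable fun w : Fin n → Inp d × Label =>
      ∏ i, ∏ j, labelProb (g (inputs w j)) (s i j) := fun s =>
    Finset.measurable_fun_prod _ fun i _ => Finset.measurable_fun_prod _ fun j _ =>
      measurable_labelProb (hg.comp (measurable_fst.comp (measurable_pi_apply j))) _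
  have hpt : Measurable fun z : Fin n → Inp d => ∏ j, labelProb (g (z j)) (t j) :=
    Finset.measurable_fun_prod _ fun j _ =>
      measurable_labelProb (hg.comp (measurable_pi_apply j)) _
  have hterm : ∀ s : I → Fin n → Label,
      μ ({ω | inputs (fun j : Fin n => (x j ω, y n θ i₀ j ω)) ∈ A ∧
        labels (fun j : Fin n => (x j ω, y n θ i₀ j ω)) = t} ∩ l ⁻¹' {s})
      = ∫⁻ w in inputs ⁻¹' A, (if s ⟨i₀, hi₀⟩ = t
          then ∏ i, ∏ j, labelProb (g (inputs w j)) (s i j) else 0) ∂(Measure.pi fun _ => P) := by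
    intro s
    split_ifs with hs
    · rw [← hres.measure_resample hg hfg n hA' s]
      congr 1
      ext ω
      simp only [Set.mem_inter_iff, Set.mem_ofPred_eq, Set.mem_preimage, Set.mem_singleton_iff, l,
        funext_iff, labels]
      constructor
      · rintro ⟨⟨h1, -⟩, h2⟩
        exact ⟨h1, h2⟩
      · rintro ⟨h1, h2⟩
        exact ⟨⟨h1, fun j => (h2 ⟨i₀, hi₀⟩ j).trans (congrFun hs j)⟩, h2⟩
    · rw [lintegral_zero]
      convert measure_empty (μ := μ)
      ext ω
      simp only [Set.mem_inter_iff, Set.mem_ofPred_eq, Set.mem_preimage, Set.mem_singleton_iff,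
        Set.mem_empty_iff_false, iff_false, not_and]
      rintro ⟨-, h2⟩ rfl
      exact hs h2
  rw [measure_eq_sum_labels μ hl hB]
  simp only [hterm]
  rw [← lintegral_finsetSum]
  -- Summing over the labels of the other alternative datasets leaves the marginal law of dataset
  -- `i₀`.
  · have hsum : ∀ w : Fin n → Inp d × Label, ∑ s : I → Fin n → Label, (if s ⟨i₀, hi₀⟩ = t
        then ∏ i, ∏ j, labelProb (g (inputs w j)) (s i j) else 0)
        = ∏ j, labelProb (g (inputs w j)) (t j) := fun w =>
      sum_ite_prod_eq (p := fun u : Fin n → Label => ∏ j, labelProb (g (inputs w j)) (u j))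
        (sum_prod_eq_one fun j => sum_labelProb (hg1 _)) _ _
    simp only [hsum]
    rw [← map_inputs_pi P n, setLIntegral_map hA hpt measurable_inputs]
  · intro s _
    split_ifs
    · exact hp s
    · exact measurable_const

/-- The joint law of all the datasets generated from the true regression function. -/
lemma IsResampling.measure_joint (hres : IsResampling μ P f x y₀ y π) {θ : Θ} {g : Inp d → ℝ}
    (hg : Measurable g) (hg1 : ∀ z, |g z| ≤ 1) (hfg : f θ =ᵐ[P.fst] g)
    (hPg : P = labelLaw P.fst g) (n : ℕ) {A : Set (Fin n → Inp d)} (hA : MeasurableSet A)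
    (s : Fin m → Fin n → Label) :
    μ {ω | (fun j : Fin n => x j ω) ∈ A ∧ (fun i j => y n θ i j ω) = s}
      = ∫⁻ z in A, ∏ i, ∏ j, labelProb (g (z j)) (s i j) ∂(Measure.pi fun _ => P.fst) := by
  have hA' : MeasurableSet {w : Fin n → Inp d × Label | inputs w ∈ A ∧ labels w = s 0} :=
    (measurable_inputs hA).inter (measurable_labels (measurableSet_singleton _))
  have h1 := hres.measure_resample hg hfg n hA' fun i j => s i j
  have hset : {ω | (fun j : Fin n => x j ω) ∈ A ∧ (fun i j => y n θ i j ω) = s}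
      = {ω | (fun j : Fin n => (x j ω, y₀ j ω)) ∈
          {w : Fin n → Inp d × Label | inputs w ∈ A ∧ labels w = s 0} ∧
          ∀ (i : {i : Fin m // i ≠ 0}) (j : Fin n), y n θ i j ω = s i j} := by
    ext ω
    simp only [Set.mem_ofPred_eq, funext_iff, labels]
    constructor
    · rintro ⟨h, h'⟩
      exact ⟨⟨h, fun j => by rw [← hres.original n θ j ω, h']⟩, fun i j => h' i j⟩
    · rintro ⟨⟨h, h'⟩, h''⟩
      refine ⟨h, fun i j => ?_⟩
      by_cases hi : i = 0
      · subst hi; rw [hres.original, h']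
      · exact h'' ⟨i, hi⟩ j
  have hΦ : Measurable fun z : Fin n → Inp d =>
      ∏ i : {i : Fin m // i ≠ 0}, ∏ j, labelProb (g (z j)) (s i j) :=
    Finset.measurable_fun_prod _ fun i _ => Finset.measurable_fun_prod _ fun j _ =>
      measurable_labelProb (hg.comp (measurable_pi_apply j)) _
  -- The resampling yields the factors i ≠ 0. The factor i = 0 of the original labels has the same
  -- form because P has regression function `g`; this is where the candidate must be the true one.
  have h2 := setLIntegral_inputs_labels P.fst hg hg1 (s 0) hA hΦ
  rw [← hPg] at h2
  rw [hset, h1]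
  refine h2.trans (lintegral_congr fun z => ?_)
  rw [← Finset.mul_prod_erase Finset.univ (fun i => ∏ j, labelProb (g (z j)) (s i j))
    (Finset.mem_univ 0)]
  congr 1
  exact (Finset.prod_subtype (Finset.univ.erase (0 : Fin m)) (by simp)
    fun i => ∏ j, labelProb (g (z j)) (s i j)).symm

/-- The datasets generated from the true regression function are exchangeable. -/
lemma IsResampling.measure_datasets_perm (hres : IsResampling μ P f x y₀ y π) {θ : Θ}
    {g : Inp d → ℝ} (hg : Measurable g) (hg1 : ∀ z, |g z| ≤ 1) (hfg : f θ =ᵐ[P.fst] g)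
    (hPg : P = labelLaw P.fst g) (n : ℕ) {B : Set (Fin m → Fin n → Inp d × Label)}
    (hB : MeasurableSet B) (τ : Equiv.Perm (Fin m)) :
    μ {ω | datasets x y n θ ω ∘ τ ∈ B} = μ {ω | datasets x y n θ ω ∈ B} := by
  -- The right-hand side does not contain τ: the joint density is a product over the datasets and
  -- hence symmetric in them.
  have key : ∀ τ : Equiv.Perm (Fin m), μ {ω | datasets x y n θ ω ∘ τ ∈ B}
      = ∑ s : Fin m → Fin n → Label, ∫⁻ z in {z : Fin n → Inp d | (fun i j => (z j, s i j)) ∈ B},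
        ∏ i, ∏ j, labelProb (g (z j)) (s i j) ∂(Measure.pi fun _ => P.fst) := by
    intro τ
    have hl : Measurable fun ω => (fun i j => y n θ (τ i) j ω : Fin m → Fin n → Label) :=
      measurable_pi_lambda _ fun i => measurable_pi_lambda _ fun j => hres.measurable_y n θ _ j
    have hBτ : MeasurableSet {ω | datasets x y n θ ω ∘ τ ∈ B} := by
      have : Measurable fun ω => datasets x y n θ ω ∘ τ :=
        measurable_pi_lambda _ fun i => (measurable_pi_apply (τ i)).comp (measurable_datasets hres n θ)
      exact this hB
    rw [measure_eq_sum_labels μ hl hBτ]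
    refine Finset.sum_congr rfl fun s _ => ?_
    have hA : MeasurableSet {z : Fin n → Inp d | (fun i j => (z j, s i j)) ∈ B} := by
      have : Measurable fun z : Fin n → Inp d =>
          (fun i j => (z j, s i j) : Fin m → Fin n → Inp d × Label) :=
        measurable_pi_lambda _ fun i => measurable_pi_lambda _ fun j =>
          (measurable_pi_apply j).prodMk measurable_const
      exact this hB
    have h1 := hres.measure_joint hg hg1 hfg hPg n hA fun i => s (τ.symm i)
    have h2 : ∀ z : Fin n → Inp d, ∏ i, ∏ j, labelProb (g (z j)) (s (τ.symm i) j)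
        = ∏ i, ∏ j, labelProb (g (z j)) (s i j) := fun z =>
      Equiv.prod_comp τ.symm fun i => ∏ j, labelProb (g (z j)) (s i j)
    simp only [h2] at h1
    rw [← h1]
    congr 1
    ext ω
    simp only [Set.mem_inter_iff, Set.mem_preimage, Set.mem_singleton_iff, Set.mem_ofPred_eq]
    constructor
    · rintro ⟨h3, h4⟩
      refine ⟨?_, ?_⟩
      · rw [← h4]; exact h3
      · rw [← h4]; funext i j; simp
    · rintro ⟨h3, h4⟩
      have h5 : (fun i j => y n θ (τ i) j ω) = s := by
        funext i j
        have := congrFun (congrFun h4 (τ i)) j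
        simpa using this
      refine ⟨?_, h5⟩
      rw [← h5] at h3
      exact h3
  rw [key τ]
  exact (key 1).symm

end Datasets

/-! ### Exact coverage -/

section Coverage

instance isStrictTotalOrder_precedes {m : ℕ} (σ : Equiv.Perm (Fin m)) (Z : Fin m → ℝ) :
    IsStrictTotalOrder (Fin m) (Precedes σ Z) where
  irrefl a h := by
    rcases h with h | h
    · exact lt_irrefl _ h
    · exact lt_irrefl _ h.2
  trans a b c hab hbc := by
    rcases hab with h | ⟨h, h'⟩ <;> rcases hbc with g | ⟨g, g'⟩
    · exact Or.inl (h.trans g)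
    · exact Or.inl (g ▸ h)
    · exact Or.inl (h ▸ g)
    · exact Or.inr ⟨h.trans g, h'.trans g'⟩
  trichotomous a b hab hba := by
    simp only [Precedes, not_or, not_and, not_lt] at hab hba
    have h := le_antisymm hba.1 hab.1
    exact σ.injective (le_antisymm (hba.2 h.symm) (hab.2 h))

lemma rankZero_eq_rankIn {m : ℕ} [NeZero m] (σ : Equiv.Perm (Fin m)) (Z : Fin m → ℝ) :
    rankZero σ Z = 1 + rankIn (Precedes σ Z) Finset.univ 0 := by
  classical
  unfold rankZero rankIn
  congr 2
  ext i
  simp only [Finset.mem_filter, Finset.mem_univ, true_and, and_iff_right_iff_imp]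
  rintro h rfl
  exact irrefl_of (Precedes σ Z) _ h

/-- Permuting the values together with the tie-breaking ranks permutes the whole order, ties
included. -/
lemma rankIn_precedes_comp {m : ℕ} (σ τ : Equiv.Perm (Fin m)) (Z : Fin m → ℝ) (a : Fin m) :
    rankIn (Precedes (σ * τ) (Z ∘ τ)) Finset.univ a
      = rankIn (Precedes σ Z) Finset.univ (τ a) := by
  classical
  unfold rankIn
  refine Finset.card_equiv τ fun i => ?_
  rw [Finset.mem_filter, Finset.mem_filter]
  simp only [Finset.mem_univ, true_and, Precedes, Function.comp_apply, Equiv.Perm.mul_apply]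

lemma totalDist_comp_perm {d n m : ℕ} (𝕏 : Set (Inp d)) (k : ℕ) (x : Fin n → Inp d)
    (y : Fin m → Fin n → Label) (τ : Equiv.Perm (Fin m)) :
    totalDist 𝕏 k x (y ∘ τ) = totalDist 𝕏 k x y ∘ τ := by
  funext i
  exact Equiv.sum_comp τ fun j => sqDist 𝕏 (knnEstimate k x (y (τ i))) (knnEstimate k x (y j))

lemma measurable_totalDist {d n m : ℕ} (𝕏 : Set (Inp d)) (k : ℕ) {α : Type*} [MeasurableSpace α]
    {x : Fin n → α → Inp d} (hx : ∀ j, Measurable (x j)) {y : Fin m → Fin n → α → Label}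
    (hy : ∀ i j, Measurable (y i j)) (i : Fin m) :
    Measurable fun a => totalDist 𝕏 k (fun j => x j a) (fun i j => y i j a) i := by
  have hF : ∀ i, Measurable fun p : α × Inp d =>
      knnEstimate k (fun j => x j p.1) (fun j => y i j p.1) p.2 := fun i =>
    measurable_knnEstimate (x := fun j (p : α × Inp d) => x j p.1)
      (fun j => (hx j).comp measurable_fst) (y := fun j (p : α × Inp d) => y i j p.1)
      (fun j => (hy i j).comp measurable_fst) measurable_snd k
  unfold totalDist sqDist
  refine Finset.measurable_fun_sum _ fun j _ => ?_
  exact ((((hF i).sub (hF j)).pow_const 2).stronglyMeasurable.integral_prod_right'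
    (ν := volume.restrict 𝕏)).measurable

lemma measurableSet_rankIn_precedes {m : ℕ} {α : Type*} [MeasurableSpace α] {Z : α → Fin m → ℝ}
    (hZ : ∀ i, Measurable fun a => Z a i) (σ : Equiv.Perm (Fin m)) (q : ℕ) (i : Fin m) :
    MeasurableSet {a | rankIn (Precedes σ (Z a)) Finset.univ i < q} := by
  classical
  have : Measurable fun a => rankIn (Precedes σ (Z a)) Finset.univ i := by
    simp only [rankIn, Finset.card_filter]
    exact Finset.measurable_fun_sum _ fun l _ => Measurable.ite
      ((measurableSet_lt (hZ l) (hZ i)).union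
        ((measurableSet_eq_fun (hZ l) (hZ i)).inter (MeasurableSet.const _)))
      measurable_const measurable_const
  exact this (measurableSet_Iio (a := q))

variable {d m : ℕ} {Θ Ω : Type*} [MeasurableSpace Ω] {μ : Measure Ω}
  {P : Measure (Inp d × Label)}
  {f : Θ → Inp d → ℝ} {x : ℕ → Ω → Inp d} {y₀ : ℕ → Ω → Label}
  {y : (n : ℕ) → Θ → Fin m → Fin n → Ω → Label} {π : ℕ → Ω → Equiv.Perm (Fin m)}

/-- The total distances as functions of the datasets, whose inputs agree. -/
noncomputable def datasetDist [NeZero m] {n : ℕ} (𝕏 : Set (Inp d)) (k : ℕ)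
    (D : Fin m → Fin n → Inp d × Label) (i : Fin m) : ℝ :=
  totalDist 𝕏 k (inputs (D 0)) (fun i => labels (D i)) i

lemma measurable_datasetDist [NeZero m] {n : ℕ} (𝕏 : Set (Inp d)) (k : ℕ) (i : Fin m) :
    Measurable fun D : Fin m → Fin n → Inp d × Label => datasetDist 𝕏 k D i := by
  have h : ∀ i j, Measurable fun D : Fin m → Fin n → Inp d × Label => D i j := fun i j =>
    (measurable_pi_apply j).comp (measurable_pi_apply i)
  exact measurable_totalDist 𝕏 k (fun j => measurable_fst.comp (h 0 j))
    (fun i j => measurable_snd.comp (h i j)) i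

/-- The probability that dataset `i` has one of the `q` smallest total distances does not depend on
`i`, for datasets generated from the true regression function. -/
lemma IsResampling.measure_rankIn_eq [NeZero m] [IsProbabilityMeasure μ] [IsProbabilityMeasure P]
    (hres : IsResampling μ P f x y₀ y π) {θ : Θ} {g : Inp d → ℝ}
    (hg : Measurable g) (hg1 : ∀ z, |g z| ≤ 1) (hfg : f θ =ᵐ[P.fst] g)
    (hPg : P = labelLaw P.fst g) (𝕏 : Set (Inp d)) (k q n : ℕ) (i : Fin m) :
    μ {ω | rankIn (Precedes (π n ω) (datasetDist 𝕏 k (datasets x y n θ ω))) Finset.univ i < q}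
      = μ {ω | rankIn (Precedes (π n ω) (datasetDist 𝕏 k (datasets x y n θ ω)))
          Finset.univ 0 < q} := by
  classical
  let C : Equiv.Perm (Fin m) → Fin m → Set (Fin m → Fin n → Inp d × Label) := fun σ i =>
    {D | rankIn (Precedes σ (datasetDist 𝕏 k D)) Finset.univ i < q}
  have hC : ∀ σ i, MeasurableSet (C σ i) := fun σ i =>
    measurableSet_rankIn_precedes (measurable_datasetDist 𝕏 k) σ q i
  have key : ∀ i,
      μ {ω | rankIn (Precedes (π n ω) (datasetDist 𝕏 k (datasets x y n θ ω))) Finset.univ i < q}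
      = ∑ σ, μ {ω | datasets x y n θ ω ∈ C σ i} * (m.factorial : ℝ≥0∞)⁻¹ := by
    intro i
    have hσ : ∀ σ, μ {ω | datasets x y n θ ω ∈ C σ i} * (m.factorial : ℝ≥0∞)⁻¹
        = μ {ω | datasets x y n θ ω ∈ C σ i ∧ π n ω = σ} := fun σ =>
      (hres.permutation n θ _ (hC σ i) σ).symm
    simp only [hσ]
    rw [← measure_biUnion_finset]
    · congr 1
      ext ω
      simp [C]
    · intro σ _ σ' _ hne
      refine Set.disjoint_left.2 fun ω h h' => hne ?_
      exact h.2.symm.trans h'.2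
    · intro σ _
      exact ((measurable_datasets hres n θ) (hC σ i)).inter (hres.measurable_π n σ)
  -- Interchanging datasets 0 and i in the data preserves their law by exchangeability, and
  -- multiplying by the same transposition preserves the uniform law of the tie-breaking
  -- permutation.
  rw [key, key, ← Equiv.sum_comp (Equiv.mulRight (Equiv.swap 0 i))
    fun σ => μ {ω | datasets x y n θ ω ∈ C σ 0} * (m.factorial : ℝ≥0∞)⁻¹]
  refine Finset.sum_congr rfl fun σ _ => ?_
  congr 1
  rw [← hres.measure_datasets_perm hg hg1 hfg hPg n
    (hC (Equiv.mulRight (Equiv.swap 0 i) σ) 0) (Equiv.swap 0 i)]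
  congr 1
  ext ω
  have h1 : datasetDist 𝕏 k (datasets x y n θ ω ∘ Equiv.swap 0 i)
      = datasetDist 𝕏 k (datasets x y n θ ω) ∘ Equiv.swap 0 i :=
    totalDist_comp_perm 𝕏 k (fun j => x j ω) (fun i j => y n θ i j ω) (Equiv.swap 0 i)
  simp only [Set.mem_ofPred_eq, C, h1, Equiv.coe_mulRight, rankIn_precedes_comp,
    Equiv.swap_apply_left]

/-- Exact coverage: the rank of the original dataset is uniformly distributed. -/
lemma IsResampling.measure_rankZero_le [NeZero m] [IsProbabilityMeasure μ]
    [IsProbabilityMeasure P] (hres : IsResampling μ P f x y₀ y π) {θ : Θ} {g : Inp d → ℝ}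
    (hg : Measurable g) (hg1 : ∀ z, |g z| ≤ 1) (hfg : f θ =ᵐ[P.fst] g)
    (hPg : P = labelLaw P.fst g) (𝕏 : Set (Inp d)) {k q n : ℕ} (hqm : q ≤ m) :
    μ {ω | rankZero (π n ω) (totalDist 𝕏 k (fun j : Fin n => x j ω) fun i j => y n θ i j ω) ≤ q}
      = (q : ℝ≥0∞) / m := by
  classical
  let r : Ω → Fin m → ℕ := fun ω i =>
    rankIn (Precedes (π n ω) (datasetDist 𝕏 k (datasets x y n θ ω))) Finset.univ i
  have hset : {ω | rankZero (π n ω) (totalDist 𝕏 k (fun j : Fin n => x j ω)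
      fun i j => y n θ i j ω) ≤ q} = {ω | r ω 0 < q} := by
    ext ω
    simp only [Set.mem_ofPred_eq, rankZero_eq_rankIn]
    rw [add_comm, Nat.add_one_le_iff]
    rfl
  have hmeas : ∀ i, MeasurableSet {ω | r ω i < q} := fun i => by
    have : {ω | r ω i < q} = ⋃ σ, {ω | rankIn (Precedes σ (datasetDist 𝕏 k
        (datasets x y n θ ω))) Finset.univ i < q} ∩ {ω | π n ω = σ} := by
      ext ω; simp [r]
    rw [this]
    exact MeasurableSet.iUnion fun σ => (measurableSet_rankIn_precedes
      (fun i => (measurable_datasetDist 𝕏 k i).comp (measurable_datasets hres n θ)) σ q i).inter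
      (hres.measurable_π n σ)
  -- At every outcome exactly q of the m datasets have rank below q, as the order is strict and
  -- total.
  have hsum : ∑ i, μ {ω | r ω i < q} = q := by
    have h1 : ∀ i, μ {ω | r ω i < q} = ∫⁻ ω, {ω | r ω i < q}.indicator 1 ω ∂μ := fun i =>
      (lintegral_indicator_one (hmeas i)).symm
    simp only [h1]
    rw [← lintegral_finsetSum _ fun i _ => measurable_one.indicator (hmeas i)]
    have h2 : ∀ ω, ∑ i, {ω | r ω i < q}.indicator (1 : Ω → ℝ≥0∞) ω = q := fun ω => by
      simp only [Set.indicator_apply, Set.mem_ofPred_eq, Pi.one_apply, Finset.sum_boole]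
      exact_mod_cast card_filter_rankIn_lt _ Finset.univ (by simpa using hqm)
    simp [h2]
  have hconst : ∀ i, μ {ω | r ω i < q} = μ {ω | r ω 0 < q} := fun i =>
    hres.measure_rankIn_eq hg hg1 hfg hPg 𝕏 k q n i
  simp only [hconst, Finset.sum_const, Finset.card_univ, Fintype.card_fin, nsmul_eq_mul] at hsum
  rw [hset, ← hsum, ENNReal.eq_div_iff (by simpa using NeZero.ne m) (by simp)]

end Coverage

/-! ### Strong consistency -/

section Consistency

variable {d m : ℕ} [NeZero m] {Θ Ω : Type*} [MeasurableSpace Ω] {μ : Measure Ω}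
  {𝕏 : Set (Inp d)} {P : Measure (Inp d × Label)}
  {f : Θ → Inp d → ℝ} {θstar : Θ} {x : ℕ → Ω → Inp d} {y₀ : ℕ → Ω → Label}
  {y : (n : ℕ) → Θ → Fin m → Fin n → Ω → Label} {π : ℕ → Ω → Equiv.Perm (Fin m)}

/-- Points are Lebesgue-null only in positive dimension. -/
lemma InputAssumptions.nullSingletonClass (hd : 1 ≤ d) (hP : InputAssumptions 𝕏 P) :
    NullSingletonClass P.fst := by
  have : NeZero d := ⟨by omega⟩
  exact ⟨fun z => hP.absCont (measure_singleton z)⟩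

/-- A measurable version of the regression function determines the law of `(X, Y)`. -/
lemma IsRegressionFamily.eq_labelLaw [IsProbabilityMeasure P]
    (hf : IsRegressionFamily 𝕏 P f θstar) {g : Inp d → ℝ} (hg : Measurable g)
    (hg1 : ∀ z, |g z| ≤ 1) (hfg : f θstar =ᵐ[P.fst] g) : P = labelLaw P.fst g := by
  refine eq_labelLaw_of_condExp P hg hg1 (hf.regression.trans ?_)
  exact ae_of_ae_map measurable_fst.aemeasurable hfg

/-- Different candidates also have a positive distance for Lebesgue measure on the input space. -/
lemma IsRegressionFamily.integral_sub_sq_pos [IsProbabilityMeasure P]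
    (hP : InputAssumptions 𝕏 P) (hf : IsRegressionFamily 𝕏 P f θstar) {θ₁ θ₂ : Θ}
    (hne : θ₁ ≠ θ₂) {g₁ g₂ : Inp d → ℝ} (hg₁ : Measurable g₁) (hg₂ : Measurable g₂)
    (h₁ : ∀ z, |g₁ z| ≤ 1) (h₂ : ∀ z, |g₂ z| ≤ 1) (hf₁ : f θ₁ =ᵐ[P.fst] g₁)
    (hf₂ : f θ₂ =ᵐ[P.fst] g₂) : 0 < ∫ z in 𝕏, (g₁ z - g₂ z) ^ 2 := by
  have : IsFiniteMeasure (volume.restrict 𝕏) := ⟨by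
    rw [Measure.restrict_apply_univ]; exact hP.compact.measure_lt_top⟩
  have hm : Measurable fun z => (g₁ z - g₂ z) ^ 2 := (hg₁.sub hg₂).pow_const 2
  have hi : Integrable (fun z => (g₁ z - g₂ z) ^ 2) (volume.restrict 𝕏) :=
    integrable_of_measurable_of_abs_le hm (2 ^ 2) fun z =>
      abs_pow_le_pow_of_abs_le ((abs_sub _ _).trans (by linarith [h₁ z, h₂ z])) 2
  refine lt_of_le_of_ne (integral_nonneg fun z => sq_nonneg _) fun h0 => ?_
  have h3 := (integral_eq_zero_iff_of_nonneg (fun z => sq_nonneg _) hi).1 h0.symm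
  refine hf.injective θ₁ θ₂ hne (integral_eq_zero_of_ae ?_)
  -- If the Lebesgue distance were zero, absolute continuity of the input law would make its own
  -- distance zero, against the injectivity of the parametrization.
  have h4 : ∀ᵐ z ∂P.fst, z ∈ 𝕏 → (g₁ z - g₂ z) ^ 2 = 0 :=
    hP.absCont ((ae_restrict_iff' hP.compact.measurableSet).1 h3)
  filter_upwards [h4, hP.mem_ae, hf₁, hf₂] with z hz hz𝕏 hz₁ hz₂
  rw [hz₁, hz₂]
  exact hz hz𝕏

/-- The estimates of all the datasets converge in mean, almost surely. -/
lemma IsResampling.ae_tendsto_knnError_datasets [IsProbabilityMeasure μ] [IsProbabilityMeasure P]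
    [NullSingletonClass P.fst] (hres : IsResampling μ P f x y₀ y π) {θ : Θ} {g gstar : Inp d → ℝ}
    (hg : Measurable g) (hg1 : ∀ z, |g z| ≤ 1) (hfg : f θ =ᵐ[P.fst] g)
    (hgs : Measurable gstar) (hgs1 : ∀ z, |gstar z| ≤ 1) (hPg : P = labelLaw P.fst gstar)
    {k : ℕ → ℕ} (hkn : ∀ n, k n ≤ n) (hk : Tendsto k atTop atTop)
    (hk' : Tendsto (fun n => (k n : ℝ) / n) atTop (𝓝 0)) (i : Fin m) :
    ∀ᵐ ω ∂μ, Tendsto (fun n => ∫ z, |knnEstimate (k n) (fun j : Fin n => x j ω)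
      (fun j => y n θ i j ω) z - (if i = 0 then gstar z else g z)| ∂P.fst) atTop (𝓝 0) := by
  have hD : ∀ n, Measurable fun ω => datasets x y n θ ω i := fun n =>
    (measurable_pi_apply i).comp (measurable_datasets hres n θ)
  have key : ∀ h : Inp d → ℝ, Measurable h → (∀ z, |h z| ≤ 1) →
      (∀ n, μ.map (fun ω => datasets x y n θ ω i) = Measure.pi fun _ => labelLaw P.fst h) →
      ∀ᵐ ω ∂μ, Tendsto (fun n => ∫ z, |knnEstimate (k n) (fun j : Fin n => x j ω)
        (fun j => y n θ i j ω) z - h z| ∂P.fst) atTop (𝓝 0) := by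
    intro h hh hh1 hlaw
    have hfst := fst_labelLaw P.fst hh hh1
    have : NullSingletonClass (labelLaw P.fst h).fst := by rw [hfst]; infer_instance
    have := isProbabilityMeasure_labelLaw P.fst hh hh1
    have h1 := ae_tendsto_knnError (labelLaw P.fst h) μ hh hh1
      (integral_mul_residual_labelLaw P.fst hh hh1) hkn hk hk' hD hlaw
    simp only [knnError, hfst] at h1
    exact h1
  by_cases hi : i = 0
  · subst hi
    simp only [if_true]
    refine key gstar hgs hgs1 fun n => ?_
    rw [← hPg, ← hres.map_original n]
    congr 1
    funext ω j
    exact Prod.ext rfl (hres.original n θ j ω)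
  · simp only [hi, if_false]
    exact key g hg hg1 fun n => hres.map_dataset hg hg1 hfg n hi

/-- If `θ` is not the true parameter, then almost surely the original dataset eventually has the
largest total distance. -/
lemma IsResampling.ae_eventually_totalDist_lt [IsProbabilityMeasure μ] [IsProbabilityMeasure P]
    (hd : 1 ≤ d) (hm : 3 ≤ m) (hP : InputAssumptions 𝕏 P) (hf : IsRegressionFamily 𝕏 P f θstar)
    (hres : IsResampling μ P f x y₀ y π) {θ : Θ} (hθ : θ ≠ θstar)
    {k : ℕ → ℕ} (hkn : ∀ n, k n ≤ n) (hk : Tendsto k atTop atTop)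
    (hk' : Tendsto (fun n => (k n : ℝ) / n) atTop (𝓝 0)) :
    ∀ᵐ ω ∂μ, ∀ᶠ n in atTop, ∀ i : Fin m, i ≠ 0 →
      totalDist 𝕏 (k n) (fun j : Fin n => x j ω) (fun i j => y n θ i j ω) i
        < totalDist 𝕏 (k n) (fun j : Fin n => x j ω) (fun i j => y n θ i j ω) 0 := by
  have := hP.nullSingletonClass hd
  have : IsFiniteMeasure (volume.restrict 𝕏) := ⟨by
    rw [Measure.restrict_apply_univ]; exact hP.compact.measure_lt_top⟩
  obtain ⟨g, hg, hg1, hfg⟩ := hf.exists_measurable_version hP θ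
  obtain ⟨gs, hgs, hgs1, hfgs⟩ := hf.exists_measurable_version hP θstar
  have hΔ := hf.integral_sub_sq_pos hP hθ.symm hgs hg hgs1 hg1 hfgs hfg
  have hPg := hf.eq_labelLaw hgs hgs1 hfgs
  set Δ := ∫ z in 𝕏, (gs z - g z) ^ 2 with hΔdef
  -- The limits of the estimates: the true function for the original dataset, the candidate for all
  -- others.
  let G : Fin m → Inp d → ℝ := fun i z => if i = 0 then gs z else g z
  have hG : ∀ i, Measurable (G i) := fun i => by
    by_cases hi : i = 0
    · simpa only [G, hi, if_true] using hgs
    · simpa only [G, hi, if_false] using hg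
  have hG1 : ∀ i z, |G i z| ≤ 1 := fun i z => by
    simp only [G]
    split_ifs
    exacts [hgs1 z, hg1 z]
  have hlim : ∀ i j : Fin m, ∫ z in 𝕏, (G i z - G j z) ^ 2
      = if (i = 0 ↔ j = 0) then 0 else Δ := fun i j => by
    by_cases hi : i = 0 <;> by_cases hj : j = 0 <;> simp [G, hi, hj, hΔdef, sub_sq_comm (g _)]
  have hsum0 : ∑ j : Fin m, ∫ z in 𝕏, (G 0 z - G j z) ^ 2 = (m - 1) * Δ := by
    have : ∀ j : Fin m, ∫ z in 𝕏, (G 0 z - G j z) ^ 2 = Δ - if j = 0 then Δ else 0 := fun j => by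
      rw [hlim]
      by_cases hj : j = 0 <;> simp [hj]
    simp only [this, Finset.sum_sub_distrib, Finset.sum_const, Finset.card_univ, Fintype.card_fin,
      nsmul_eq_mul, Finset.sum_ite_eq', Finset.mem_univ, if_true]
    ring
  have hsum : ∀ i : Fin m, i ≠ 0 → ∑ j : Fin m, ∫ z in 𝕏, (G i z - G j z) ^ 2 = Δ := fun i hi => by
    have : ∀ j : Fin m, ∫ z in 𝕏, (G i z - G j z) ^ 2 = if j = 0 then Δ else 0 := fun j => by
      rw [hlim]
      by_cases hj : j = 0 <;> simp [hi, hj]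
    simp [this]
  have hconv := ae_all_iff.2 fun i =>
    hres.ae_tendsto_knnError_datasets hg hg1 hfg hgs hgs1 hPg hkn hk hk' i
  filter_upwards [hconv] with ω hω
  have hZ : ∀ i : Fin m, Tendsto (fun n => totalDist 𝕏 (k n) (fun j : Fin n => x j ω)
      (fun i j => y n θ i j ω) i) atTop (𝓝 (∑ j : Fin m, ∫ z in 𝕏, (G i z - G j z) ^ 2)) := by
    intro i
    refine tendsto_finsetSum _ fun j _ => ?_
    have hF : ∀ i n, Measurable (knnEstimate (k n) (fun j : Fin n => x j ω)
        (fun j => y n θ i j ω)) := fun i n =>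
      measurable_knnEstimate (x := fun (j : Fin n) (_ : Inp d) => x j ω)
        (fun _ => measurable_const) (y := fun j _ => y n θ i j ω) (fun _ => measurable_const)
        measurable_id (k n)
    exact tendsto_integral_sub_sq hP.fullSupport (hF i) (hF j) (hG i) (hG j)
      (fun n z => abs_knnEstimate_le _ _ _ _) (fun n z => abs_knnEstimate_le _ _ _ _)
      (hG1 i) (hG1 j) (hω i) (hω j)
  refine eventually_all.2 fun i => ?_
  by_cases hi : i = 0
  · simp [hi]
  · have hm3 : (3 : ℝ) ≤ m := by exact_mod_cast hm
    -- This is where m ≥ 3 is needed: for m = 2 both limits would equal Δ.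
    have hlt : Δ < (m - 1) * Δ := by nlinarith
    have h0 := hZ 0
    have h1 := hZ i
    rw [hsum0] at h0
    rw [hsum i hi] at h1
    filter_upwards [h1.eventually_lt h0 hlt] with n hn _
    exact hn

lemma rankZero_eq_of_forall_lt (σ : Equiv.Perm (Fin m)) {Z : Fin m → ℝ}
    (h : ∀ i, i ≠ 0 → Z i < Z 0) : rankZero σ Z = m := by
  classical
  unfold rankZero
  have hpos : 0 < m := Nat.pos_of_ne_zero (NeZero.ne m)
  have : (Finset.univ.filter fun i : Fin m => i ≠ 0 ∧ Precedes σ Z i 0)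
      = Finset.univ.erase 0 := by
    ext i
    simp only [Finset.mem_filter, Finset.mem_univ, true_and, Finset.mem_erase, and_true]
    exact ⟨fun h' => h'.1, fun h' => ⟨h', Or.inl (h i h')⟩⟩
  have hc : (Finset.univ.filter fun i : Fin m => i ≠ 0 ∧ Precedes σ Z i 0).card = m - 1 := by
    rw [this, Finset.card_erase_of_mem (Finset.mem_univ _), Finset.card_univ, Fintype.card_fin]
  convert (show 1 + (m - 1) = m by omega)

end Consistency

theorem theorem2 {d m : ℕ} [NeZero m] (hd : 1 ≤ d) (hm : 3 ≤ m)
    {Θ Ω : Type*} [MeasurableSpace Ω] (μ : Measure Ω) [IsProbabilityMeasure μ]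
    (𝕏 : Set (Inp d)) (P : Measure (Inp d × Label)) [IsProbabilityMeasure P]
    (hP : InputAssumptions 𝕏 P)
    (f : Θ → Inp d → ℝ) (θstar : Θ) (hf : IsRegressionFamily 𝕏 P f θstar)
    (x : ℕ → Ω → Inp d) (y₀ : ℕ → Ω → Label)
    (y : (n : ℕ) → Θ → Fin m → Fin n → Ω → Label) (π : ℕ → Ω → Equiv.Perm (Fin m))
    (hres : IsResampling μ P f x y₀ y π)
    (q : ℕ) (hq1 : 1 ≤ q) (hqm : q ≤ m)
    (k : ℕ → ℕ) (hk : ∀ n, k n ≤ n) :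
    (∀ n : ℕ, μ {ω | θstar ∈ randomRegion 𝕏 k q x y π n ω} = (q : ℝ≥0∞) / (m : ℝ≥0∞)) ∧
    (q < m → Tendsto k atTop atTop → Tendsto (fun n => (k n : ℝ) / (n : ℝ)) atTop (𝓝 0) →
      ∀ θ : Θ, θ ≠ θstar →
        μ (⋂ N : ℕ, ⋃ n ≥ N, {ω | θ ∈ randomRegion 𝕏 k q x y π n ω}) = 0) := by
  refine ⟨fun n => ?_, fun hq hk1 hk2 θ hθ => ?_⟩
  · obtain ⟨g, hg, hg1, hfg⟩ := hf.exists_measurable_version hP θstar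
    exact hres.measure_rankZero_le hg hg1 hfg (hf.eq_labelLaw hg hg1 hfg) 𝕏 hqm
  · have h := hres.ae_eventually_totalDist_lt hd hm hP hf hθ hk hk1 hk2
    refine measure_mono_null (fun ω hω => ?_) h
    simp only [Set.mem_compl_iff, Set.mem_ofPred_eq]
    intro hev
    obtain ⟨N, hN⟩ := eventually_atTop.1 hev
    simp only [Set.mem_iInter, Set.mem_iUnion] at hω
    obtain ⟨n, hn, hmem⟩ := hω N
    have h1 : rankZero (π n ω) (totalDist 𝕏 (k n) (fun j : Fin n => x j ω)
        fun i j => y n θ i j ω) ≤ q := hmem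
    rw [rankZero_eq_of_forall_lt _ (hN n hn)] at h1
    omega
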